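/- Let $\mathbb T^3=\mathbb R^3/\mathbb Z^3$ be the torus of volume one, let $\gamma>1$, $\mu>0$, $\lambda+2\mu>0$, and consider on $\mathbb T^3\times(0,\infty)$ the system $$\begin{aligned} &\partial_t\rho+\nabla\cdot(\rho u)=0,\\ &\partial_t(\rho u)+\nabla\cdot(\rho u\otimes u)+\nabla\rho=-\rho(u-v),\\ &\partial_t n+\nabla\cdot(nv)=0,\\ &\partial_t(nv)+\nabla\cdot(nv\otimes v)+\nabla (n^\gamma)-\mu\Delta v-(\mu+\lambda)\nabla(\nabla\cdot v)=\rho(u-v). \end{aligned}$$ A global classical solution is a quadruple $(\rho,u,n,v)$, with $\rho,n$ real-valued and $u,v$ $\mathbb R^3$-valued, that is continuous on $\mathbb T^3\times[0,\infty)$ and $C^1$ on $\mathbb T^3\times(0,\infty)$, for which $v(\cdot,t)$ is $C^2$ for each $t>0$ with second spatial derivatives continuous on $\mathbb T^3\times(0,\infty)$, and which satisfies the system pointwise for $t>0$; its initial data $(\rho_0,u_0,n_0,v_0)$ are its values at $t=0$. Put $$\rho_c(t)=\int_{\mathbb T^3}\rho\,dx,\quad n_c(t)=\int_{\mathbb T^3}n\,dx,\quad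 m_c(t)=\frac{\int_{\mathbb T^3}\rho u\,dx}{\int_{\mathbb T^3}\rho\,dx},\quad j_c(t)=\frac{\int_{\mathbb T^3}nv\,dx}{\int_{\mathbb T^3}n\,dx},$$ $$\mathcal L(t)=\int_{\mathbb T^3}\rho|u-m_c|^2dx+\int_{\mathbb T^3}(\rho-\rho_c)^2dx+\int_{\mathbb T^3}n|v-j_c|^2dx+|m_c-j_c|^2+\int_{\mathbb T^3}(n-n_c)^2dx,$$ $$\widetilde E_0=\int_{\mathbb T^3}\rho_0|u_0|^2dx+\int_{\mathbb T^3}(\rho_0-\rho_c(0))^2dx+\int_{\mathbb T^3}n_0|v_0|^2dx+\int_{\mathbb T^3}(n_0-n_c(0))^2dx.$$ **Theorem.** For all $\bar\rho,\bar n>0$ and all prescribed masses $\rho_*,n_*\in(0,\infty)$ there is $\varepsilon>0$, depending only on $\gamma,\mu,\lambda,\bar\rho,\bar n,\rho_*,n_*$, such that for every $M$ there are constants $K,C>0$, depending only on these quantities and $M$, with the following property. If $(\rho,u,n,v)$ is a global classical solution such that, on $\mathbb T^3\times[0,\infty)$, (i) $0\le\rho\le\bar\rho$ and $0\le n\le\bar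 n$, with $\rho_c(0)=\rho_*$ and $n_c(0)=n_*$; (ii) $|u|\le M$ and $|v|\le M$; (iii) $\widetilde E_0\le\varepsilon$; then $$\mathcal L(t)\le K\,\mathcal L(0)\,e^{-Ct}\qquad\text{for all } t\ge0 .$$ -/

import Mathlib

open MeasureTheory Set

namespace TwoPhase

noncomputable section

/-- Coordinates on `ℝ³`. A function on the torus `𝕋³ = ℝ³ / ℤ³` (of total volume one) is a function
of these coordinates that has period one in each of them. -/
abbrev Coord : Type := Fin 3 → ℝ

/-- Velocities: vectors of `ℝ³` with the Euclidean norm. -/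
abbrev Vel : Type := EuclideanSpace ℝ (Fin 3)

/-- `f` is (the lift to `ℝ³` of) a function on `𝕋³`. -/
def IsTorusFun {F : Type*} (f : Coord → F) : Prop :=
  ∀ i : Fin 3, Function.Periodic f (Pi.single i 1)

/-- The integral `∫_{𝕋³} f dx`, computed on the unit cube. -/
def torusInt {F : Type*} [NormedAddCommGroup F] [NormedSpace ℝ F] (f : Coord → F) : F :=
  ∫ x in Icc (0 : Coord) 1, f x

/-- The spatial partial derivative `∂_i f (x)`. -/
def pd (i : Fin 3) (f : Coord → ℝ) (x : Coord) : ℝ :=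
  fderiv ℝ f x (Pi.single i 1)

/-- The divergence `∇ · w`. -/
def div (w : Coord → Vel) (x : Coord) : ℝ :=
  ∑ j, pd j (fun y => w y j) x

/-- The Laplacian `Δ f`. -/
def lap (f : Coord → ℝ) (x : Coord) : ℝ :=
  ∑ j, pd j (pd j f) x

/-- The `i`-th component of the Lamé operator
`L v = - μ Δ v - (μ + lam) ∇ (∇ · v)`. -/
def lame (μ lam : ℝ) (w : Coord → Vel) (i : Fin 3) (x : Coord) : ℝ :=
  -μ * lap (fun y => w y i) x - (μ + lam) * pd i (div w) x

/-- Continuity on `[0,∞) × 𝕋³` and continuous differentiability in `(t,x)` on `(0,∞) × 𝕋³`. -/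
structure IsC1 {F : Type*} [NormedAddCommGroup F] [NormedSpace ℝ F]
    (f : ℝ → Coord → F) : Prop where
  periodic : ∀ t, 0 ≤ t → IsTorusFun (f t)
  cont : ContinuousOn (fun p : ℝ × Coord => f p.1 p.2) (Ici 0 ×ˢ univ)
  contDiff : ContDiffOn ℝ 1 (fun p : ℝ × Coord => f p.1 p.2) (Ioi 0 ×ˢ univ)

/-- `(ρ,u,n,v)` is a global classical solution on `𝕋³ × [0,∞)` of the isothermal Euler /
isentropic Navier–Stokes system coupled by drag, with pressure `n ^ γ` and viscosities `μ`, `lam`.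
The values at `t = 0` are its initial data; values at `t < 0` play no role. -/
structure IsGlobalClassicalSolution (γ μ lam : ℝ)
    (ρ : ℝ → Coord → ℝ) (u : ℝ → Coord → Vel) (n : ℝ → Coord → ℝ) (v : ℝ → Coord → Vel) :
    Prop where
  ρ_C1 : IsC1 ρ
  u_C1 : IsC1 u
  n_C1 : IsC1 n
  v_C1 : IsC1 v
  v_C2 : ∀ t, 0 < t → ContDiff ℝ 2 (v t)
  v_C2_cont : ContinuousOn (fun p : ℝ × Coord => iteratedFDeriv ℝ 2 (v p.1) p.2) (Ioi 0 ×ˢ univ)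
  /-- `∂_t ρ + ∇ · (ρ u) = 0` -/
  mass_ρ : ∀ t, 0 < t → ∀ x,
    deriv (fun s => ρ s x) t + div (fun y => ρ t y • u t y) x = 0
  /-- `∂_t (ρ u) + ∇ · (ρ u ⊗ u) + ∇ ρ = - ρ (u - v)` -/
  momentum_ρ : ∀ t, 0 < t → ∀ x, ∀ i : Fin 3,
    deriv (fun s => ρ s x * u s x i) t
      + ∑ j, pd j (fun y => ρ t y * u t y i * u t y j) x
      + pd i (ρ t) x
      = -(ρ t x * (u t x i - v t x i))
  /-- `∂_t n + ∇ · (n v) = 0` -/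
  mass_n : ∀ t, 0 < t → ∀ x,
    deriv (fun s => n s x) t + div (fun y => n t y • v t y) x = 0
  /-- `∂_t (n v) + ∇ · (n v ⊗ v) + ∇ (n ^ γ) + L v = ρ (u - v)` -/
  momentum_n : ∀ t, 0 < t → ∀ x, ∀ i : Fin 3,
    deriv (fun s => n s x * v s x i) t
      + ∑ j, pd j (fun y => n t y * v t y i * v t y j) x
      + pd i (fun y => n t y ^ γ) x
      + lame μ lam (v t) i x
      = ρ t x * (u t x i - v t x i)

/-- The mass `∫ ρ dx` of a density at a fixed time: this is `ρ_c`, and also `n_c`. -/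
def mass (r : Coord → ℝ) : ℝ := torusInt r

/-- The averaged velocity `∫ r w dx / ∫ r dx`: this is `m_c` for `(ρ,u)` and `j_c` for `(n,v)`. -/
def meanVel (r : Coord → ℝ) (w : Coord → Vel) : Vel :=
  (mass r)⁻¹ • torusInt (fun x => r x • w x)

/-- The energy
`∫ ρ |u|² + ∫ (ρ - ρ_c)² + ∫ n |v|² + ∫ (n - n_c)²` of a state. -/
def energy (r : Coord → ℝ) (w : Coord → Vel) (m : Coord → ℝ) (z : Coord → Vel) : ℝ :=
  torusInt (fun x => r x * ‖w x‖ ^ 2) + torusInt (fun x => (r x - mass r) ^ 2)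
    + torusInt (fun x => m x * ‖z x‖ ^ 2) + torusInt (fun x => (m x - mass m) ^ 2)

/-- The Lyapunov functional
`∫ ρ |u - m_c|² + ∫ (ρ - ρ_c)² + ∫ n |v - j_c|² + |m_c - j_c|² + ∫ (n - n_c)²` of a state. -/
def lyapunov (r : Coord → ℝ) (w : Coord → Vel) (m : Coord → ℝ) (z : Coord → Vel) : ℝ :=
  torusInt (fun x => r x * ‖w x - meanVel r w‖ ^ 2) + torusInt (fun x => (r x - mass r) ^ 2)
    + torusInt (fun x => m x * ‖z x - meanVel m z‖ ^ 2) + ‖meanVel r w - meanVel m z‖ ^ 2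
    + torusInt (fun x => (m x - mass m) ^ 2)

end

end TwoPhase

/-!
In the frame of the centre of mass, whose velocity `w` is constant because the total momentum is
conserved, the relative energy
`½ ∫ ρ |u - w|² + ½ ∫ n |v - w|² + ∫ H₁(ρ) + ∫ H₂(n)`,
with `H₁`, `H₂` the relative entropies of the two pressures with respect to the mean densities, is
dissipated at the rate `∫ ρ |u - v|² + μ ∫ |∇v|² + (μ + lam) ∫ (∇ · v)²`
(`TwoPhase.IsBoundedSolution.hasDerivAt_relEnergy`). By Poincaré's inequality the viscosity confines
`v` to its mean, and the drag confines `u` to `v`, so the dissipation controls the relative kinetic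
energy (`TwoPhase.kin_add_kin_le_dissipation`). It does not see the density fluctuations. These are
recovered from a compensating functional, formally `∫ (r - R) Δ⁻¹ ∇ · (r (z - w))` for a phase with
density `r`, velocity `z` and mean density `R`: by the momentum equation its derivative contains
`-∫ (r - R) p`, with `p` the pressure of the phase, and all other terms are controlled by the
dissipation because densities and velocities are bounded
(`TwoPhase.IsBoundedSolution.exists_hasDerivAt_cross`). A small multiple of the compensating
functional added to the relative energy therefore decays exponentially
(`TwoPhase.exists_decay`), and this sum is comparable to the Lyapunov functional. Smallness of the
initial energy is not needed, so any `ε` will do.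

Three points keep the argument elementary. The compensating functional is a finite sum over the
Fourier modes in a cube (`TwoPhase.cross`), and the error of the truncation tends to zero, locally
uniformly in time, as the cube grows. The isothermal entropy `ρ log ρ` is not differentiable on
vacuum, so it is replaced by a function of `ρ + δ`, at the cost of an error in the energy balance
that vanishes with `δ`. Solutions are differentiable only at positive times, so the decay is proved
between positive times and extended to the initial time by continuity.
-/


namespace TwoPhase

noncomputable section

/-! ### Integration and differentiation on the torus -/

lemma integrableOn_cube {F : Type*} [NormedAddCommGroup F] {f : Coord → F} (hf : Continuous f) :
    IntegrableOn f (Icc (0 : Coord) 1) :=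
  hf.continuousOn.integrableOn_compact isCompact_Icc

lemma torusInt_add {f g : Coord → ℝ} (hf : Continuous f) (hg : Continuous g) :
    torusInt (fun x => f x + g x) = torusInt f + torusInt g :=
  integral_add (integrableOn_cube hf) (integrableOn_cube hg)

lemma torusInt_sub {f g : Coord → ℝ} (hf : Continuous f) (hg : Continuous g) :
    torusInt (fun x => f x - g x) = torusInt f - torusInt g :=
  integral_sub (integrableOn_cube hf) (integrableOn_cube hg)

lemma torusInt_neg (f : Coord → ℝ) : torusInt (fun x => -f x) = -torusInt f :=
  integral_neg _

lemma torusInt_const_mul (c : ℝ) (f : Coord → ℝ) :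
    torusInt (fun x => c * f x) = c * torusInt f :=
  integral_const_mul _ _

lemma torusInt_sum {ι : Type*} (s : Finset ι) {f : ι → Coord → ℝ}
    (hf : ∀ i ∈ s, Continuous (f i)) :
    torusInt (fun x => ∑ i ∈ s, f i x) = ∑ i ∈ s, torusInt (f i) :=
  integral_finsetSum _ fun i hi => integrableOn_cube (hf i hi)

lemma volume_cube : (volume : Measure Coord).real (Icc (0 : Coord) 1) = 1 := by
  rw [Measure.real, Real.volume_Icc_pi]
  simp

lemma torusInt_const (c : ℝ) : torusInt (fun _ => c) = c := by
  simp [torusInt, volume_cube]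

lemma torusInt_mono {f g : Coord → ℝ} (hf : Continuous f) (hg : Continuous g)
    (h : ∀ x, f x ≤ g x) : torusInt f ≤ torusInt g :=
  integral_mono (integrableOn_cube hf) (integrableOn_cube hg) h

lemma torusInt_nonneg {f : Coord → ℝ} (h : ∀ x, 0 ≤ f x) : 0 ≤ torusInt f :=
  integral_nonneg h

lemma torusInt_vel_apply {f : Coord → Vel} (hf : Continuous f) (i : Fin 3) :
    torusInt f i = torusInt (fun x => f x i) :=
  ((EuclideanSpace.proj (𝕜 := ℝ) i).integral_comp_comm (integrableOn_cube hf)).symm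

section Pd

variable {f g : Coord → ℝ} {x : Coord} {i : Fin 3}

lemma pd_mul (hf : DifferentiableAt ℝ f x) (hg : DifferentiableAt ℝ g x) :
    pd i (fun y => f y * g y) x = pd i f x * g x + f x * pd i g x := by
  simp [pd, fderiv_fun_mul hf hg]; ring

lemma pd_const_mul (c : ℝ) (hf : DifferentiableAt ℝ f x) :
    pd i (fun y => c * f y) x = c * pd i f x := by
  simp [pd, fderiv_const_mul hf]

lemma pd_add_const (c : ℝ) : pd i (fun y => f y + c) x = pd i f x := by
  simp [pd]

lemma pd_sub_const (c : ℝ) : pd i (fun y => f y - c) x = pd i f x := by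
  simp [pd, fderiv_sub_const]

lemma pd_sub (hf : DifferentiableAt ℝ f x) (hg : DifferentiableAt ℝ g x) :
    pd i (fun y => f y - g y) x = pd i f x - pd i g x := by
  simp [pd, fderiv_fun_sub hf hg]

end Pd

lemma continuous_pd {f : Coord → ℝ} (hf : ContDiff ℝ 1 f) (i : Fin 3) : Continuous (pd i f) :=
  (hf.continuous_fderiv one_ne_zero).clm_apply continuous_const

lemma IsTorusFun.pd {f : Coord → ℝ} (hf : IsTorusFun f) (i : Fin 3) : IsTorusFun (pd i f) := by
  intro j x
  have : (fun y => f (y + Pi.single j 1)) = f := funext (hf j)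
  have h := fderiv_comp_add_right (𝕜 := ℝ) (f := f) (x := x) (Pi.single j (1 : ℝ))
  rw [this] at h
  simp [TwoPhase.pd, h]

/-- The integral of a derivative of a periodic function vanishes: in the divergence theorem on the
unit cube, the contributions of opposite faces cancel. -/
lemma torusInt_pd {f : Coord → ℝ} (hf : ContDiff ℝ 1 f) (hp : IsTorusFun f) (i : Fin 3) :
    torusInt (pd i f) = 0 := by
  classical
  have hd := hf.differentiable one_ne_zero
  have h := integral_divergence_of_hasFDerivAt_off_countable' (E := ℝ) (n := 2) (0 : Coord) 1
    zero_le_one (fun j => if j = i then f else 0)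
    (fun j x => if j = i then fderiv ℝ f x else 0) ∅ countable_empty
    (fun j => by split_ifs; exacts [hf.continuous.continuousOn, continuousOn_const])
    (fun x _ j => by
      split_ifs
      exacts [(hd x).hasFDerivAt, hasFDerivAt_const 0 x]) ?_
  · have hl : ∀ x : Coord, (∑ j, (if j = i then fderiv ℝ f x else 0) (Pi.single j 1))
        = pd i f x := by
      intro x
      rw [Finset.sum_eq_single i]
      · simp [pd]
      · intro j _ hj; simp [hj]
      · simp
    simp only [hl] at h
    change torusInt (pd i f) = _ at h
    rw [h]
    refine Finset.sum_eq_zero fun j _ => ?_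
    by_cases hj : j = i
    · subst hj
      simp only [if_true]
      rw [sub_eq_zero]
      congr 1
      funext x
      have : (j.insertNth ((1 : Coord) j) x : Coord)
          = j.insertNth ((0 : Coord) j) x + Pi.single j 1 := by
        ext k
        refine Fin.succAboveCases j ?_ (fun l => ?_) k
        · simp
        · simp [Fin.succAbove_ne]
      rw [this]
      exact hp j _
    · simp [hj]
  · refine integrableOn_cube (continuous_finsetSum _ fun j _ => ?_)
    by_cases hj : j = i
    · subst hj; simpa [pd] using! continuous_pd hf j
    · simp [hj, continuous_const]

lemma IsTorusFun.mul {f g : Coord → ℝ} (hf : IsTorusFun f) (hg : IsTorusFun g) :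
    IsTorusFun (fun x => f x * g x) := fun i x => by
  simp only [hf i x, hg i x]

/-- Integration by parts on the torus. -/
lemma torusInt_mul_pd {f g : Coord → ℝ} (hf : ContDiff ℝ 1 f) (hg : ContDiff ℝ 1 g)
    (hpf : IsTorusFun f) (hpg : IsTorusFun g) (i : Fin 3) :
    torusInt (fun x => f x * pd i g x) = -torusInt (fun x => pd i f x * g x) := by
  have h : torusInt (pd i (fun x => f x * g x)) = 0 := torusInt_pd (hf.mul hg) (hpf.mul hpg) i
  have e : pd i (fun x => f x * g x) = fun x => pd i f x * g x + f x * pd i g x :=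
    funext fun x => pd_mul (hf.differentiable one_ne_zero x) (hg.differentiable one_ne_zero x)
  rw [e, torusInt_add (f := fun x => pd i f x * g x) (g := fun x => f x * pd i g x)
    ((continuous_pd hf i).mul hg.continuous) (hf.continuous.mul (continuous_pd hg i))] at h
  linarith

/-! ### Functions of class `C¹` in time and space -/

section Time

variable {f g : ℝ → Coord → ℝ}

lemma IsC1.add (hf : IsC1 f) (hg : IsC1 g) : IsC1 (fun t x => f t x + g t x) where
  periodic t ht i x := by simp only [hf.periodic t ht i x, hg.periodic t ht i x]
  cont := hf.cont.add hg.cont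
  contDiff := hf.contDiff.add hg.contDiff

lemma IsC1.mul (hf : IsC1 f) (hg : IsC1 g) : IsC1 (fun t x => f t x * g t x) where
  periodic t ht i x := by simp only [hf.periodic t ht i x, hg.periodic t ht i x]
  cont := hf.cont.mul hg.cont
  contDiff := hf.contDiff.mul hg.contDiff

lemma IsC1.const (c : ℝ) : IsC1 (fun _ (_ : Coord) => c) where
  periodic _ _ _ _ := rfl
  cont := continuousOn_const
  contDiff := contDiffOn_const

/-- A `C¹` function of `x` alone, regarded as a function of time and space. -/
lemma IsC1.of_space {h : Coord → ℝ} (hh : ContDiff ℝ 1 h) (hp : IsTorusFun h) :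
    IsC1 (fun _ : ℝ => h) where
  periodic _ _ := hp
  cont := (hh.continuous.comp continuous_snd).continuousOn
  contDiff := (hh.comp contDiff_snd).contDiffOn

lemma IsC1.const_mul (c : ℝ) (hf : IsC1 f) : IsC1 (fun t x => c * f t x) := (IsC1.const c).mul hf

lemma IsC1.sub (hf : IsC1 f) (hg : IsC1 g) : IsC1 (fun t x => f t x - g t x) where
  periodic t ht i x := by simp only [hf.periodic t ht i x, hg.periodic t ht i x]
  cont := hf.cont.sub hg.cont
  contDiff := hf.contDiff.sub hg.contDiff

lemma IsC1.sub_const (hf : IsC1 f) (c : ℝ) : IsC1 (fun t x => f t x - c) := hf.sub (IsC1.const c)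

lemma IsC1.sum {ι : Type*} (s : Finset ι) {F : ι → ℝ → Coord → ℝ} (hF : ∀ k ∈ s, IsC1 (F k)) :
    IsC1 (fun t x => ∑ k ∈ s, F k t x) where
  periodic t ht i x := Finset.sum_congr rfl fun k hk => (hF k hk).periodic t ht i x
  cont := continuousOn_finsetSum _ fun k hk => (hF k hk).cont
  contDiff := ContDiffOn.sum fun k hk => (hF k hk).contDiff

lemma IsC1.apply {u : ℝ → Coord → Vel} (hu : IsC1 u) (i : Fin 3) : IsC1 (fun t x => u t x i) where
  periodic t ht j x := congrArg (fun a : Vel => a i) (hu.periodic t ht j x)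
  cont := (EuclideanSpace.proj (𝕜 := ℝ) i).continuous.comp_continuousOn hu.cont
  contDiff := (EuclideanSpace.proj (𝕜 := ℝ) i).contDiff.comp_contDiffOn hu.contDiff

lemma IsC1.comp {b : ℝ → ℝ} {s : Set ℝ} (hb : ContDiffOn ℝ 1 b s) (hf : IsC1 f)
    (hs : ∀ t, 0 ≤ t → ∀ x, f t x ∈ s) : IsC1 (fun t x => b (f t x)) where
  periodic t ht i x := by simp only [hf.periodic t ht i x]
  cont := hb.continuousOn.comp hf.cont fun p hp => hs p.1 hp.1 p.2
  contDiff := hb.comp hf.contDiff fun p hp => hs p.1 (le_of_lt (mem_prod.1 hp).1) p.2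

lemma isOpen_Ioi_prod : IsOpen (Ioi (0 : ℝ) ×ˢ (univ : Set Coord)) := isOpen_Ioi.prod isOpen_univ

lemma IsC1.contDiff_slice (hf : IsC1 f) {t : ℝ} (ht : 0 < t) : ContDiff ℝ 1 (f t) := by
  rw [← contDiffOn_univ]
  exact hf.contDiff.comp (f := fun x : Coord => (t, x)) (by fun_prop) fun x _ => ⟨ht, mem_univ x⟩

lemma IsC1.continuous_slice {F : Type*} [NormedAddCommGroup F] [NormedSpace ℝ F]
    {f : ℝ → Coord → F} (hf : IsC1 f) {t : ℝ} (ht : 0 ≤ t) : Continuous (f t) := by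
  rw [← continuousOn_univ]
  exact hf.cont.comp (f := fun x : Coord => (t, x)) (by fun_prop) fun x _ => ⟨ht, mem_univ x⟩

lemma IsC1.differentiableAt_slice (hf : IsC1 f) {t : ℝ} (ht : 0 < t) (x : Coord) :
    DifferentiableAt ℝ (f t) x :=
  (hf.contDiff_slice ht).differentiable one_ne_zero x

lemma IsC1.hasFDerivAt (hf : IsC1 f) {t : ℝ} (ht : 0 < t) (x : Coord) :
    HasFDerivAt (fun p : ℝ × Coord => f p.1 p.2)
      (fderiv ℝ (fun p : ℝ × Coord => f p.1 p.2) (t, x)) (t, x) :=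
  ((hf.contDiff.differentiableOn one_ne_zero).differentiableAt
    (isOpen_Ioi_prod.mem_nhds (mk_mem_prod ht (mem_univ x)))).hasFDerivAt

lemma IsC1.hasDerivAt_time' (hf : IsC1 f) {t : ℝ} (ht : 0 < t) (x : Coord) :
    HasDerivAt (fun s => f s x) (fderiv ℝ (fun p : ℝ × Coord => f p.1 p.2) (t, x) (1, 0)) t :=
  HasFDerivAt.comp_hasDerivAt (l := fun p : ℝ × Coord => f p.1 p.2) t (hf.hasFDerivAt ht x)
    ((hasDerivAt_id t).prodMk (hasDerivAt_const t x))

lemma IsC1.hasDerivAt_time (hf : IsC1 f) {t : ℝ} (ht : 0 < t) (x : Coord) :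
    HasDerivAt (fun s => f s x) (deriv (fun s => f s x) t) t :=
  (hf.hasDerivAt_time' ht x).differentiableAt.hasDerivAt

lemma IsC1.continuousOn_fderiv (hf : IsC1 f) (e : ℝ × Coord) :
    ContinuousOn (fun p => fderiv ℝ (fun p : ℝ × Coord => f p.1 p.2) p e) (Ioi 0 ×ˢ univ) :=
  (hf.contDiff.continuousOn_fderiv_of_isOpen isOpen_Ioi_prod le_rfl).clm_apply
    continuousOn_const

lemma IsC1.continuousOn_deriv (hf : IsC1 f) :
    ContinuousOn (fun p : ℝ × Coord => deriv (fun s => f s p.2) p.1) (Ioi 0 ×ˢ univ) :=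
  (hf.continuousOn_fderiv (1, 0)).congr fun p hp => (hf.hasDerivAt_time' hp.1 p.2).deriv

lemma IsC1.continuous_deriv (hf : IsC1 f) {t : ℝ} (ht : 0 < t) :
    Continuous (fun x => deriv (fun s => f s x) t) := by
  rw [← continuousOn_univ]
  exact hf.continuousOn_deriv.comp (f := fun x : Coord => (t, x)) (by fun_prop)
    fun x _ => ⟨ht, mem_univ x⟩

lemma IsC1.continuousOn_pd (hf : IsC1 f) (i : Fin 3) :
    ContinuousOn (fun p : ℝ × Coord => pd i (f p.1) p.2) (Ioi 0 ×ˢ univ) := by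
  refine (hf.continuousOn_fderiv (0, Pi.single i 1)).congr fun p hp => ?_
  have h := (hf.hasFDerivAt hp.1 p.2).comp p.2 ((hasFDerivAt_const p.1 p.2).prodMk
    (hasFDerivAt_id (𝕜 := ℝ) p.2))
  have h' : fderiv ℝ (f p.1) p.2 = _ := HasFDerivAt.fderiv h
  simp [pd, h']

/-- Differentiation under the integral over the torus. -/
lemma IsC1.hasDerivAt_torusInt (hf : IsC1 f) {t : ℝ} (ht : 0 < t) :
    HasDerivAt (fun s => torusInt (f s)) (torusInt (fun x => deriv (fun s => f s x) t)) t := by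
  have hsub : Icc (t / 2) (t + 1) ×ˢ Icc (0 : Coord) 1 ⊆ Ioi (0 : ℝ) ×ˢ univ := fun p hp =>
    ⟨lt_of_lt_of_le (half_pos ht) hp.1.1, mem_univ _⟩
  obtain ⟨K, hK⟩ := (isCompact_Icc.prod isCompact_Icc).exists_bound_of_continuousOn
    (hf.continuousOn_deriv.mono hsub)
  refine (hasDerivAt_integral_of_dominated_loc_of_deriv_le (bound := fun _ => K)
    (F' := fun s x => deriv (fun s => f s x) s)
    (Icc_mem_nhds (half_lt_self ht) (lt_add_one t)) ?_ ?_ ?_ ?_ ?_ ?_).2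
  · filter_upwards [lt_mem_nhds ht] with s hs
    exact (integrableOn_cube (hf.continuous_slice hs.le)).aestronglyMeasurable
  · exact integrableOn_cube (hf.continuous_slice ht.le)
  · exact (integrableOn_cube (hf.continuous_deriv ht)).aestronglyMeasurable
  · filter_upwards [ae_restrict_mem measurableSet_Icc] with x hx s hs
    exact hK (s, x) ⟨hs, hx⟩
  · exact integrableOn_cube continuous_const
  · exact Filter.Eventually.of_forall fun x s hs =>
      hf.hasDerivAt_time (lt_of_lt_of_le (half_pos ht) hs.1) x

lemma continuousOn_torusInt_of_continuousOn {F : Type*} [NormedAddCommGroup F] [NormedSpace ℝ F]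
    {f : ℝ → Coord → F}
    (hf : ContinuousOn (fun p : ℝ × Coord => f p.1 p.2) (Ici 0 ×ˢ univ)) :
    ContinuousOn (fun t => torusInt (f t)) (Ici 0) := by
  have hc : Continuous (Function.uncurry fun (t : ℝ) (x : Coord) => f (max t 0) x) :=
    hf.comp_continuous (f := fun p : ℝ × Coord => (max p.1 0, p.2)) (by fun_prop)
      fun p => mk_mem_prod (mem_Ici.2 (le_max_right _ _)) (mem_univ _)
  refine (continuous_parametric_integral_of_continuous (μ := volume) hc
    (isCompact_Icc (a := (0 : Coord)) (b := 1))).continuousOn.congr fun t ht => ?_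
  simp only [torusInt, max_eq_left (mem_Ici.1 ht)]

/-- A function continuous for positive times is bounded on a compact time interval. -/
lemma exists_bound_cube {h : ℝ → Coord → ℝ}
    (hh : ContinuousOn (fun p : ℝ × Coord => h p.1 p.2) (Ioi 0 ×ˢ univ)) {a b : ℝ} (ha : 0 < a) :
    ∃ K, 0 ≤ K ∧ ∀ t ∈ Icc a b, ∀ x ∈ Icc (0 : Coord) 1, |h t x| ≤ K := by
  have hsub : Icc a b ×ˢ Icc (0 : Coord) 1 ⊆ Ioi (0 : ℝ) ×ˢ univ := fun p hp =>
    ⟨lt_of_lt_of_le ha hp.1.1, mem_univ _⟩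
  obtain ⟨K, hK⟩ := (isCompact_Icc.prod isCompact_Icc).exists_bound_of_continuousOn (hh.mono hsub)
  exact ⟨max K 0, le_max_right _ _, fun t ht x hx => (hK (t, x) ⟨ht, hx⟩).trans (le_max_left _ _)⟩

end Time

/-! ### Fourier coefficients -/

/-- The phase `2π ξ · x` of the Fourier mode with frequency `ξ ∈ ℤ³`. -/
def phase (ξ : Fin 3 → ℤ) (x : Coord) : ℝ := 2 * Real.pi * ∑ j, ξ j * x j

/-- The cosine coefficient `∫ f cos (2π ξ · x) dx`, the real part of the `ξ`-th Fourier
coefficient. -/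
def fcos (ξ : Fin 3 → ℤ) (f : Coord → ℝ) : ℝ := torusInt fun x => f x * Real.cos (phase ξ x)

/-- The sine coefficient `∫ f sin (2π ξ · x) dx`, the negative of the imaginary part of the `ξ`-th
Fourier coefficient. -/
def fsin (ξ : Fin 3 → ℤ) (f : Coord → ℝ) : ℝ := torusInt fun x => f x * Real.sin (phase ξ x)

lemma contDiff_phase (ξ : Fin 3 → ℤ) {k : WithTop ℕ∞} : ContDiff ℝ k (phase ξ) := by
  unfold phase; fun_prop

@[fun_prop]
lemma continuous_phase (ξ : Fin 3 → ℤ) : Continuous (phase ξ) :=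
  (contDiff_phase ξ (k := 0)).continuous

lemma phase_add_single (ξ : Fin 3 → ℤ) (x : Coord) (i : Fin 3) (c : ℝ) :
    phase ξ (x + Pi.single i c) = phase ξ x + c * (2 * Real.pi * ξ i) := by
  have : ∑ j, (ξ j : ℝ) * (Pi.single i c : Coord) j = ξ i * c := by
    rw [Finset.sum_eq_single i] <;> simp +contextual
  simp only [phase, Pi.add_apply, mul_add, Finset.sum_add_distrib, this]
  ring

lemma hasFDerivAt_phase (ξ : Fin 3 → ℤ) (x : Coord) :
    HasFDerivAt (phase ξ) (fderiv ℝ (phase ξ) x) x :=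
  ((contDiff_phase ξ (k := 1)).differentiable one_ne_zero x).hasFDerivAt

lemma pd_phase (ξ : Fin 3 → ℤ) (x : Coord) (i : Fin 3) :
    pd i (phase ξ) x = 2 * Real.pi * ξ i := by
  have h := (hasFDerivAt_phase ξ x).hasLineDerivAt (Pi.single i 1)
  have h2 : HasDerivAt (fun t : ℝ => phase ξ (x + t • Pi.single i 1)) (2 * Real.pi * ξ i) 0 := by
    have e : (fun t : ℝ => phase ξ (x + t • Pi.single i 1))
        = fun t => phase ξ x + t * (2 * Real.pi * ξ i) := by
      funext t
      rw [← phase_add_single, ← Pi.single_smul]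
      simp
    rw [e]
    simpa using ((hasDerivAt_id (0 : ℝ)).mul_const (2 * Real.pi * ξ i)).const_add (phase ξ x)
  exact HasDerivAt.unique h h2

lemma pd_cos_phase (ξ : Fin 3 → ℤ) (i : Fin 3) (x : Coord) :
    pd i (fun x => Real.cos (phase ξ x)) x = -(2 * Real.pi * ξ i * Real.sin (phase ξ x)) := by
  rw [pd, (hasFDerivAt_phase ξ x).cos.fderiv]
  have := pd_phase ξ x i
  rw [pd] at this
  simp [this]; ring

lemma pd_sin_phase (ξ : Fin 3 → ℤ) (i : Fin 3) (x : Coord) :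
    pd i (fun x => Real.sin (phase ξ x)) x = 2 * Real.pi * ξ i * Real.cos (phase ξ x) := by
  rw [pd, (hasFDerivAt_phase ξ x).sin.fderiv]
  have := pd_phase ξ x i
  rw [pd] at this
  simp [this]; ring

lemma isTorusFun_cos_phase (ξ : Fin 3 → ℤ) : IsTorusFun fun x => Real.cos (phase ξ x) := by
  intro i x
  have : phase ξ (x + Pi.single i 1) = phase ξ x + ξ i * (2 * Real.pi) := by
    rw [phase_add_single]; ring
  simp only [this, Real.cos_add_int_mul_two_pi]

lemma isTorusFun_sin_phase (ξ : Fin 3 → ℤ) : IsTorusFun fun x => Real.sin (phase ξ x) := by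
  intro i x
  have : phase ξ (x + Pi.single i 1) = phase ξ x + ξ i * (2 * Real.pi) := by
    rw [phase_add_single]; ring
  simp only [this, Real.sin_add_int_mul_two_pi]

lemma contDiff_cos_phase (ξ : Fin 3 → ℤ) {k : WithTop ℕ∞} :
    ContDiff ℝ k fun x => Real.cos (phase ξ x) := (contDiff_phase ξ).cos

lemma contDiff_sin_phase (ξ : Fin 3 → ℤ) {k : WithTop ℕ∞} :
    ContDiff ℝ k fun x => Real.sin (phase ξ x) := (contDiff_phase ξ).sin

section Linear

variable (ξ : Fin 3 → ℤ) {f g : Coord → ℝ}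

lemma fcos_add (hf : Continuous f) (hg : Continuous g) :
    fcos ξ (fun x => f x + g x) = fcos ξ f + fcos ξ g := by
  simp only [fcos, add_mul]
  exact torusInt_add (by fun_prop) (by fun_prop)

lemma fsin_add (hf : Continuous f) (hg : Continuous g) :
    fsin ξ (fun x => f x + g x) = fsin ξ f + fsin ξ g := by
  simp only [fsin, add_mul]
  exact torusInt_add (by fun_prop) (by fun_prop)

lemma fcos_const_mul (c : ℝ) : fcos ξ (fun x => c * f x) = c * fcos ξ f := by
  simp only [fcos, mul_assoc, torusInt_const_mul]

lemma fsin_const_mul (c : ℝ) : fsin ξ (fun x => c * f x) = c * fsin ξ f := by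
  simp only [fsin, mul_assoc, torusInt_const_mul]

lemma fcos_neg : fcos ξ (fun x => -f x) = -fcos ξ f := by
  simp only [fcos, neg_mul, torusInt_neg]

lemma fsin_neg : fsin ξ (fun x => -f x) = -fsin ξ f := by
  simp only [fsin, neg_mul, torusInt_neg]

lemma fcos_sub (hf : Continuous f) (hg : Continuous g) :
    fcos ξ (fun x => f x - g x) = fcos ξ f - fcos ξ g := by
  simp only [fcos, sub_mul]
  exact torusInt_sub (by fun_prop) (by fun_prop)

lemma fsin_sub (hf : Continuous f) (hg : Continuous g) :
    fsin ξ (fun x => f x - g x) = fsin ξ f - fsin ξ g := by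
  simp only [fsin, sub_mul]
  exact torusInt_sub (by fun_prop) (by fun_prop)

lemma fcos_sum {ι : Type*} (s : Finset ι) {F : ι → Coord → ℝ} (hF : ∀ k ∈ s, Continuous (F k)) :
    fcos ξ (fun x => ∑ k ∈ s, F k x) = ∑ k ∈ s, fcos ξ (F k) := by
  simp only [fcos, Finset.sum_mul]
  exact torusInt_sum s fun k hk => (hF k hk).mul (by fun_prop)

lemma fsin_sum {ι : Type*} (s : Finset ι) {F : ι → Coord → ℝ} (hF : ∀ k ∈ s, Continuous (F k)) :
    fsin ξ (fun x => ∑ k ∈ s, F k x) = ∑ k ∈ s, fsin ξ (F k) := by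
  simp only [fsin, Finset.sum_mul]
  exact torusInt_sum s fun k hk => (hF k hk).mul (by fun_prop)

lemma fcos_pd (hf : ContDiff ℝ 1 f) (hp : IsTorusFun f) (i : Fin 3) :
    fcos ξ (pd i f) = 2 * Real.pi * ξ i * fsin ξ f := by
  have h := torusInt_mul_pd (contDiff_cos_phase ξ) hf (isTorusFun_cos_phase ξ) hp i
  simp only [pd_cos_phase] at h
  rw [fcos, fsin, ← torusInt_const_mul]
  simp only [mul_comm (pd i f _), h, ← torusInt_neg]
  congr 1; funext x; ring

lemma fsin_pd (hf : ContDiff ℝ 1 f) (hp : IsTorusFun f) (i : Fin 3) :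
    fsin ξ (pd i f) = -(2 * Real.pi * ξ i * fcos ξ f) := by
  have h := torusInt_mul_pd (contDiff_sin_phase ξ) hf (isTorusFun_sin_phase ξ) hp i
  simp only [pd_sin_phase] at h
  rw [fcos, fsin, ← torusInt_const_mul]
  simp only [mul_comm (pd i f _), h, ← torusInt_neg]
  congr 1; funext x; ring

end Linear

/-- The squared modulus of the `ξ`-th Fourier coefficient. -/
def modeSq (ξ : Fin 3 → ℤ) (f : Coord → ℝ) : ℝ := fcos ξ f ^ 2 + fsin ξ f ^ 2

lemma modeSq_nonneg (ξ : Fin 3 → ℤ) (f : Coord → ℝ) : 0 ≤ modeSq ξ f := by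
  unfold modeSq; positivity

lemma mFourier_neg_coe (ξ : Fin 3 → ℤ) (x : Coord) :
    UnitAddTorus.mFourier (-ξ) (fun i => (x i : UnitAddCircle))
      = (Real.cos (phase ξ x) : ℂ) - Real.sin (phase ξ x) * Complex.I := by
  have h : UnitAddTorus.mFourier (-ξ) (fun i => (x i : UnitAddCircle))
      = Complex.exp (-(phase ξ x : ℂ) * Complex.I) := by
    simp only [UnitAddTorus.mFourier, ContinuousMap.coe_mk, fourier_coe_apply, ← Complex.exp_sum]
    congr 1
    simp only [phase]
    push_cast
    rw [Finset.mul_sum, ← Finset.sum_neg_distrib, Finset.sum_mul]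
    refine Finset.sum_congr rfl fun i _ => ?_
    simp; ring
  rw [h, Complex.exp_mul_I]
  push_cast
  rw [Complex.cos_neg, Complex.sin_neg]; ring

lemma setIntegral_Ioc_cube {F : Type*} [NormedAddCommGroup F] [NormedSpace ℝ F] (f : Coord → F) :
    ∫ x in {x : Coord | ∀ i, x i ∈ Ioc ((0 : Coord) i) ((0 : Coord) i + 1)}, f x = torusInt f := by
  have : {x : Coord | ∀ i, x i ∈ Ioc ((0 : Coord) i) ((0 : Coord) i + 1)}
      = pi univ fun i => Ioc ((0 : Coord) i) ((1 : Coord) i) := by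
    ext x; simp
  rw [this, torusInt, volume_pi, setIntegral_congr_set Measure.univ_pi_Ioc_ae_eq_Icc]

/-- Parseval's identity on the torus. -/
lemma hasSum_modeSq {f : Coord → ℝ} (hf : Continuous f) :
    HasSum (fun ξ => modeSq ξ f) (torusInt fun x => f x ^ 2) := by
  let _ : MeasureSpace UnitAddCircle := ⟨AddCircle.haarAddCircle⟩
  have _ : IsProbabilityMeasure (volume : Measure UnitAddCircle) :=
    inferInstanceAs (IsProbabilityMeasure AddCircle.haarAddCircle)
  let r : UnitAddTorus (Fin 3) → Coord := fun y i => (AddCircle.equivIoc 1 0 (y i)).1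
  have hr : Measurable r := measurable_pi_lambda _ fun i =>
    measurable_subtype_coe.comp
      ((AddCircle.measurableEquivIoc 1 0).measurable.comp (measurable_pi_apply i))
  have hrx : ∀ x : Coord, (∀ i, x i ∈ Ioc ((0 : Coord) i) ((0 : Coord) i + 1)) →
      r (fun i => (x i : UnitAddCircle)) = x := by
    intro x hx
    funext i
    have := AddCircle.equivIoc_coe_of_mem (p := 1) (a := 0) (hx i)
    exact this
  let g : UnitAddTorus (Fin 3) → ℂ := fun y => (f (r y) : ℂ)
  have hgm : Measurable g := Complex.measurable_ofReal.comp (hf.measurable.comp hr)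
  obtain ⟨K, hK⟩ := (isCompact_Icc (a := (0 : Coord)) (b := 1)).exists_bound_of_continuousOn
    hf.continuousOn
  have hg : MemLp g 2 (volume : Measure (UnitAddTorus (Fin 3))) := by
    refine MemLp.of_bound hgm.aestronglyMeasurable K (Filter.Eventually.of_forall fun y => ?_)
    rw [Complex.norm_real]
    refine hK _ ⟨fun i => ?_, fun i => ?_⟩
    · exact (AddCircle.equivIoc 1 0 (y i)).2.1.le
    · have := (AddCircle.equivIoc (1 : ℝ) 0 (y i)).2.2
      simpa using this
  have hS : MeasurableSet {x : Coord | ∀ i, x i ∈ Ioc ((0 : Coord) i) ((0 : Coord) i + 1)} :=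
    MeasurableSet.univ_pi' fun i => measurableSet_Ioc
  have key := UnitAddTorus.hasSum_sq_mFourierCoeff (hg.toLp g)
  have e1 : (∫ t, ‖(hg.toLp g) t‖ ^ 2) = torusInt fun x => f x ^ 2 := by
    rw [integral_congr_ae (g := fun t => ‖g t‖ ^ 2)
      (by filter_upwards [hg.coeFn_toLp] with t ht; rw [ht]),
      UnitAddTorus.integral_preimage _ 0, ← setIntegral_Ioc_cube]
    refine setIntegral_congr_fun hS fun x hx => ?_
    simp only [g, hrx x hx, Complex.norm_real, Real.norm_eq_abs, sq_abs]
  have e2 : ∀ ξ, ‖UnitAddTorus.mFourierCoeff (hg.toLp g) ξ‖ ^ 2 = modeSq ξ f := by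
    intro ξ
    have : UnitAddTorus.mFourierCoeff (hg.toLp g) ξ
        = (fcos ξ f : ℂ) - (fsin ξ f : ℂ) * Complex.I := by
      have h1 : UnitAddTorus.mFourierCoeff (hg.toLp g) ξ = UnitAddTorus.mFourierCoeff g ξ :=
        integral_congr_ae (by filter_upwards [hg.coeFn_toLp] with t ht; rw [ht])
      rw [h1, UnitAddTorus.mFourierCoeff_eq_integral _ _ 0]
      have h2 : ∫ x in {x : Coord | ∀ i, x i ∈ Ioc ((0 : Coord) i) ((0 : Coord) i + 1)},
          UnitAddTorus.mFourier (-ξ) (fun i => (x i : UnitAddCircle))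
            • g (fun i => (x i : UnitAddCircle))
          = ∫ x in {x : Coord | ∀ i, x i ∈ Ioc ((0 : Coord) i) ((0 : Coord) i + 1)},
            (((f x * Real.cos (phase ξ x) : ℝ) : ℂ)
              - ((f x * Real.sin (phase ξ x) : ℝ) : ℂ) * Complex.I) := by
        refine setIntegral_congr_fun hS fun x hx => ?_
        simp only [g, hrx x hx, mFourier_neg_coe, smul_eq_mul]
        push_cast; ring
      rw [h2, setIntegral_Ioc_cube, torusInt, integral_sub, integral_mul_const,
        integral_complex_ofReal, integral_complex_ofReal]
      · rfl
      · exact integrableOn_cube (by fun_prop)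
      · exact integrableOn_cube (by fun_prop)
    rw [this, Complex.sq_norm, Complex.normSq_apply]
    simp [modeSq]; ring
  rw [← e1]
  simpa only [e2] using key

/-! ### Consequences of Parseval's identity -/

/-- The squared length `|ξ|²` of a frequency. -/
def freqSq (ξ : Fin 3 → ℤ) : ℝ := ∑ i, (ξ i : ℝ) ^ 2

lemma freqSq_nonneg (ξ : Fin 3 → ℤ) : 0 ≤ freqSq ξ := Finset.sum_nonneg fun _ _ => sq_nonneg _

lemma sq_le_freqSq (ξ : Fin 3 → ℤ) (i : Fin 3) : (ξ i : ℝ) ^ 2 ≤ freqSq ξ :=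
  Finset.single_le_sum (f := fun i => (ξ i : ℝ) ^ 2) (fun _ _ => sq_nonneg _) (Finset.mem_univ i)

lemma one_le_freqSq {ξ : Fin 3 → ℤ} (h : ξ ≠ 0) : 1 ≤ freqSq ξ := by
  obtain ⟨i, hi⟩ := Function.ne_iff.mp h
  refine le_trans ?_ (sq_le_freqSq ξ i)
  have : (1 : ℤ) ≤ ξ i ^ 2 := Int.add_one_le_iff.mpr (sq_pos_of_ne_zero hi)
  exact_mod_cast this

/-- The frequencies all of whose entries are at most `k` in absolute value. -/
def freqBox (k : ℕ) : Finset (Fin 3 → ℤ) := Fintype.piFinset fun _ => Finset.Icc (-k : ℤ) k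

lemma sq_le_freqSq_of_notMem {k : ℕ} {ξ : Fin 3 → ℤ} (h : ξ ∉ freqBox k) :
    (k : ℝ) ^ 2 ≤ freqSq ξ := by
  simp only [freqBox, Fintype.mem_piFinset, Finset.mem_Icc, not_forall] at h
  obtain ⟨i, hi⟩ := h
  refine le_trans ?_ (sq_le_freqSq ξ i)
  rw [sq_le_sq, Nat.abs_cast]
  have : (k : ℤ) ≤ |ξ i| := by
    by_contra hc
    exact hi (abs_le.mp (not_le.mp hc).le)
  exact_mod_cast this

/-- The Dirichlet integral `∫ |∇ f|²`. -/
def gradSq (f : Coord → ℝ) : ℝ := ∑ i, torusInt fun x => pd i f x ^ 2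

lemma one_le_four_pi_sq : (1 : ℝ) ≤ 4 * Real.pi ^ 2 := by nlinarith [Real.pi_gt_three]

/-- Bessel's inequality. -/
lemma sum_modeSq_le {f : Coord → ℝ} (hf : Continuous f) (s : Finset (Fin 3 → ℤ)) :
    ∑ ξ ∈ s, modeSq ξ f ≤ torusInt fun x => f x ^ 2 :=
  sum_le_hasSum s (fun ξ _ => modeSq_nonneg ξ f) (hasSum_modeSq hf)

lemma sum_modeSq_pd {f : Coord → ℝ} (hf : ContDiff ℝ 1 f) (hp : IsTorusFun f) (ξ : Fin 3 → ℤ) :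
    ∑ i, modeSq ξ (pd i f) = 4 * Real.pi ^ 2 * freqSq ξ * modeSq ξ f := by
  simp only [modeSq, fcos_pd ξ hf hp, fsin_pd ξ hf hp, freqSq, Finset.mul_sum, Finset.sum_mul]
  exact Finset.sum_congr rfl fun i _ => by ring

lemma hasSum_gradSq {f : Coord → ℝ} (hf : ContDiff ℝ 1 f) (hp : IsTorusFun f) :
    HasSum (fun ξ => 4 * Real.pi ^ 2 * freqSq ξ * modeSq ξ f) (gradSq f) := by
  simp only [← sum_modeSq_pd hf hp]
  exact hasSum_sum fun i _ => hasSum_modeSq (continuous_pd hf i)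

/-- The Poincaré inequality on the torus. -/
lemma torusInt_sub_mean_sq_le {f : Coord → ℝ} (hf : ContDiff ℝ 1 f) (hp : IsTorusFun f) :
    torusInt (fun x => (f x - torusInt f) ^ 2) ≤ gradSq f := by
  set g : Coord → ℝ := fun x => f x - torusInt f with hg
  have hgc : ContDiff ℝ 1 g := hf.sub contDiff_const
  have hgp : IsTorusFun g := fun i x => by simp only [hg, hp i x]
  have e : gradSq f = gradSq g := by simp only [gradSq, hg, pd_sub_const]
  rw [e]
  refine hasSum_le (fun ξ => ?_) (hasSum_modeSq hgc.continuous) (hasSum_gradSq hgc hgp)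
  by_cases h : ξ = 0
  · subst h
    have h0 : modeSq 0 g = 0 := by
      have h1 : torusInt g = 0 := by
        rw [hg, torusInt_sub hf.continuous continuous_const, torusInt_const, sub_self]
      have h2 : torusInt (fun _ => (0 : ℝ)) = 0 := torusInt_const 0
      simp [modeSq, fcos, fsin, phase, h1, h2]
    change modeSq 0 g ≤ _
    simp [h0]
  · have := one_le_freqSq h
    exact le_mul_of_one_le_left (modeSq_nonneg ξ g)
      (one_le_mul_of_one_le_of_one_le one_le_four_pi_sq this)

/-- High frequencies of a `C¹` function carry little `L²` mass. -/
lemma torusInt_sq_le_sum_modeSq {f : Coord → ℝ} (hf : ContDiff ℝ 1 f) (hp : IsTorusFun f) {k : ℕ}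
    (hk : 0 < k) :
    torusInt (fun x => f x ^ 2) ≤ ∑ ξ ∈ freqBox k, modeSq ξ f + gradSq f / k ^ 2 := by
  have h1 : HasSum (fun ξ => if ξ ∈ freqBox k then modeSq ξ f else 0)
      (∑ ξ ∈ freqBox k, modeSq ξ f) := by
    have := hasSum_sum_of_ne_finset_zero (f := fun ξ => if ξ ∈ freqBox k then modeSq ξ f else 0)
      (s := freqBox k) (L := .unconditional _) fun ξ hξ => by simp [hξ]
    rwa [Finset.sum_congr rfl fun ξ hξ => if_pos hξ] at this
  have hk' : (0 : ℝ) < (k : ℝ) ^ 2 := by positivity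
  refine hasSum_le (fun ξ => ?_) (hasSum_modeSq hf.continuous)
    (h1.add ((hasSum_gradSq hf hp).div_const ((k : ℝ) ^ 2)))
  have hn := modeSq_nonneg ξ f
  have hq := freqSq_nonneg ξ
  split_ifs with h
  · exact le_add_of_nonneg_right (by positivity)
  · rw [zero_add, le_div_iff₀ hk', mul_comm (modeSq ξ f)]
    refine mul_le_mul_of_nonneg_right ((sq_le_freqSq_of_notMem h).trans ?_) hn
    exact le_mul_of_one_le_left hq one_le_four_pi_sq

/-- The real part of the product of the `ξ`-th Fourier coefficient of `g` with the conjugate of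
that of `f`. -/
def modePair (ξ : Fin 3 → ℤ) (f g : Coord → ℝ) : ℝ := fcos ξ f * fcos ξ g + fsin ξ f * fsin ξ g

/-- A truncated Parseval identity for the pairing of two `C¹` functions, up to an error that is
small when the cutoff is high. -/
lemma torusInt_mul_le_sum_modePair {f g : Coord → ℝ} (hf : ContDiff ℝ 1 f) (hg : ContDiff ℝ 1 g)
    (hpf : IsTorusFun f) (hpg : IsTorusFun g) {k : ℕ} (hk : 0 < k) :
    torusInt (fun x => f x * g x)
      ≤ ∑ ξ ∈ freqBox k, modePair ξ f g + gradSq (fun x => f x + g x) / (4 * k ^ 2) := by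
  have hfc := hf.continuous
  have hgc := hg.continuous
  have h1 := torusInt_sq_le_sum_modeSq (hf.add hg)
    (fun i x => by simp only [hpf i x, hpg i x]) hk
  have h2 := sum_modeSq_le (hfc.sub hgc) (freqBox k)
  have e1 : torusInt (fun x => (f x + g x) ^ 2) - torusInt (fun x => (f x - g x) ^ 2)
      = 4 * torusInt (fun x => f x * g x) := by
    rw [← torusInt_sub (by fun_prop) (by fun_prop), ← torusInt_const_mul]
    congr 1; funext x; ring
  have e2 : ∑ ξ ∈ freqBox k, modeSq ξ (fun x => f x + g x)
      - ∑ ξ ∈ freqBox k, modeSq ξ (fun x => f x - g x)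
      = 4 * ∑ ξ ∈ freqBox k, modePair ξ f g := by
    rw [← Finset.sum_sub_distrib, Finset.mul_sum]
    refine Finset.sum_congr rfl fun ξ _ => ?_
    simp only [modeSq, modePair, fcos_add ξ hfc hgc, fsin_add ξ hfc hgc, fcos_sub ξ hfc hgc,
      fsin_sub ξ hfc hgc]
    ring
  have e3 : gradSq (fun x => f x + g x) / (4 * (k : ℝ) ^ 2)
      = gradSq (fun x => f x + g x) / (k : ℝ) ^ 2 / 4 := by
    rw [div_div, mul_comm (4 : ℝ)]
  rw [e3]
  change torusInt (fun x => (f x + g x) ^ 2) ≤ ∑ ξ ∈ freqBox k, modeSq ξ (fun x => f x + g x)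
    + gradSq (fun x => f x + g x) / (k : ℝ) ^ 2 at h1
  change ∑ ξ ∈ freqBox k, modeSq ξ (fun x => f x - g x)
    ≤ torusInt (fun x => (f x - g x) ^ 2) at h2
  linarith

lemma fcos_sum_pd {F : Fin 3 → Coord → ℝ} (hF : ∀ j, ContDiff ℝ 1 (F j))
    (hp : ∀ j, IsTorusFun (F j)) (ξ : Fin 3 → ℤ) :
    fcos ξ (fun x => ∑ j, pd j (F j) x) = 2 * Real.pi * ∑ j, ξ j * fsin ξ (F j) := by
  rw [fcos_sum ξ _ fun j _ => continuous_pd (hF j) j, Finset.mul_sum]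
  exact Finset.sum_congr rfl fun j _ => by rw [fcos_pd ξ (hF j) (hp j)]; ring

lemma fsin_sum_pd {F : Fin 3 → Coord → ℝ} (hF : ∀ j, ContDiff ℝ 1 (F j))
    (hp : ∀ j, IsTorusFun (F j)) (ξ : Fin 3 → ℤ) :
    fsin ξ (fun x => ∑ j, pd j (F j) x) = -(2 * Real.pi * ∑ j, ξ j * fcos ξ (F j)) := by
  rw [fsin_sum ξ _ fun j _ => continuous_pd (hF j) j, Finset.mul_sum, ← Finset.sum_neg_distrib]
  exact Finset.sum_congr rfl fun j _ => by rw [fsin_pd ξ (hF j) (hp j)]; ring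

lemma fcos_div {w : Coord → Vel} (hw : ∀ j, ContDiff ℝ 1 fun x => w x j)
    (hp : ∀ j, IsTorusFun fun x => w x j) (ξ : Fin 3 → ℤ) :
    fcos ξ (div w) = 2 * Real.pi * ∑ j, ξ j * fsin ξ fun x => w x j :=
  fcos_sum_pd hw hp ξ

lemma fsin_div {w : Coord → Vel} (hw : ∀ j, ContDiff ℝ 1 fun x => w x j)
    (hp : ∀ j, IsTorusFun fun x => w x j) (ξ : Fin 3 → ℤ) :
    fsin ξ (div w) = -(2 * Real.pi * ∑ j, ξ j * fcos ξ fun x => w x j) :=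
  fsin_sum_pd hw hp ξ

lemma continuous_div {w : Coord → Vel} (hw : ∀ j, ContDiff ℝ 1 fun x => w x j) :
    Continuous (div w) :=
  continuous_finsetSum _ fun j _ => continuous_pd (hw j) j

/-- The divergence is controlled in `L²` by the gradient with constant one; this is what makes the
condition `lam + 2 μ > 0` sufficient for dissipation. -/
lemma torusInt_div_sq_le {w : Coord → Vel} (hw : ∀ j, ContDiff ℝ 1 fun x => w x j)
    (hp : ∀ j, IsTorusFun fun x => w x j) :
    torusInt (fun x => div w x ^ 2) ≤ ∑ j, gradSq fun x => w x j := by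
  refine hasSum_le (fun ξ => ?_) (hasSum_modeSq (continuous_div hw))
    (hasSum_sum fun j _ => hasSum_gradSq (hw j) (hp j))
  have h1 := Finset.sum_mul_sq_le_sq_mul_sq Finset.univ (fun j => (ξ j : ℝ))
    (fun j => fcos ξ fun x => w x j)
  have h2 := Finset.sum_mul_sq_le_sq_mul_sq Finset.univ (fun j => (ξ j : ℝ))
    (fun j => fsin ξ fun x => w x j)
  rw [← Finset.mul_sum]
  simp only [modeSq, fcos_div hw hp, fsin_div hw hp, Finset.sum_add_distrib]
  rw [← freqSq] at h1 h2
  nlinarith [mul_le_mul_of_nonneg_left h1 (sq_nonneg (2 * Real.pi)),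
    mul_le_mul_of_nonneg_left h2 (sq_nonneg (2 * Real.pi))]

/-! ### The compensating functional -/

lemma contDiff_pd {f : Coord → ℝ} (hf : ContDiff ℝ 2 f) (i : Fin 3) : ContDiff ℝ 1 (pd i f) :=
  (hf.fderiv_right (m := 1) (by norm_num)).clm_apply contDiff_const

lemma contDiff_div {w : Coord → Vel} (hw : ∀ j, ContDiff ℝ 2 fun x => w x j) :
    ContDiff ℝ 1 (div w) :=
  ContDiff.sum fun j _ => contDiff_pd (hw j) j

lemma isTorusFun_div {w : Coord → Vel} (hp : ∀ j, IsTorusFun fun x => w x j) :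
    IsTorusFun (div w) := fun i x =>
  Finset.sum_congr rfl fun j _ => (hp j).pd j i x

lemma continuous_lap {f : Coord → ℝ} (hf : ContDiff ℝ 2 f) : Continuous (lap f) :=
  continuous_finsetSum _ fun j _ => continuous_pd (contDiff_pd hf j) j

lemma continuous_lame {μ lam : ℝ} {w : Coord → Vel} (hw : ∀ j, ContDiff ℝ 2 fun x => w x j)
    (i : Fin 3) : Continuous (lame μ lam w i) :=
  ((continuous_lap (hw i)).const_mul (-μ)).sub
    ((continuous_pd (contDiff_div hw) i).const_mul (μ + lam))

lemma fcos_lap {f : Coord → ℝ} (hf : ContDiff ℝ 2 f) (hp : IsTorusFun f) (ξ : Fin 3 → ℤ) :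
    fcos ξ (lap f) = -(4 * Real.pi ^ 2 * freqSq ξ * fcos ξ f) := by
  have h := fcos_sum_pd (F := fun j => pd j f) (fun j => contDiff_pd hf j) (fun j => hp.pd j) ξ
  simp only [fsin_pd ξ (hf.of_le (by norm_num)) hp] at h
  change fcos ξ (lap f) = _ at h
  rw [h, freqSq]
  simp only [Fin.sum_univ_three]
  ring

lemma fsin_lap {f : Coord → ℝ} (hf : ContDiff ℝ 2 f) (hp : IsTorusFun f) (ξ : Fin 3 → ℤ) :
    fsin ξ (lap f) = -(4 * Real.pi ^ 2 * freqSq ξ * fsin ξ f) := by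
  have h := fsin_sum_pd (F := fun j => pd j f) (fun j => contDiff_pd hf j) (fun j => hp.pd j) ξ
  simp only [fcos_pd ξ (hf.of_le (by norm_num)) hp] at h
  change fsin ξ (lap f) = _ at h
  rw [h, freqSq]
  simp only [Fin.sum_univ_three]
  ring

section Lame

variable {μ lam : ℝ} {w : Coord → Vel}

lemma sum_fcos_lame (hw : ∀ j, ContDiff ℝ 2 fun x => w x j)
    (hp : ∀ j, IsTorusFun fun x => w x j) (ξ : Fin 3 → ℤ) :
    ∑ i, ξ i * fcos ξ (lame μ lam w i)
      = -(2 * Real.pi * (2 * μ + lam) * freqSq ξ * fsin ξ (div w)) := by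
  have hw1 : ∀ j, ContDiff ℝ 1 fun x => w x j := fun j => (hw j).of_le (by norm_num)
  have h : ∀ i, fcos ξ (lame μ lam w i) = μ * (4 * Real.pi ^ 2 * freqSq ξ * fcos ξ fun x => w x i)
      - (μ + lam) * (2 * Real.pi * ξ i * fsin ξ (div w)) := by
    intro i
    have : lame μ lam w i = fun x => -μ * lap (fun y => w y i) x - (μ + lam) * pd i (div w) x := rfl
    rw [this, fcos_sub ξ ((continuous_lap (hw i)).const_mul _)
      ((continuous_pd (contDiff_div hw) i).const_mul _), fcos_const_mul, fcos_const_mul,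
      fcos_lap (hw i) (hp i), fcos_pd ξ (contDiff_div hw) (isTorusFun_div hp)]
    ring
  have e : ∑ i, (ξ i : ℝ) * fcos ξ (lame μ lam w i)
      = μ * (4 * Real.pi ^ 2 * freqSq ξ) * (∑ i, ξ i * fcos ξ fun x => w x i)
        - (μ + lam) * (2 * Real.pi * fsin ξ (div w)) * freqSq ξ := by
    simp only [h, freqSq, Fin.sum_univ_three]
    ring
  rw [e, fsin_div hw1 hp]; ring

lemma sum_fsin_lame (hw : ∀ j, ContDiff ℝ 2 fun x => w x j)
    (hp : ∀ j, IsTorusFun fun x => w x j) (ξ : Fin 3 → ℤ) :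
    ∑ i, ξ i * fsin ξ (lame μ lam w i)
      = 2 * Real.pi * (2 * μ + lam) * freqSq ξ * fcos ξ (div w) := by
  have hw1 : ∀ j, ContDiff ℝ 1 fun x => w x j := fun j => (hw j).of_le (by norm_num)
  have h : ∀ i, fsin ξ (lame μ lam w i) = μ * (4 * Real.pi ^ 2 * freqSq ξ * fsin ξ fun x => w x i)
      + (μ + lam) * (2 * Real.pi * ξ i * fcos ξ (div w)) := by
    intro i
    have : lame μ lam w i = fun x => -μ * lap (fun y => w y i) x - (μ + lam) * pd i (div w) x := rfl
    rw [this, fsin_sub ξ ((continuous_lap (hw i)).const_mul _)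
      ((continuous_pd (contDiff_div hw) i).const_mul _), fsin_const_mul, fsin_const_mul,
      fsin_lap (hw i) (hp i), fsin_pd ξ (contDiff_div hw) (isTorusFun_div hp)]
    ring
  have e : ∑ i, (ξ i : ℝ) * fsin ξ (lame μ lam w i)
      = μ * (4 * Real.pi ^ 2 * freqSq ξ) * (∑ i, ξ i * fsin ξ fun x => w x i)
        + (μ + lam) * (2 * Real.pi * fcos ξ (div w)) * freqSq ξ := by
    simp only [h, freqSq, Fin.sum_univ_three]
    ring
  rw [e, fcos_div hw1 hp]; ring

end Lame

lemma IsC1.hasDerivAt_fcos {f : ℝ → Coord → ℝ} (hf : IsC1 f) {t : ℝ} (ht : 0 < t)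
    (ξ : Fin 3 → ℤ) :
    HasDerivAt (fun s => fcos ξ (f s)) (fcos ξ fun x => deriv (fun s => f s x) t) t := by
  convert (hf.mul (IsC1.of_space (contDiff_cos_phase ξ)
    (isTorusFun_cos_phase ξ))).hasDerivAt_torusInt ht using 1
  · rfl
  · exact congrArg torusInt (funext fun x => ((hf.hasDerivAt_time ht x).mul_const _).deriv.symm)

lemma IsC1.hasDerivAt_fsin {f : ℝ → Coord → ℝ} (hf : IsC1 f) {t : ℝ} (ht : 0 < t)
    (ξ : Fin 3 → ℤ) :
    HasDerivAt (fun s => fsin ξ (f s)) (fsin ξ fun x => deriv (fun s => f s x) t) t := by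
  convert (hf.mul (IsC1.of_space (contDiff_sin_phase ξ)
    (isTorusFun_sin_phase ξ))).hasDerivAt_torusInt ht using 1
  · rfl
  · exact congrArg torusInt (funext fun x => ((hf.hasDerivAt_time ht x).mul_const _).deriv.symm)

/-- The contribution of the frequency `ξ` to `∫ f Δ⁻¹ (∇ · q)`. At `ξ = 0` it vanishes, the
denominator being zero. -/
def crossMode (ξ : Fin 3 → ℤ) (f : Coord → ℝ) (q : Fin 3 → Coord → ℝ) : ℝ :=
  (fsin ξ f * ∑ i, ξ i * fcos ξ (q i) - fcos ξ f * ∑ i, ξ i * fsin ξ (q i))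
    / (2 * Real.pi * freqSq ξ)

/-- The pairing `∫ f Δ⁻¹ (∇ · q)`, truncated to the frequencies in `freqBox k`. -/
def cross (k : ℕ) (f : Coord → ℝ) (q : Fin 3 → Coord → ℝ) : ℝ :=
  ∑ ξ ∈ freqBox k, crossMode ξ f q

lemma freqSq_zero : freqSq 0 = 0 := by simp [freqSq]

lemma sq_sum_freq_mul_le (ξ : Fin 3 → ℤ) (a : Fin 3 → ℝ) :
    (∑ i, ξ i * a i) ^ 2 ≤ freqSq ξ * ∑ i, a i ^ 2 :=
  Finset.sum_mul_sq_le_sq_mul_sq Finset.univ (fun j => (ξ j : ℝ)) a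

lemma abs_crossMode_le (ξ : Fin 3 → ℤ) (f : Coord → ℝ) (q : Fin 3 → Coord → ℝ) :
    |crossMode ξ f q| ≤ modeSq ξ f + ∑ i, modeSq ξ (q i) := by
  have hnn : 0 ≤ ∑ i, modeSq ξ (q i) := Finset.sum_nonneg fun i _ => modeSq_nonneg ξ _
  by_cases h : ξ = 0
  · simp only [crossMode, h, freqSq_zero, mul_zero, div_zero, abs_zero]
    rw [h] at hnn
    exact add_nonneg (modeSq_nonneg 0 f) hnn
  have hN := one_le_freqSq h
  have ha := sq_sum_freq_mul_le ξ fun i => fcos ξ (q i)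
  have hb := sq_sum_freq_mul_le ξ fun i => fsin ξ (q i)
  simp only [modeSq, Finset.sum_add_distrib]
  set a := ∑ i, (ξ i : ℝ) * fcos ξ (q i)
  set b := ∑ i, (ξ i : ℝ) * fsin ξ (q i)
  set A := ∑ i, fcos ξ (q i) ^ 2
  set B := ∑ i, fsin ξ (q i) ^ 2
  set N := freqSq ξ
  have hpi := Real.pi_gt_three
  have hden : 0 < 2 * Real.pi * N := by positivity
  rw [crossMode, abs_div, abs_of_pos hden, div_le_iff₀ hden]
  have hle : fsin ξ f ^ 2 + fcos ξ f ^ 2 + A + B ≥ 0 := by positivity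
  have hA : 0 ≤ A := by positivity
  have hB : 0 ≤ B := by positivity
  have h1 : |fsin ξ f * a - fcos ξ f * b|
      ≤ (fsin ξ f ^ 2 + a ^ 2 + fcos ξ f ^ 2 + b ^ 2) / 2 := by
    rw [abs_le]
    constructor
    · nlinarith [sq_nonneg (fsin ξ f + a), sq_nonneg (fcos ξ f - b)]
    · nlinarith [sq_nonneg (fsin ξ f - a), sq_nonneg (fcos ξ f + b)]
  have h2 : (fsin ξ f ^ 2 + a ^ 2 + fcos ξ f ^ 2 + b ^ 2) / 2
      ≤ N * (fcos ξ f ^ 2 + fsin ξ f ^ 2 + (A + B)) := by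
    nlinarith [mul_nonneg (sub_nonneg.2 hN) (add_nonneg (sq_nonneg (fcos ξ f))
      (sq_nonneg (fsin ξ f))), sq_nonneg (fcos ξ f), sq_nonneg (fsin ξ f), mul_nonneg
      (zero_le_one.trans hN) hA, mul_nonneg (zero_le_one.trans hN) hB]
  have h3 : 0 ≤ N * (fcos ξ f ^ 2 + fsin ξ f ^ 2 + (A + B)) := by positivity
  nlinarith

lemma abs_cross_le {f : Coord → ℝ} {q : Fin 3 → Coord → ℝ} (hf : Continuous f)
    (hq : ∀ i, Continuous (q i)) (k : ℕ) :
    |cross k f q| ≤ torusInt (fun x => f x ^ 2) + ∑ i, torusInt fun x => q i x ^ 2 := by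
  calc |cross k f q| ≤ ∑ ξ ∈ freqBox k, (modeSq ξ f + ∑ i, modeSq ξ (q i)) :=
        (Finset.abs_sum_le_sum_abs _ _).trans
          (Finset.sum_le_sum fun ξ _ => abs_crossMode_le ξ f q)
    _ = ∑ ξ ∈ freqBox k, modeSq ξ f + ∑ i, ∑ ξ ∈ freqBox k, modeSq ξ (q i) := by
        rw [Finset.sum_add_distrib, Finset.sum_comm]
    _ ≤ _ := add_le_add (sum_modeSq_le hf _) (Finset.sum_le_sum fun i _ => sum_modeSq_le (hq i) _)

/-- The algebra behind the time derivative of `crossMode`. The unknowns are the Fourier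
coefficients of the density (`r`), of the momentum along `ξ` (`a`, `b`), of the momentum flux
along `ξ ⊗ ξ` (`τ`), of the pressure (`p`), of the divergence (`d`) and of the drag along `ξ`
(`g`), the suffix `c` standing for cosine and `s` for sine; `ω` is the frequency of the frame. The
terms with `ω` cancel: this is Galilean invariance. -/
lemma cross_derivative_algebra {N π rc rs a b τc τs pc ps dc ds gc gs ω ν : ℝ} (hN : N ≠ 0)
    (hπ : π ≠ 0) :
    ((2 * π * (a + ω * rc)) * a
        + rs * (-(2 * π * (τs + ω * b)) - 2 * π * N * ps + 2 * π * ν * N * ds + gc)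
        - ((-(2 * π * (b + ω * rs))) * b
          + rc * (2 * π * (τc + ω * a) + 2 * π * N * pc - 2 * π * ν * N * dc + gs)))
      / (2 * π * N)
    = (a ^ 2 + b ^ 2) / N - (rc * τc + rs * τs) / N - (rc * pc + rs * ps)
      + ν * (rc * dc + rs * ds) + (rs * gc - rc * gs) / (2 * π * N) := by
  field_simp
  ring

/-- Young's inequality in the form used for every cross term. -/
lemma mul_le_young {θ x y : ℝ} (hθ : 0 < θ) : x * y ≤ θ / 4 * x ^ 2 + θ⁻¹ * y ^ 2 := by
  have h : 0 ≤ θ⁻¹ * (θ / 2 * x - y) ^ 2 := by positivity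
  have e : θ⁻¹ * (θ / 2 * x - y) ^ 2 = θ / 4 * x ^ 2 + θ⁻¹ * y ^ 2 - x * y := by
    field_simp; ring
  linarith

/-- If the density fluctuation `f` and the momentum `q`, seen in the frame moving with velocity
`w`, satisfy the linear balance laws
`∂_t f + ∇ · (q + f w) = 0`, `∂_t q + ∇ · (T + q ⊗ w) + ∇ P + L V = g`,
then the frequency `ξ` of the compensating functional dissipates the pairing of `f` with the
pressure `P`. -/
lemma exists_hasDerivAt_crossMode {μ lam : ℝ} {w : Fin 3 → ℝ} {f : ℝ → Coord → ℝ}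
    {q : Fin 3 → ℝ → Coord → ℝ} {T : Fin 3 → Fin 3 → Coord → ℝ} {P : Coord → ℝ}
    {V : Coord → Vel} {g : Fin 3 → Coord → ℝ} {t : ℝ} (ht : 0 < t)
    (hf : IsC1 f) (hq : ∀ i, IsC1 (q i))
    (hT : ∀ i j, ContDiff ℝ 1 (T i j)) (hTp : ∀ i j, IsTorusFun (T i j))
    (hP : ContDiff ℝ 1 P) (hPp : IsTorusFun P)
    (hV : ∀ j, ContDiff ℝ 2 fun x => V x j) (hVp : ∀ j, IsTorusFun fun x => V x j)
    (hg : ∀ i, Continuous (g i))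
    (hmass : ∀ x, deriv (fun s => f s x) t = -∑ j, pd j (fun y => q j t y + w j * f t y) x)
    (hmom : ∀ x i, deriv (fun s => q i s x) t
      = -∑ j, pd j (fun y => T i j y + w j * q i t y) x - pd i P x - lame μ lam V i x + g i x)
    (h0 : torusInt (f t) = 0) {θ : ℝ} (hθ : 0 < θ) (ξ : Fin 3 → ℤ) :
    ∃ X', HasDerivAt (fun s => crossMode ξ (f s) fun i => q i s) X' t ∧
      X' ≤ -modePair ξ (f t) P + ∑ i, modeSq ξ (q i t) + θ * modeSq ξ (f t)
        + θ⁻¹ * (∑ i, ∑ j, modeSq ξ (T i j) + (2 * μ + lam) ^ 2 * modeSq ξ (div V)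
          + ∑ i, modeSq ξ (g i)) := by
  have hfs := hf.contDiff_slice ht
  have hfp := hf.periodic t ht.le
  have hqs := fun i => (hq i).contDiff_slice ht
  have hqp := fun i => (hq i).periodic t ht.le
  have hrest : 0 ≤ ∑ i, modeSq ξ (q i t) + θ * modeSq ξ (f t)
        + θ⁻¹ * (∑ i, ∑ j, modeSq ξ (T i j) + (2 * μ + lam) ^ 2 * modeSq ξ (div V)
          + ∑ i, modeSq ξ (g i)) := by
    have := hθ.le
    have h1 := modeSq_nonneg ξ (f t)
    have h2 := modeSq_nonneg ξ (div V)
    have h3 : 0 ≤ ∑ i, modeSq ξ (q i t) := Finset.sum_nonneg fun i _ => modeSq_nonneg ξ _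
    have h4 : 0 ≤ ∑ i, modeSq ξ (g i) := Finset.sum_nonneg fun i _ => modeSq_nonneg ξ _
    have h5 : 0 ≤ ∑ i, ∑ j, modeSq ξ (T i j) :=
      Finset.sum_nonneg fun i _ => Finset.sum_nonneg fun j _ => modeSq_nonneg ξ _
    positivity
  by_cases hξ : ξ = 0
  · subst hξ
    refine ⟨0, ?_, ?_⟩
    · simp only [crossMode, freqSq_zero, mul_zero, div_zero]
      exact hasDerivAt_const t 0
    · have h1 : fcos 0 (f t) = 0 := by simpa [fcos, phase] using h0
      have h2 : fsin 0 (f t) = 0 := by simpa [fsin, phase] using torusInt_const 0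
      simp only [modePair, h1, h2, zero_mul, add_zero, neg_zero, zero_add]
      linarith
  have hN := one_le_freqSq hξ
  -- The evolution of the Fourier coefficients of `f` and `q`.
  set rc := fcos ξ (f t) with hrc
  set rs := fsin ξ (f t) with hrs
  set ω := ∑ j, ξ j * w j with hω
  set a := ∑ i, ξ i * fcos ξ (q i t) with ha
  set b := ∑ i, ξ i * fsin ξ (q i t) with hb
  set τc := ∑ i, ξ i * ∑ j, ξ j * fcos ξ (T i j) with hτc
  set τs := ∑ i, ξ i * ∑ j, ξ j * fsin ξ (T i j) with hτs
  set gc := ∑ i, ξ i * fcos ξ (g i) with hgc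
  set gs := ∑ i, ξ i * fsin ξ (g i) with hgs
  have hflux : ∀ j, ContDiff ℝ 1 fun y => q j t y + w j * f t y := fun j =>
    (hqs j).add (contDiff_const.mul hfs)
  have hfluxp : ∀ j, IsTorusFun fun y => q j t y + w j * f t y := fun j i x => by
    simp only [hqp j i x, hfp i x]
  have hflux2 : ∀ i j, ContDiff ℝ 1 fun y => T i j y + w j * q i t y := fun i j =>
    (hT i j).add (contDiff_const.mul (hqs i))
  have hfluxp2 : ∀ i j, IsTorusFun fun y => T i j y + w j * q i t y := fun i j k x => by
    simp only [hTp i j k x, hqp i k x]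
  have drc : HasDerivAt (fun s => fcos ξ (f s)) (-(2 * Real.pi * (b + ω * rs))) t := by
    convert hf.hasDerivAt_fcos ht ξ using 1
    simp only [hmass]
    rw [fcos_neg, fcos_sum_pd hflux hfluxp]
    simp only [fsin_add ξ (hqs _).continuous (hfs.continuous.const_mul _), fsin_const_mul,
      hb, hω, Fin.sum_univ_three]
    ring
  have drs : HasDerivAt (fun s => fsin ξ (f s)) (2 * Real.pi * (a + ω * rc)) t := by
    convert hf.hasDerivAt_fsin ht ξ using 1
    simp only [hmass]
    rw [fsin_neg, fsin_sum_pd hflux hfluxp]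
    simp only [fcos_add ξ (hqs _).continuous (hfs.continuous.const_mul _), fcos_const_mul,
      ha, hω, Fin.sum_univ_three]
    ring
  have c1 : ∀ i, Continuous fun x => ∑ j, pd j (fun y => T i j y + w j * q i t y) x := fun i =>
    continuous_finsetSum _ fun j _ => continuous_pd (hflux2 i j) j
  have c2 := fun i => continuous_pd hP i
  have c3 := fun i => continuous_lame (μ := μ) (lam := lam) hV i
  have k1 : ∀ i, Continuous fun x => -∑ j, pd j (fun y => T i j y + w j * q i t y) x :=
    fun i => (c1 i).neg
  have k2 : ∀ i, Continuous fun x =>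
      -∑ j, pd j (fun y => T i j y + w j * q i t y) x - pd i P x :=
    fun i => (k1 i).sub (c2 i)
  have k3 : ∀ i, Continuous fun x =>
      -∑ j, pd j (fun y => T i j y + w j * q i t y) x - pd i P x - lame μ lam V i x :=
    fun i => (k2 i).sub (c3 i)
  have hlc := sum_fcos_lame (μ := μ) (lam := lam) hV hVp ξ
  have hls := sum_fsin_lame (μ := μ) (lam := lam) hV hVp ξ
  have da : HasDerivAt (fun s => ∑ i, (ξ i : ℝ) * fcos ξ (q i s))
      (-(2 * Real.pi * (τs + ω * b)) - 2 * Real.pi * freqSq ξ * fsin ξ P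
        + 2 * Real.pi * (2 * μ + lam) * freqSq ξ * fsin ξ (div V) + gc) t := by
    refine (HasDerivAt.fun_sum fun i (_ : i ∈ Finset.univ) =>
      ((hq i).hasDerivAt_fcos ht ξ).const_mul (ξ i : ℝ)).congr_deriv ?_
    have e : ∀ i, (fcos ξ fun x => deriv (fun s => q i s x) t)
        = -(2 * Real.pi * ∑ j, ξ j * (fsin ξ (T i j) + w j * fsin ξ (q i t)))
          - 2 * Real.pi * ξ i * fsin ξ P - fcos ξ (lame μ lam V i) + fcos ξ (g i) := by
      intro i
      simp only [hmom]
      rw [fcos_add ξ (k3 i) (hg i), fcos_sub ξ (k2 i) (c3 i), fcos_sub ξ (k1 i) (c2 i), fcos_neg,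
        fcos_sum_pd (hflux2 i) (hfluxp2 i), fcos_pd ξ hP hPp]
      simp only [fsin_add ξ (hT i _).continuous ((hqs i).continuous.const_mul _), fsin_const_mul]
    rw [← neg_eq_iff_eq_neg] at hlc
    rw [← hlc]
    simp only [e, hτs, hω, hb, hgc, freqSq, Fin.sum_univ_three]
    ring
  have db : HasDerivAt (fun s => ∑ i, (ξ i : ℝ) * fsin ξ (q i s))
      (2 * Real.pi * (τc + ω * a) + 2 * Real.pi * freqSq ξ * fcos ξ P
        - 2 * Real.pi * (2 * μ + lam) * freqSq ξ * fcos ξ (div V) + gs) t := by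
    refine (HasDerivAt.fun_sum fun i (_ : i ∈ Finset.univ) =>
      ((hq i).hasDerivAt_fsin ht ξ).const_mul (ξ i : ℝ)).congr_deriv ?_
    have e : ∀ i, (fsin ξ fun x => deriv (fun s => q i s x) t)
        = 2 * Real.pi * (∑ j, ξ j * (fcos ξ (T i j) + w j * fcos ξ (q i t)))
          + 2 * Real.pi * ξ i * fcos ξ P - fsin ξ (lame μ lam V i) + fsin ξ (g i) := by
      intro i
      simp only [hmom]
      rw [fsin_add ξ (k3 i) (hg i), fsin_sub ξ (k2 i) (c3 i), fsin_sub ξ (k1 i) (c2 i), fsin_neg,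
        fsin_sum_pd (hflux2 i) (hfluxp2 i), fsin_pd ξ hP hPp, neg_neg, sub_neg_eq_add]
      simp only [fcos_add ξ (hT i _).continuous ((hqs i).continuous.const_mul _), fcos_const_mul]
    rw [← hls]
    simp only [e, hτc, hω, ha, hgs, freqSq, Fin.sum_univ_three]
    ring
  have hpi := Real.pi_gt_three
  have hN0 : 0 < freqSq ξ := zero_lt_one.trans_le hN
  refine ⟨_, ((drs.fun_mul da).fun_sub (drc.fun_mul db)).div_const _, ?_⟩
  refine (cross_derivative_algebra (ω := ω) (rc := rc) (rs := rs) hN0.ne' Real.pi_ne_zero).le.trans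
    ?_
  -- Cauchy–Schwarz in the frequency, and Young's inequality.
  have hab : (a ^ 2 + b ^ 2) / freqSq ξ ≤ ∑ i, modeSq ξ (q i t) := by
    rw [div_le_iff₀ hN0]
    simp only [modeSq, Finset.sum_add_distrib]
    have h1 := sq_sum_freq_mul_le ξ fun i => fcos ξ (q i t)
    have h2 := sq_sum_freq_mul_le ξ fun i => fsin ξ (q i t)
    linarith
  have hτ : ∀ m : Fin 3 → Fin 3 → ℝ, ((∑ i, ξ i * ∑ j, ξ j * m i j) / freqSq ξ) ^ 2
      ≤ ∑ i, ∑ j, m i j ^ 2 := by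
    intro m
    rw [div_pow, div_le_iff₀ (pow_pos hN0 2)]
    refine (sq_sum_freq_mul_le ξ _).trans ?_
    rw [sq (freqSq ξ), mul_comm, ← mul_assoc]
    refine mul_le_mul_of_nonneg_right ?_ hN0.le
    rw [Finset.sum_mul]
    exact Finset.sum_le_sum fun i _ => (sq_sum_freq_mul_le ξ _).trans_eq (mul_comm _ _)
  have hG : ∀ m : Fin 3 → ℝ, ((∑ i, ξ i * m i) / (2 * Real.pi * freqSq ξ)) ^ 2
      ≤ ∑ i, m i ^ 2 := by
    intro m
    have hs : 0 ≤ ∑ i, m i ^ 2 := Finset.sum_nonneg fun _ _ => sq_nonneg _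
    rw [div_pow, div_le_iff₀ (by positivity)]
    refine (sq_sum_freq_mul_le ξ _).trans ?_
    rw [mul_comm]
    refine mul_le_mul_of_nonneg_left ?_ hs
    refine (le_mul_of_one_le_left hN0.le
      (one_le_mul_of_one_le_of_one_le one_le_four_pi_sq hN)).trans_eq ?_
    ring
  have hτcs := add_le_add (hτ fun i j => fcos ξ (T i j)) (hτ fun i j => fsin ξ (T i j))
  have hgcs := add_le_add (hG fun i => fcos ξ (g i)) (hG fun i => fsin ξ (g i))
  simp only [← hτc, ← hτs, ← hgc, ← hgs, ← Finset.sum_add_distrib] at hτcs hgcs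
  have y1 := mul_le_young hθ (x := rc) (y := -(τc / freqSq ξ))
  have y2 := mul_le_young hθ (x := rs) (y := -(τs / freqSq ξ))
  have y3 := mul_le_young hθ (x := rc) (y := (2 * μ + lam) * fcos ξ (div V))
  have y4 := mul_le_young hθ (x := rs) (y := (2 * μ + lam) * fsin ξ (div V))
  have y5 := mul_le_young hθ (x := rs) (y := gc / (2 * Real.pi * freqSq ξ))
  have y6 := mul_le_young hθ (x := rc) (y := -(gs / (2 * Real.pi * freqSq ξ)))
  have hi := inv_pos.2 hθ
  have z1 := mul_le_mul_of_nonneg_left hτcs hi.le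
  have z2 := mul_le_mul_of_nonneg_left hgcs hi.le
  have hsq : 0 ≤ θ * (rc ^ 2 + rs ^ 2) := by positivity
  have s1 : (rc * τc + rs * τs) / freqSq ξ = rc * (τc / freqSq ξ) + rs * (τs / freqSq ξ) := by ring
  have s2 : (rs * gc - rc * gs) / (2 * Real.pi * freqSq ξ)
      = rs * (gc / (2 * Real.pi * freqSq ξ)) - rc * (gs / (2 * Real.pi * freqSq ξ)) := by ring
  rw [s1, s2]
  simp only [modePair, modeSq, ← hrc, ← hrs] at hab ⊢
  generalize τc / freqSq ξ = x1 at *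
  generalize τs / freqSq ξ = x2 at *
  generalize gc / (2 * Real.pi * freqSq ξ) = x3 at *
  generalize gs / (2 * Real.pi * freqSq ξ) = x4 at *
  generalize (a ^ 2 + b ^ 2) / freqSq ξ = x5 at *
  linarith

/-- The time derivative of the compensating functional, integrated form of
`exists_hasDerivAt_crossMode`. -/
lemma exists_hasDerivAt_cross {μ lam : ℝ} {w : Fin 3 → ℝ} {f : ℝ → Coord → ℝ}
    {q : Fin 3 → ℝ → Coord → ℝ} {T : Fin 3 → Fin 3 → Coord → ℝ} {P : Coord → ℝ}
    {V : Coord → Vel} {g : Fin 3 → Coord → ℝ} {t : ℝ} (ht : 0 < t)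
    (hf : IsC1 f) (hq : ∀ i, IsC1 (q i))
    (hT : ∀ i j, ContDiff ℝ 1 (T i j)) (hTp : ∀ i j, IsTorusFun (T i j))
    (hP : ContDiff ℝ 1 P) (hPp : IsTorusFun P)
    (hV : ∀ j, ContDiff ℝ 2 fun x => V x j) (hVp : ∀ j, IsTorusFun fun x => V x j)
    (hg : ∀ i, Continuous (g i))
    (hmass : ∀ x, deriv (fun s => f s x) t = -∑ j, pd j (fun y => q j t y + w j * f t y) x)
    (hmom : ∀ x i, deriv (fun s => q i s x) t
      = -∑ j, pd j (fun y => T i j y + w j * q i t y) x - pd i P x - lame μ lam V i x + g i x)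
    (h0 : torusInt (f t) = 0) {θ : ℝ} (hθ : 0 < θ) {k : ℕ} (hk : 0 < k) :
    ∃ X', HasDerivAt (fun s => cross k (f s) fun i => q i s) X' t ∧
      X' ≤ -torusInt (fun x => f t x * P x) + gradSq (fun x => f t x + P x) / (4 * k ^ 2)
        + ∑ i, torusInt (fun x => q i t x ^ 2) + θ * torusInt (fun x => f t x ^ 2)
        + θ⁻¹ * (∑ i, ∑ j, torusInt (fun x => T i j x ^ 2)
          + (2 * μ + lam) ^ 2 * torusInt (fun x => div V x ^ 2)
          + ∑ i, torusInt fun x => g i x ^ 2) := by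
  choose X' hX' hle using fun ξ => exists_hasDerivAt_crossMode ht hf hq hT hTp hP hPp hV hVp hg
    hmass hmom h0 hθ ξ
  refine ⟨∑ ξ ∈ freqBox k, X' ξ, HasDerivAt.fun_sum fun ξ _ => hX' ξ, ?_⟩
  refine (Finset.sum_le_sum fun ξ _ => hle ξ).trans ?_
  have hpair := torusInt_mul_le_sum_modePair (hf.contDiff_slice ht) hP (hf.periodic t ht.le) hPp hk
  simp only [Finset.sum_add_distrib, ← Finset.mul_sum, Finset.sum_neg_distrib]
  have hi := (inv_pos.2 hθ).le
  have hV1 : ∀ j, ContDiff ℝ 1 fun x => V x j := fun j => (hV j).of_le (by norm_num)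
  have b1 : ∑ ξ ∈ freqBox k, ∑ i, modeSq ξ (q i t) ≤ ∑ i, torusInt (fun x => q i t x ^ 2) := by
    rw [Finset.sum_comm]
    exact Finset.sum_le_sum fun i _ => sum_modeSq_le ((hq i).continuous_slice ht.le) _
  have b2 := mul_le_mul_of_nonneg_left
    (sum_modeSq_le (hf.continuous_slice ht.le) (freqBox k)) hθ.le
  have b3 : ∑ ξ ∈ freqBox k, ∑ i, ∑ j, modeSq ξ (T i j)
      ≤ ∑ i, ∑ j, torusInt (fun x => T i j x ^ 2) := by
    rw [Finset.sum_comm]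
    refine Finset.sum_le_sum fun i _ => ?_
    rw [Finset.sum_comm]
    exact Finset.sum_le_sum fun j _ => sum_modeSq_le (hT i j).continuous _
  have b4 := mul_le_mul_of_nonneg_left
    (sum_modeSq_le (continuous_div hV1) (freqBox k)) (sq_nonneg (2 * μ + lam))
  have b5 : ∑ ξ ∈ freqBox k, ∑ i, modeSq ξ (g i) ≤ ∑ i, torusInt fun x => g i x ^ 2 := by
    rw [Finset.sum_comm]
    exact Finset.sum_le_sum fun i _ => sum_modeSq_le (hg i) _
  have b6 := mul_le_mul_of_nonneg_left (add_le_add (add_le_add b3 b4) b5) hi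
  linarith

/-! ### Balance laws of a single phase -/

/-- One phase of the mixture: a density `r` transported by the velocity `z`, whose momentum is
driven by the pressure `p`, the viscous force of the velocity field `v`, and the force `g`. For the
inviscid phase one takes `μ = lam = 0`, which makes the Lamé operator vanish. -/
structure IsPhase (μ lam : ℝ) (r : ℝ → Coord → ℝ) (z v : ℝ → Coord → Vel) (p : ℝ → Coord → ℝ)
    (g : Fin 3 → ℝ → Coord → ℝ) : Prop where
  r_C1 : IsC1 r
  z_C1 : IsC1 z
  v_C1 : IsC1 v
  p_C1 : IsC1 p
  g_C1 : ∀ i, IsC1 (g i)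
  v_C2 : ∀ t, 0 < t → ContDiff ℝ 2 (v t)
  mass : ∀ t, 0 < t → ∀ x,
    deriv (fun s => r s x) t + div (fun y => r t y • z t y) x = 0
  momentum : ∀ t, 0 < t → ∀ x, ∀ i : Fin 3,
    deriv (fun s => r s x * z s x i) t
      + ∑ j, pd j (fun y => r t y * z t y i * z t y j) x
      + pd i (p t) x + lame μ lam (v t) i x = g i t x

/-- The momentum density `r (z - w)` relative to the frame moving with velocity `w`. -/
def relMom (r : ℝ → Coord → ℝ) (z : ℝ → Coord → Vel) (w : Vel) (i : Fin 3) (t : ℝ) (x : Coord) :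
    ℝ := r t x * (z t x i - w i)

/-- The momentum flux `r (z - w) ⊗ (z - w)` relative to the frame moving with velocity `w`. -/
def relFlux (r : ℝ → Coord → ℝ) (z : ℝ → Coord → Vel) (w : Vel) (i j : Fin 3) (t : ℝ) (x : Coord) :
    ℝ := r t x * (z t x i - w i) * (z t x j - w j)

/-- Twice the kinetic energy relative to the frame moving with velocity `w`. -/
def kin (r : Coord → ℝ) (z : Coord → Vel) (w : Vel) : ℝ := torusInt fun x => r x * ‖z x - w‖ ^ 2

lemma norm_sub_sq (a b : Vel) : ‖a - b‖ ^ 2 = ∑ i, (a i - b i) ^ 2 := by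
  simp [EuclideanSpace.norm_sq_eq]

/-- The viscous dissipation. -/
lemma sum_torusInt_mul_lame {μ lam : ℝ} {v : Coord → Vel} (hv : ∀ j, ContDiff ℝ 2 fun x => v x j)
    (hp : ∀ j, IsTorusFun fun x => v x j) (c : Fin 3 → ℝ) :
    ∑ i, torusInt (fun x => (v x i - c i) * lame μ lam v i x)
      = μ * (∑ i, gradSq fun x => v x i) + (μ + lam) * torusInt (fun x => div v x ^ 2) := by
  have hv1 : ∀ j, ContDiff ℝ 1 fun x => v x j := fun j => (hv j).of_le (by norm_num)
  have hy : ∀ i, ContDiff ℝ 1 fun x => v x i - c i := fun i => (hv1 i).sub contDiff_const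
  have hyp : ∀ i, IsTorusFun fun x => v x i - c i := fun i k x => by
    have := hp i k x
    simp only at this ⊢
    rw [this]
  have hdc := continuous_div hv1
  have hpc := fun i => continuous_pd (contDiff_div hv) i
  have h1 : ∀ i j, torusInt (fun x => (v x i - c i) * pd j (pd j fun y => v y i) x)
      = -torusInt (fun x => pd j (fun y => v y i) x ^ 2) := by
    intro i j
    rw [torusInt_mul_pd (hy i) (contDiff_pd (hv i) j) (hyp i) ((hp i).pd j)]
    simp only [pd_sub_const, sq]
  have h2 : ∀ i, torusInt (fun x => (v x i - c i) * pd i (div v) x)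
      = -torusInt (fun x => pd i (fun y => v y i) x * div v x) := by
    intro i
    rw [torusInt_mul_pd (hy i) (contDiff_div hv) (hyp i) (isTorusFun_div hp)]
    simp only [pd_sub_const]
  have h3 : ∀ i, torusInt (fun x => (v x i - c i) * lame μ lam v i x)
      = μ * gradSq (fun x => v x i)
        + (μ + lam) * torusInt (fun x => pd i (fun y => v y i) x * div v x) := by
    intro i
    have e : (fun x => (v x i - c i) * lame μ lam v i x)
        = fun x => (-μ) * ∑ j, (v x i - c i) * pd j (pd j fun y => v y i) x
          - (μ + lam) * ((v x i - c i) * pd i (div v) x) := by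
      funext x
      simp only [lame, lap, ← Finset.mul_sum]
      ring
    have hc : ∀ j, Continuous fun x => (v x i - c i) * pd j (pd j fun y => v y i) x := fun j =>
      (hy i).continuous.mul (continuous_pd (contDiff_pd (hv i) j) j)
    have hc' : Continuous fun x => (μ + lam) * ((v x i - c i) * pd i (div v) x) :=
      ((hy i).continuous.mul (hpc i)).const_mul _
    rw [e, torusInt_sub ((continuous_finsetSum _ fun j _ => hc j).const_mul _) hc',
      torusInt_const_mul, torusInt_const_mul,
      torusInt_sum _ fun j _ => hc j, h2 i]
    simp only [h1, gradSq, Finset.sum_neg_distrib]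
    ring
  have h4 : ∑ i, torusInt (fun x => pd i (fun y => v y i) x * div v x)
      = torusInt (fun x => div v x ^ 2) := by
    have hc : ∀ i, Continuous fun x => pd i (fun y => v y i) x * div v x := fun i =>
      (continuous_pd (hv1 i) i).mul hdc
    rw [← torusInt_sum _ fun i _ => hc i]
    congr 1; funext x
    rw [← Finset.sum_mul, sq]; rfl
  simp only [h3, Finset.sum_add_distrib, ← Finset.mul_sum, h4]

namespace IsPhase

variable {μ lam : ℝ} {r : ℝ → Coord → ℝ} {z v : ℝ → Coord → Vel} {p : ℝ → Coord → ℝ}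
  {g : Fin 3 → ℝ → Coord → ℝ}

lemma isC1_vel (h : IsPhase μ lam r z v p g) (w : Vel) (i : Fin 3) :
    IsC1 fun t x => z t x i - w i := (h.z_C1.apply i).sub_const _

lemma isC1_relMom (h : IsPhase μ lam r z v p g) (w : Vel) (i : Fin 3) :
    IsC1 (relMom r z w i) := h.r_C1.mul (h.isC1_vel w i)

lemma isC1_relFlux (h : IsPhase μ lam r z v p g) (w : Vel) (i j : Fin 3) :
    IsC1 (relFlux r z w i j) := (h.isC1_relMom w i).mul (h.isC1_vel w j)

lemma contDiff_v (h : IsPhase μ lam r z v p g) {t : ℝ} (ht : 0 < t) (j : Fin 3) :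
    ContDiff ℝ 2 fun x => v t x j :=
  (EuclideanSpace.proj (𝕜 := ℝ) j).contDiff.comp (h.v_C2 t ht)

lemma isTorusFun_v (h : IsPhase μ lam r z v p g) {t : ℝ} (ht : 0 < t) (j : Fin 3) :
    IsTorusFun fun x => v t x j := (h.v_C1.apply j).periodic t ht.le

lemma continuous_lame (h : IsPhase μ lam r z v p g) {t : ℝ} (ht : 0 < t) (i : Fin 3) :
    Continuous (lame μ lam (v t) i) := TwoPhase.continuous_lame (h.contDiff_v ht) i

lemma mass_pd (h : IsPhase μ lam r z v p g) {t : ℝ} (ht : 0 < t) (x : Coord) :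
    deriv (fun s => r s x) t = -∑ j, pd j (fun y => r t y * z t y j) x :=
  eq_neg_of_add_eq_zero_left (h.mass t ht x)

/-- Conservation of mass in the moving frame, for the fluctuation of the density. -/
lemma mass_rel (h : IsPhase μ lam r z v p g) (w : Vel) (R : ℝ) {t : ℝ} (ht : 0 < t) (x : Coord) :
    deriv (fun s => r s x - R) t
      = -∑ j, pd j (fun y => relMom r z w j t y + w j * (r t y - R)) x := by
  rw [deriv_sub_const, h.mass_pd ht]
  congr 1
  refine Finset.sum_congr rfl fun j _ => ?_
  have e : (fun y => r t y * z t y j)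
      = fun y => (relMom r z w j t y + w j * (r t y - R)) + w j * R := by
    funext y; simp only [relMom]; ring
  rw [e, pd_add_const]

lemma momentum_mul (h : IsPhase μ lam r z v p g) (w : Vel) {t : ℝ} (ht : 0 < t) (x : Coord)
    (i : Fin 3) :
    deriv (fun s => relMom r z w i s x) t
      = -∑ j, pd j (fun y => relMom r z w i t y * z t y j) x - pd i (p t) x
        - lame μ lam (v t) i x + g i t x := by
  have hz := fun j => h.z_C1.apply j
  have hm := h.momentum t ht x i
  have e : (fun s => relMom r z w i s x) = fun s => r s x * z s x i - w i * r s x := by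
    funext s; simp only [relMom]; ring
  have hd1 := (h.r_C1.mul (hz i)).hasDerivAt_time ht x
  have hd2 := (h.r_C1.hasDerivAt_time ht x).const_mul (w i)
  rw [e, (hd1.fun_sub hd2).deriv, h.mass_pd ht]
  have e2 : ∀ j, pd j (fun y => relMom r z w i t y * z t y j) x
      = pd j (fun y => r t y * z t y i * z t y j) x - w i * pd j (fun y => r t y * z t y j) x := by
    intro j
    rw [← pd_const_mul _ ((h.r_C1.mul (hz j)).differentiableAt_slice ht x),
      ← pd_sub (((h.r_C1.mul (hz i)).mul (hz j)).differentiableAt_slice ht x)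
        (((h.r_C1.mul (hz j)).const_mul (w i)).differentiableAt_slice ht x)]
    congr 1; funext y; simp only [relMom]; ring
  simp only [e2, Finset.sum_sub_distrib, ← Finset.mul_sum]
  linarith

/-- Balance of momentum in the moving frame. -/
lemma momentum_rel (h : IsPhase μ lam r z v p g) (w : Vel) (p₀ : ℝ) {t : ℝ} (ht : 0 < t)
    (x : Coord) (i : Fin 3) :
    deriv (fun s => relMom r z w i s x) t
      = -∑ j, pd j (fun y => relFlux r z w i j t y + w j * relMom r z w i t y) x
        - pd i (fun y => p t y - p₀) x - lame μ lam (v t) i x + g i t x := by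
  rw [h.momentum_mul w ht, pd_sub_const]
  have e : ∀ j, (fun y => relMom r z w i t y * z t y j)
      = fun y => relFlux r z w i j t y + w j * relMom r z w i t y := by
    intro j; funext y; simp only [relMom, relFlux]; ring
  simp only [e]

/-- The momentum of a phase changes only through the force `g`. -/
lemma hasDerivAt_momentum (h : IsPhase μ lam r z v p g) (w : Vel) {t : ℝ} (ht : 0 < t)
    (i : Fin 3) :
    HasDerivAt (fun s => torusInt (relMom r z w i s)) (torusInt (g i t)) t := by
  refine ((h.isC1_relMom w i).hasDerivAt_torusInt ht).congr_deriv ?_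
  simp only [h.momentum_mul w ht]
  have hF : ∀ j, IsC1 fun t y => relMom r z w i t y * z t y j := fun j =>
    (h.isC1_relMom w i).mul (h.z_C1.apply j)
  have c1 : ∀ j, Continuous (pd j fun y => relMom r z w i t y * z t y j) := fun j =>
    continuous_pd ((hF j).contDiff_slice ht) j
  have c2 : Continuous (pd i (p t)) := continuous_pd (h.p_C1.contDiff_slice ht) i
  have c3 := h.continuous_lame ht i
  have c4 := (h.g_C1 i).continuous_slice ht.le
  have hl : torusInt (lame μ lam (v t) i) = 0 := by
    have hv := h.contDiff_v ht
    have hp := h.isTorusFun_v ht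
    have e : lame μ lam (v t) i
        = fun x => -μ * ∑ j, pd j (pd j fun y => v t y i) x - (μ + lam) * pd i (div (v t)) x := rfl
    have c : ∀ j, Continuous (pd j (pd j fun y => v t y i)) := fun j =>
      continuous_pd (contDiff_pd (hv i) j) j
    rw [e, torusInt_sub ((continuous_finsetSum _ fun j _ => c j).const_mul _)
      ((continuous_pd (contDiff_div hv) i).const_mul _), torusInt_const_mul, torusInt_const_mul,
      torusInt_sum _ fun j _ => c j, torusInt_pd (contDiff_div hv) (isTorusFun_div hp)]
    simp only [torusInt_pd (contDiff_pd (hv i) _) ((hp i).pd _), Finset.sum_const_zero, mul_zero,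
      sub_zero]
  have s : Continuous fun x => -∑ j, pd j (fun y => relMom r z w i t y * z t y j) x :=
    (continuous_finsetSum _ fun j _ => c1 j).neg
  have s2 : Continuous fun x => -∑ j, pd j (fun y => relMom r z w i t y * z t y j) x
      - pd i (p t) x := s.sub c2
  have s3 : Continuous fun x => -∑ j, pd j (fun y => relMom r z w i t y * z t y j) x
      - pd i (p t) x - lame μ lam (v t) i x := s2.sub c3
  rw [torusInt_add s3 c4, torusInt_sub s2 c3, torusInt_sub s c2, torusInt_neg,
    torusInt_sum _ fun j _ => c1 j, hl, torusInt_pd (h.p_C1.contDiff_slice ht)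
      (h.p_C1.periodic t ht.le)]
  simp only [torusInt_pd ((hF _).contDiff_slice ht) ((hF _).periodic t ht.le),
    Finset.sum_const_zero, neg_zero, sub_zero, zero_add]

lemma hasDerivAt_mass (h : IsPhase μ lam r z v p g) {t : ℝ} (ht : 0 < t) :
    HasDerivAt (fun s => torusInt (r s)) 0 t := by
  refine (h.r_C1.hasDerivAt_torusInt ht).congr_deriv ?_
  simp only [h.mass_pd ht]
  have hF := fun j => h.r_C1.mul (h.z_C1.apply j)
  rw [torusInt_neg, torusInt_sum _ fun j _ => continuous_pd ((hF j).contDiff_slice ht) j]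
  simp only [torusInt_pd ((hF _).contDiff_slice ht) ((hF _).periodic t ht.le),
    Finset.sum_const_zero, neg_zero]

/-- Balance of kinetic energy. -/
lemma hasDerivAt_kin (h : IsPhase μ lam r z v p g) (w : Vel) {t : ℝ} (ht : 0 < t) :
    HasDerivAt (fun s => kin (r s) (z s) w / 2)
      (torusInt (fun x => p t x * div (z t) x)
        - ∑ i, torusInt (fun x => (z t x i - w i) * lame μ lam (v t) i x)
        + ∑ i, torusInt (fun x => (z t x i - w i) * g i t x)) t := by
  have hy := h.isC1_vel w
  have hq := h.isC1_relMom w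
  have hz := fun j => h.z_C1.apply j
  have hK : ∀ i, IsC1 fun s x => relMom r z w i s x * (z s x i - w i) := fun i => (hq i).mul (hy i)
  have hFl : ∀ i j, IsC1 fun s x => relMom r z w i s x * (z s x i - w i) * z s x j := fun i j =>
    (hK i).mul (hz j)
  have hqz : ∀ i j, IsC1 fun s x => relMom r z w i s x * z s x j := fun i j => (hq i).mul (hz j)
  have hrz : ∀ j, IsC1 fun s x => r s x * z s x j := fun j => h.r_C1.mul (hz j)
  -- The pointwise energy balance.
  have hpt : ∀ i x, deriv (fun s => relMom r z w i s x * (z s x i - w i)) t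
      = 2 * (-((z t x i - w i) * pd i (p t) x) - (z t x i - w i) * lame μ lam (v t) i x
        + (z t x i - w i) * g i t x)
        - ∑ j, pd j (fun y => relMom r z w i t y * (z t y i - w i) * z t y j) x := by
    intro i x
    have d1 := (hq i).hasDerivAt_time ht x
    have d2 := (hy i).hasDerivAt_time ht x
    have d3 := h.r_C1.hasDerivAt_time ht x
    have e1 := (d3.fun_mul d2).deriv
    change deriv (fun s => relMom r z w i s x) t = _ at e1
    rw [(d1.fun_mul d2).deriv]
    have e2 : ∀ j, pd j (fun y => relMom r z w i t y * (z t y i - w i) * z t y j) x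
        = 2 * (z t x i - w i) * pd j (fun y => relMom r z w i t y * z t y j) x
          - (z t x i - w i) ^ 2 * pd j (fun y => r t y * z t y j) x := by
      intro j
      have dr := (hrz j).differentiableAt_slice ht x
      have dy := (hy i).differentiableAt_slice ht x
      have dq := (hqz i j).differentiableAt_slice ht x
      have f1 : (fun y => relMom r z w i t y * (z t y i - w i) * z t y j)
          = fun y => (relMom r z w i t y * z t y j) * (z t y i - w i) := by funext y; ring
      have f2 : (fun y => relMom r z w i t y * z t y j)
          = fun y => (r t y * z t y j) * (z t y i - w i) := by
        funext y; simp only [relMom]; ring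
      have f3 := pd_mul (i := j) dr dy
      rw [← f2] at f3
      rw [f1, pd_mul dq dy, f3]
      simp only [relMom]
      ring
    have m1 := h.momentum_mul w ht x i
    have m2 := h.mass_pd ht x
    simp only [e2, Finset.sum_sub_distrib, ← Finset.mul_sum]
    have e3 : relMom r z w i t x * deriv (fun s => z s x i - w i) t
        = (z t x i - w i) * (deriv (fun s => relMom r z w i s x) t
          - deriv (fun s => r s x) t * (z t x i - w i)) := by
      rw [e1]; simp only [relMom]; ring
    rw [e3, m1, m2]
    ring
  have hkin : ∀ s, kin (r s) (z s) w
      = torusInt fun x => ∑ i, relMom r z w i s x * (z s x i - w i) := by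
    intro s
    simp only [kin, norm_sub_sq, Finset.mul_sum, relMom]
    congr 1; funext x
    exact Finset.sum_congr rfl fun i _ => by ring
  have hint : ∀ i, torusInt (fun x => deriv (fun s => relMom r z w i s x * (z s x i - w i)) t)
      = 2 * (torusInt (fun x => p t x * pd i (fun y => z t y i) x)
        - torusInt (fun x => (z t x i - w i) * lame μ lam (v t) i x)
        + torusInt (fun x => (z t x i - w i) * g i t x)) := by
    intro i
    have cy := (hy i).continuous_slice ht.le
    have c1 : Continuous fun x => (z t x i - w i) * pd i (p t) x :=
      cy.mul (continuous_pd (h.p_C1.contDiff_slice ht) i)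
    have c2 : Continuous fun x => (z t x i - w i) * lame μ lam (v t) i x :=
      cy.mul (h.continuous_lame ht i)
    have c3 : Continuous fun x => (z t x i - w i) * g i t x :=
      cy.mul ((h.g_C1 i).continuous_slice ht.le)
    have c4 : ∀ j, Continuous
        (pd j fun y => relMom r z w i t y * (z t y i - w i) * z t y j) := fun j =>
      continuous_pd ((hFl i j).contDiff_slice ht) j
    simp only [hpt]
    have c5 : Continuous fun x => -((z t x i - w i) * pd i (p t) x) := c1.neg
    have c6 : Continuous fun x => -((z t x i - w i) * pd i (p t) x)
        - (z t x i - w i) * lame μ lam (v t) i x := c5.sub c2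
    have c7 : Continuous fun x => 2 * (-((z t x i - w i) * pd i (p t) x)
        - (z t x i - w i) * lame μ lam (v t) i x + (z t x i - w i) * g i t x) :=
      (c6.add c3).const_mul 2
    rw [torusInt_sub c7 (continuous_finsetSum _ fun j _ => c4 j), torusInt_const_mul,
      torusInt_add c6 c3, torusInt_sub c5 c2, torusInt_neg,
      torusInt_sum _ fun j _ => c4 j, torusInt_mul_pd ((hy i).contDiff_slice ht)
        (h.p_C1.contDiff_slice ht) ((hy i).periodic t ht.le) (h.p_C1.periodic t ht.le)]
    simp only [torusInt_pd ((hFl i _).contDiff_slice ht) ((hFl i _).periodic t ht.le),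
      Finset.sum_const_zero, pd_sub_const, mul_comm (pd i _ _), neg_neg, sub_zero]
  simp only [hkin]
  refine (((IsC1.sum Finset.univ fun i _ => hK i).hasDerivAt_torusInt ht).div_const
    2).congr_deriv ?_
  have hsum : ∀ x, deriv (fun s => ∑ i, relMom r z w i s x * (z s x i - w i)) t
      = ∑ i, deriv (fun s => relMom r z w i s x * (z s x i - w i)) t := fun x =>
    (HasDerivAt.fun_sum fun i _ => (hK i).hasDerivAt_time ht x).deriv
  simp only [hsum]
  rw [torusInt_sum _ fun i _ => (hK i).continuous_deriv ht]
  have cp : ∀ i, Continuous fun x => p t x * pd i (fun y => z t y i) x := fun i =>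
    (h.p_C1.continuous_slice ht.le).mul (continuous_pd ((hz i).contDiff_slice ht) i)
  have hdiv : torusInt (fun x => p t x * div (z t) x)
      = ∑ i, torusInt fun x => p t x * pd i (fun y => z t y i) x := by
    rw [← torusInt_sum _ fun i _ => cp i]
    simp only [div, Finset.mul_sum]
  rw [hdiv]
  simp only [hint, ← Finset.mul_sum, Finset.sum_add_distrib, Finset.sum_sub_distrib]
  ring

/-- The renormalized continuity equation, integrated: `b (r)` is a density of internal energy and
`b' r - b` the corresponding pressure. -/
lemma hasDerivAt_torusInt_comp (h : IsPhase μ lam r z v p g) {b b' : ℝ → ℝ} {t : ℝ} (ht : 0 < t)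
    (hbr : IsC1 fun s x => b (r s x)) (hb : ∀ x, HasDerivAt b (b' (r t x)) (r t x))
    (hb' : Continuous fun x => b' (r t x)) :
    HasDerivAt (fun s => torusInt fun x => b (r s x))
      (-torusInt fun x => (b' (r t x) * r t x - b (r t x)) * div (z t) x) t := by
  have hz := fun j => h.z_C1.apply j
  have hF := fun j => hbr.mul (hz j)
  have hdr := fun x => h.r_C1.differentiableAt_slice ht x
  have hdz := fun j x => (hz j).differentiableAt_slice ht x
  refine (hbr.hasDerivAt_torusInt ht).congr_deriv ?_
  have hpt : ∀ x, deriv (fun s => b (r s x)) t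
      = -∑ j, pd j (fun y => b (r t y) * z t y j) x
        - (b' (r t x) * r t x - b (r t x)) * div (z t) x := by
    intro x
    have d := (hb x).comp t (h.r_C1.hasDerivAt_time ht x)
    have e1 : ∀ j, pd j (fun y => b (r t y)) x = b' (r t x) * pd j (r t) x := by
      intro j
      have := ((hb x).comp_hasFDerivAt x (hdr x).hasFDerivAt).fderiv
      simp only [Function.comp_def] at this
      simp [pd, this]
    have e2 : ∀ j, pd j (fun y => b (r t y) * z t y j) x
        = b' (r t x) * pd j (r t) x * z t x j + b (r t x) * pd j (fun y => z t y j) x := by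
      intro j
      rw [pd_mul (hbr.differentiableAt_slice ht x) (hdz j x), e1]
    have e3 : ∀ j, pd j (fun y => r t y * z t y j) x
        = pd j (r t) x * z t x j + r t x * pd j (fun y => z t y j) x := fun j =>
      pd_mul (hdr x) (hdz j x)
    have d' : deriv (fun s => b (r s x)) t = _ := d.deriv
    rw [d', h.mass_pd ht]
    simp only [e2, e3, div, Fin.sum_univ_three]
    ring
  simp only [hpt]
  have c1 : Continuous fun x => -∑ j, pd j (fun y => b (r t y) * z t y j) x :=
    (continuous_finsetSum _ fun j _ => continuous_pd ((hF j).contDiff_slice ht) j).neg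
  have c2 : Continuous fun x => (b' (r t x) * r t x - b (r t x)) * div (z t) x :=
    ((hb'.mul (h.r_C1.continuous_slice ht.le)).sub (hbr.continuous_slice ht.le)).mul
      (continuous_div fun j => (hz j).contDiff_slice ht)
  rw [torusInt_sub c1 c2, torusInt_neg,
    torusInt_sum _ fun j _ => continuous_pd ((hF j).contDiff_slice ht) j]
  simp only [torusInt_pd ((hF _).contDiff_slice ht) ((hF _).periodic t ht.le),
    Finset.sum_const_zero, neg_zero, zero_sub]

end IsPhase

lemma continuous_apply_vel {z : Coord → Vel} (hz : Continuous z) (i : Fin 3) :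
    Continuous fun x => z x i := (EuclideanSpace.proj (𝕜 := ℝ) i).continuous.comp hz

lemma sum_torusInt_relMom_sq_le {r : ℝ → Coord → ℝ} {z : ℝ → Coord → Vel} {A t : ℝ} (w : Vel)
    (hr : Continuous (r t)) (hz : Continuous (z t)) (hA : ∀ x, r t x ∈ Icc 0 A) :
    ∑ i, torusInt (fun x => relMom r z w i t x ^ 2) ≤ A * kin (r t) (z t) w := by
  have hq2 : ∀ i, Continuous fun x => relMom r z w i t x ^ 2 := fun i =>
    (hr.mul ((continuous_apply_vel hz i).sub continuous_const)).pow 2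
  rw [← torusInt_sum _ fun i _ => hq2 i, kin, ← torusInt_const_mul]
  refine torusInt_mono (continuous_finsetSum _ fun i _ => hq2 i)
    ((hr.mul ((hz.sub continuous_const).norm.pow 2)).const_mul A) fun x => ?_
  have : ∑ i, relMom r z w i t x ^ 2 = r t x * (r t x * ‖z t x - w‖ ^ 2) := by
    simp only [relMom, norm_sub_sq, Finset.mul_sum]
    exact Finset.sum_congr rfl fun i _ => by ring
  rw [this]
  exact mul_le_mul_of_nonneg_right (hA x).2 (mul_nonneg (hA x).1 (sq_nonneg _))

/-- A phase whose density fluctuates loses energy to the compensating functional; all other terms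
are controlled by the relative kinetic energy, the viscosity and the force. -/
lemma IsPhase.exists_hasDerivAt_cross {μ lam : ℝ} {r : ℝ → Coord → ℝ} {z v : ℝ → Coord → Vel}
    {p : ℝ → Coord → ℝ} {g : Fin 3 → ℝ → Coord → ℝ} (h : IsPhase μ lam r z v p g) (w : Vel)
    {R p₀ A U t θ : ℝ} (ht : 0 < t) (hR : torusInt (r t) = R) (hr : ∀ x, r t x ∈ Icc 0 A)
    (hU : ∀ x, ‖z t x - w‖ ≤ U) (hθ : 0 < θ) {k : ℕ} (hk : 0 < k) :
    ∃ X', HasDerivAt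
        (fun s => cross k (fun x => r s x - R) fun i => relMom r z w i s) X' t ∧
      X' ≤ -torusInt (fun x => (r t x - R) * (p t x - p₀))
        + gradSq (fun x => r t x + p t x) / (4 * k ^ 2)
        + A * kin (r t) (z t) w + θ * torusInt (fun x => (r t x - R) ^ 2)
        + θ⁻¹ * (A * U ^ 2 * kin (r t) (z t) w
          + (2 * μ + lam) ^ 2 * torusInt (fun x => div (v t) x ^ 2)
          + ∑ i, torusInt fun x => g i t x ^ 2) := by
  have hrc := h.r_C1.continuous_slice ht.le
  have hzc := h.z_C1.continuous_slice ht.le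
  have hyc : ∀ i, Continuous fun x => z t x i - w i := fun i =>
    (continuous_apply_vel hzc i).sub continuous_const
  have hp1 := h.p_C1.sub_const p₀
  obtain ⟨X', hX, hle⟩ := TwoPhase.exists_hasDerivAt_cross (w := fun i => w i)
    (f := fun s x => r s x - R) (q := relMom r z w) (T := fun i j => relFlux r z w i j t)
    (P := fun x => p t x - p₀) (V := v t) (g := fun i => g i t) ht (h.r_C1.sub_const R)
    (h.isC1_relMom w) (fun i j => (h.isC1_relFlux w i j).contDiff_slice ht)
    (fun i j => (h.isC1_relFlux w i j).periodic t ht.le) (hp1.contDiff_slice ht)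
    (hp1.periodic t ht.le) (h.contDiff_v ht) (h.isTorusFun_v ht)
    (fun i => (h.g_C1 i).continuous_slice ht.le) (h.mass_rel w R ht) (h.momentum_rel w p₀ ht)
    (by rw [torusInt_sub hrc continuous_const, torusInt_const, hR, sub_self]) hθ hk
  refine ⟨X', hX, hle.trans ?_⟩
  have e1 : gradSq (fun x => r t x - R + (p t x - p₀)) = gradSq (fun x => r t x + p t x) := by
    have : (fun x => r t x - R + (p t x - p₀)) = fun x => (r t x + p t x) - (R + p₀) := by
      funext x; ring
    simp only [gradSq, this, pd_sub_const]
  have hkc : Continuous fun x => r t x * ‖z t x - w‖ ^ 2 :=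
    hrc.mul ((hzc.sub continuous_const).norm.pow 2)
  have hT2 : ∀ i j, Continuous fun x => relFlux r z w i j t x ^ 2 := fun i j =>
    ((hrc.mul (hyc i)).mul (hyc j)).pow 2
  have b1 := sum_torusInt_relMom_sq_le w hrc hzc hr
  have b2 : ∑ i, ∑ j, torusInt (fun x => relFlux r z w i j t x ^ 2)
      ≤ A * U ^ 2 * kin (r t) (z t) w := by
    have : ∑ i, ∑ j, torusInt (fun x => relFlux r z w i j t x ^ 2)
        = torusInt fun x => ∑ i, ∑ j, relFlux r z w i j t x ^ 2 := by
      rw [torusInt_sum _ fun i _ => continuous_finsetSum _ fun j _ => hT2 i j]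
      exact Finset.sum_congr rfl fun i _ => (torusInt_sum _ fun j _ => hT2 i j).symm
    rw [this, kin, ← torusInt_const_mul]
    refine torusInt_mono (continuous_finsetSum _ fun i _ => continuous_finsetSum _ fun j _ =>
      hT2 i j) (hkc.const_mul _) fun x => ?_
    have : ∑ i, ∑ j, relFlux r z w i j t x ^ 2
        = r t x * ‖z t x - w‖ ^ 2 * (r t x * ‖z t x - w‖ ^ 2) := by
      simp only [relFlux, norm_sub_sq, Fin.sum_univ_three]
      ring
    rw [this]
    have hs : ‖z t x - w‖ ^ 2 ≤ U ^ 2 := pow_le_pow_left₀ (norm_nonneg _) (hU x) 2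
    exact mul_le_mul_of_nonneg_right
      (mul_le_mul (hr x).2 hs (sq_nonneg _) ((hr x).1.trans (hr x).2))
      (mul_nonneg (hr x).1 (sq_nonneg _))
  have b3 := mul_le_mul_of_nonneg_left b2 (inv_pos.2 hθ).le
  rw [e1]
  linarith

/-! ### Kinetic energy and averaged velocities -/

lemma kin_nonneg {r : Coord → ℝ} (hr : ∀ x, 0 ≤ r x) (z : Coord → Vel) (w : Vel) :
    0 ≤ kin r z w := torusInt_nonneg fun x => mul_nonneg (hr x) (sq_nonneg _)

/-- Change of frame for the kinetic energy. -/
lemma kin_shift {r : Coord → ℝ} {z : Coord → Vel} (hr : Continuous r) (hz : Continuous z)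
    (w a : Vel) :
    kin r z a = kin r z w + (∑ i, 2 * (w i - a i) * torusInt (fun x => r x * (z x i - w i)))
      + mass r * ‖w - a‖ ^ 2 := by
  have hzc := continuous_apply_vel hz
  have hk : Continuous fun x => r x * ‖z x - w‖ ^ 2 := hr.mul ((hz.sub continuous_const).norm.pow 2)
  have hm : ∀ i, Continuous fun x => 2 * (w i - a i) * (r x * (z x i - w i)) := fun i =>
    (hr.mul ((hzc i).sub continuous_const)).const_mul _
  have e : (fun x => r x * ‖z x - a‖ ^ 2)
      = fun x => (r x * ‖z x - w‖ ^ 2 + ∑ i, 2 * (w i - a i) * (r x * (z x i - w i)))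
        + ‖w - a‖ ^ 2 * r x := by
    funext x
    simp only [norm_sub_sq, Fin.sum_univ_three]
    ring
  have hs : Continuous fun x => ∑ i, 2 * (w i - a i) * (r x * (z x i - w i)) :=
    continuous_finsetSum _ fun i _ => hm i
  have hks : Continuous fun x =>
      r x * ‖z x - w‖ ^ 2 + ∑ i, 2 * (w i - a i) * (r x * (z x i - w i)) := hk.add hs
  rw [kin, e, torusInt_add hks (hr.const_mul _), torusInt_add hk hs, torusInt_const_mul,
    torusInt_sum _ fun i _ => hm i]
  simp only [torusInt_const_mul, kin, mass]
  ring

lemma torusInt_mul_sub_apply {r : Coord → ℝ} {z : Coord → Vel} (hr : Continuous r)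
    (hz : Continuous z) (w : Vel) (i : Fin 3) :
    torusInt (fun x => r x * (z x i - w i))
      = torusInt (fun x => r x • z x) i - mass r * w i := by
  have hzc := continuous_apply_vel hz i
  have hrz : Continuous fun x => r x • z x := hr.smul hz
  rw [torusInt_vel_apply hrz]
  have e : (fun x => r x * (z x i - w i)) = fun x => r x * z x i - w i * r x := by
    funext x; ring
  have hrzi : Continuous fun x => r x * z x i := hr.mul hzc
  rw [e, torusInt_sub hrzi (hr.const_mul _), torusInt_const_mul, mass, mul_comm (w i)]
  rfl

/-- The averaged velocity minimizes the kinetic energy among all frames. -/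
lemma kin_eq_kin_meanVel {r : Coord → ℝ} {z : Coord → Vel} (hr : Continuous r) (hz : Continuous z)
    (hR : mass r ≠ 0) (a : Vel) :
    kin r z a = kin r z (meanVel r z) + mass r * ‖meanVel r z - a‖ ^ 2 := by
  have h0 : ∀ i, torusInt (fun x => r x * (z x i - meanVel r z i)) = 0 := by
    intro i
    rw [torusInt_mul_sub_apply hr hz]
    simp [meanVel, hR]
  rw [kin_shift hr hz (meanVel r z) a]
  simp [h0]

section TwoPhases

variable {r m : Coord → ℝ} {u v : Coord → Vel} {R N : ℝ} {w : Vel}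

/-- The velocity of the centre of mass minimizes the total kinetic energy among all frames. -/
lemma kin_add_kin_le (hr : Continuous r) (hm : Continuous m) (hu : Continuous u)
    (hv : Continuous v) (hr0 : ∀ x, 0 ≤ r x) (hm0 : ∀ x, 0 ≤ m x)
    (hw : ∀ i, torusInt (fun x => r x * (u x i - w i))
      + torusInt (fun x => m x * (v x i - w i)) = 0) (a : Vel) :
    kin r u w + kin m v w ≤ kin r u a + kin m v a := by
  rw [kin_shift hr hu w a, kin_shift hm hv w a]
  have h1 : ∑ i, 2 * (w i - a i) * torusInt (fun x => r x * (u x i - w i))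
      + ∑ i, 2 * (w i - a i) * torusInt (fun x => m x * (v x i - w i)) = 0 := by
    rw [← Finset.sum_add_distrib]
    exact Finset.sum_eq_zero fun i _ => by rw [← mul_add, hw i, mul_zero]
  have h2 : 0 ≤ mass r * ‖w - a‖ ^ 2 := mul_nonneg (torusInt_nonneg hr0) (sq_nonneg _)
  have h3 : 0 ≤ mass m * ‖w - a‖ ^ 2 := mul_nonneg (torusInt_nonneg hm0) (sq_nonneg _)
  linarith

/-- The relative kinetic energy is controlled by the dissipation: the viscosity confines `v` to its
mean by Poincaré's inequality, and the drag confines `u` to `v`. -/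
lemma kin_add_kin_le_dissipation {A B : ℝ} (hr : Continuous r) (hm : Continuous m)
    (hu : Continuous u) (hv : ∀ i, ContDiff ℝ 1 fun x => v x i) (hvc : Continuous v)
    (hvp : ∀ i, IsTorusFun fun x => v x i)
    (hrA : ∀ x, r x ∈ Icc 0 A) (hmB : ∀ x, m x ∈ Icc 0 B)
    (hw : ∀ i, torusInt (fun x => r x * (u x i - w i))
      + torusInt (fun x => m x * (v x i - w i)) = 0) :
    kin r u w + kin m v w ≤ 2 * torusInt (fun x => r x * ‖u x - v x‖ ^ 2)
      + (2 * A + B) * ∑ i, gradSq fun x => v x i := by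
  refine (kin_add_kin_le hr hm hu hvc (fun x => (hrA x).1) (fun x => (hmB x).1) hw
    (torusInt v)).trans ?_
  set a := torusInt v with ha
  have hy : Continuous fun x => ‖v x - a‖ ^ 2 := (hvc.sub continuous_const).norm.pow 2
  have hP : torusInt (fun x => ‖v x - a‖ ^ 2) ≤ ∑ i, gradSq fun x => v x i := by
    simp only [norm_sub_sq]
    have hc : ∀ i, Continuous fun x => (v x i - a i) ^ 2 := fun i =>
      ((hv i).continuous.sub continuous_const).pow 2
    rw [torusInt_sum _ fun i _ => hc i]
    refine Finset.sum_le_sum fun i _ => ?_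
    rw [ha, torusInt_vel_apply hvc]
    exact torusInt_sub_mean_sq_le (hv i) (hvp i)
  have hA : 0 ≤ A := (hrA 0).1.trans (hrA 0).2
  have hB : 0 ≤ B := (hmB 0).1.trans (hmB 0).2
  have h1 : kin m v a ≤ B * torusInt (fun x => ‖v x - a‖ ^ 2) := by
    rw [kin, ← torusInt_const_mul]
    exact torusInt_mono (hm.mul hy) (hy.const_mul B) fun x =>
      mul_le_mul_of_nonneg_right (hmB x).2 (sq_nonneg _)
  have hc : Continuous fun x => r x * ‖u x - v x‖ ^ 2 := hr.mul ((hu.sub hvc).norm.pow 2)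
  have h2 : kin r u a ≤ 2 * torusInt (fun x => r x * ‖u x - v x‖ ^ 2)
      + 2 * A * torusInt (fun x => ‖v x - a‖ ^ 2) := by
    rw [kin, ← torusInt_const_mul, ← torusInt_const_mul,
      ← torusInt_add (hc.const_mul _) (hy.const_mul _)]
    refine torusInt_mono (hr.mul ((hu.sub continuous_const).norm.pow 2))
      ((hc.const_mul _).add (hy.const_mul _)) fun x => ?_
    have t1 : ‖u x - a‖ ≤ ‖u x - v x‖ + ‖v x - a‖ := norm_sub_le_norm_sub_add_norm_sub _ _ _
    have t2 : ‖u x - a‖ ^ 2 ≤ 2 * ‖u x - v x‖ ^ 2 + 2 * ‖v x - a‖ ^ 2 := by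
      nlinarith [sq_nonneg (‖u x - v x‖ - ‖v x - a‖), norm_nonneg (u x - a)]
    have t3 := mul_le_mul_of_nonneg_left t2 (hrA x).1
    have t4 := mul_le_mul_of_nonneg_right (hrA x).2 (sq_nonneg ‖v x - a‖)
    linarith
  have h3 := mul_le_mul_of_nonneg_left hP (by positivity : 0 ≤ 2 * A + B)
  linarith

/-- The velocity part of the Lyapunov functional. -/
def lyapunovKin (r : Coord → ℝ) (u : Coord → Vel) (m : Coord → ℝ) (v : Coord → Vel) : ℝ :=
  kin r u (meanVel r u) + kin m v (meanVel m v) + ‖meanVel r u - meanVel m v‖ ^ 2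

lemma lyapunovKin_le (hr : Continuous r) (hm : Continuous m) (hu : Continuous u)
    (hv : Continuous v) (hr0 : ∀ x, 0 ≤ r x) (hm0 : ∀ x, 0 ≤ m x) (hR : mass r = R)
    (hN : mass m = N) (hR0 : 0 < R) (hN0 : 0 < N) (w : Vel) :
    lyapunovKin r u m v ≤ (1 + 2 / R + 2 / N) * (kin r u w + kin m v w) := by
  have e1 := kin_eq_kin_meanVel hr hu (hR.trans_ne hR0.ne') w
  have e2 := kin_eq_kin_meanVel hm hv (hN.trans_ne hN0.ne') w
  rw [hR] at e1
  rw [hN] at e2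
  have k1 := kin_nonneg hr0 u (meanVel r u)
  have k2 := kin_nonneg hm0 v (meanVel m v)
  have k3 := kin_nonneg hr0 u w
  have k4 := kin_nonneg hm0 v w
  have h1 : ‖meanVel r u - w‖ ^ 2 ≤ kin r u w / R := by
    rw [le_div_iff₀ hR0]; linarith
  have h2 : ‖meanVel m v - w‖ ^ 2 ≤ kin m v w / N := by
    rw [le_div_iff₀ hN0]; linarith
  have h3 : ‖meanVel r u - meanVel m v‖ ^ 2
      ≤ 2 * ‖meanVel r u - w‖ ^ 2 + 2 * ‖meanVel m v - w‖ ^ 2 := by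
    have t : ‖meanVel r u - meanVel m v‖ ≤ ‖meanVel r u - w‖ + ‖meanVel m v - w‖ := by
      rw [norm_sub_rev (meanVel m v) w]
      exact norm_sub_le_norm_sub_add_norm_sub _ _ _
    nlinarith [sq_nonneg (‖meanVel r u - w‖ - ‖meanVel m v - w‖),
      norm_nonneg (meanVel r u - meanVel m v)]
  have p1 : 0 ≤ R * ‖meanVel r u - w‖ ^ 2 := by positivity
  have p2 : 0 ≤ N * ‖meanVel m v - w‖ ^ 2 := by positivity
  have h4 : (1 + 2 / R + 2 / N) * (kin r u w + kin m v w)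
      = kin r u w + kin m v w + 2 * (kin r u w / R) + 2 * (kin m v w / N)
        + 2 / N * kin r u w + 2 / R * kin m v w := by
    ring
  have p3 : 0 ≤ 2 / N * kin r u w := by positivity
  have p4 : 0 ≤ 2 / R * kin m v w := by positivity
  rw [lyapunovKin, h4]
  linarith

lemma kin_add_kin_le_lyapunovKin (hr : Continuous r) (hm : Continuous m) (hu : Continuous u)
    (hv : Continuous v) (hr0 : ∀ x, 0 ≤ r x) (hm0 : ∀ x, 0 ≤ m x) (hN : mass m = N)
    (hN0 : 0 < N)
    (hw : ∀ i, torusInt (fun x => r x * (u x i - w i))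
      + torusInt (fun x => m x * (v x i - w i)) = 0) :
    kin r u w + kin m v w ≤ (1 + N) * lyapunovKin r u m v := by
  -- The centre of mass is the best frame, so the averaged velocity of one phase does no better.
  refine (kin_add_kin_le hr hm hu hv hr0 hm0 hw (meanVel r u)).trans ?_
  rw [kin_eq_kin_meanVel hm hv (hN.trans_ne hN0.ne') (meanVel r u), hN, norm_sub_rev, lyapunovKin]
  have k1 := kin_nonneg hr0 u (meanVel r u)
  have k2 := kin_nonneg hm0 v (meanVel m v)
  nlinarith [mul_nonneg hN0.le (add_nonneg k1 k2), sq_nonneg ‖meanVel r u - meanVel m v‖]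

end TwoPhases

/-! ### Relative internal energies -/

/-- The relative entropy density of the isothermal phase with respect to the constant density `R`,
regularized by `δ` so that it is smooth on vacuum. -/
def entropyIso (δ R x : ℝ) : ℝ := (x + δ) * Real.log ((x + δ) / (R + δ)) - (x + δ) + (R + δ)

lemma mul_log_div_le {a b : ℝ} (ha : 0 < a) (hb : 0 < b) :
    a * Real.log (a / b) - a + b ≤ (a - b) ^ 2 / b := by
  have h := mul_le_mul_of_nonneg_left (Real.log_le_sub_one_of_pos (div_pos ha hb)) ha.le
  have e : (a - b) ^ 2 / b = a * (a / b - 1) - a + b := by field_simp; ring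
  linarith

lemma le_mul_log_div {a b K : ℝ} (ha : 0 < a) (hb : 0 < b) (haK : a ≤ K) (hbK : b ≤ K) :
    (a - b) ^ 2 / (4 * K) ≤ a * Real.log (a / b) - a + b := by
  set s := Real.sqrt a with hs
  set q := Real.sqrt b with hq
  have hs0 : 0 < s := Real.sqrt_pos.2 ha
  have hq0 : 0 < q := Real.sqrt_pos.2 hb
  have es : a = s ^ 2 := (Real.sq_sqrt ha.le).symm
  have eq : b = q ^ 2 := (Real.sq_sqrt hb.le).symm
  -- `log (a / b) = - 2 log √(b / a)`, and `log x ≤ x - 1`.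
  have hl : Real.log (a / b) = -2 * Real.log (q / s) := by
    rw [es, eq, ← div_pow, Real.log_pow, Real.log_div hs0.ne' hq0.ne',
      Real.log_div hq0.ne' hs0.ne']
    push_cast; ring
  have h1 := mul_le_mul_of_nonneg_left (Real.log_le_sub_one_of_pos (div_pos hq0 hs0)) ha.le
  have h2 : a * (q / s - 1) = s * q - s ^ 2 := by rw [es]; field_simp
  have h3 : (s - q) ^ 2 ≤ a * Real.log (a / b) - a + b := by
    rw [hl, eq]; nlinarith
  refine le_trans ?_ h3
  rw [div_le_iff₀ (by linarith)]
  have h4 : (a - b) ^ 2 = (s - q) ^ 2 * (s + q) ^ 2 := by rw [es, eq]; ring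
  rw [h4]
  refine mul_le_mul_of_nonneg_left ?_ (sq_nonneg _)
  nlinarith [sq_nonneg (s - q)]

lemma hasDerivAt_entropyIso {δ R x : ℝ} (hx : 0 < x + δ) (hR : 0 < R + δ) :
    HasDerivAt (entropyIso δ R) (Real.log ((x + δ) / (R + δ))) x := by
  have h1 : HasDerivAt (fun y => y + δ) 1 x := (hasDerivAt_id x).add_const δ
  have h2 := (h1.div_const (R + δ)).log (div_pos hx hR).ne'
  have h3 := ((h1.fun_mul h2).fun_sub h1).add_const (R + δ)
  refine h3.congr_deriv ?_
  field_simp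
  ring

lemma contDiffOn_entropyIso {δ R : ℝ} (hδ : 0 < δ) (hR : 0 < R) :
    ContDiffOn ℝ 1 (entropyIso δ R) (Ici 0) := by
  have h1 : ContDiffOn ℝ 1 (fun y : ℝ => y + δ) (Ici 0) := by fun_prop
  have h2 : ContDiffOn ℝ 1 (fun y : ℝ => Real.log ((y + δ) / (R + δ))) (Ici 0) :=
    (h1.div_const _).log fun y hy =>
      (div_pos (add_pos_of_nonneg_of_pos hy hδ) (add_pos hR hδ)).ne'
  exact ((h1.mul h2).sub h1).add contDiffOn_const

/-- The relative internal energy density of the isentropic phase with respect to the constant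
density `N`. -/
def entropyPow (γ N x : ℝ) : ℝ := (x ^ γ - N ^ γ - γ * N ^ (γ - 1) * (x - N)) / (γ - 1)

section Pow

variable {γ N B x y : ℝ}

lemma hasDerivAt_entropyPow (hγ : 1 < γ) :
    HasDerivAt (entropyPow γ N) (γ * (x ^ (γ - 1) - N ^ (γ - 1)) / (γ - 1)) x := by
  have h1 := Real.hasDerivAt_rpow_const (x := x) (p := γ) (Or.inr hγ.le)
  have h2 := ((h1.sub_const (N ^ γ)).fun_sub
    (((hasDerivAt_id' x).sub_const N).const_mul (γ * N ^ (γ - 1)))).div_const (γ - 1)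
  refine h2.congr_deriv ?_
  ring

lemma contDiff_entropyPow (hγ : 1 < γ) : ContDiff ℝ 1 (entropyPow γ N) := by
  have h1 : ContDiff ℝ 1 fun x : ℝ => x ^ γ := Real.contDiff_rpow_const_of_le (by simpa using hγ.le)
  unfold entropyPow
  fun_prop

lemma rpow_mul_self (hγ : 1 < γ) (hx : 0 ≤ x) : x ^ γ = x ^ (γ - 1) * x := by
  rw [← Real.rpow_add_one' hx (by linarith)]
  congr 1; ring

/-- The tangent-line inequality for the convex function `x ^ γ`. -/
lemma rpow_tangent_le (hγ : 1 < γ) (hx : 0 ≤ x) (hy : 0 ≤ y) :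
    x ^ γ + γ * x ^ (γ - 1) * (y - x) ≤ y ^ γ := by
  rcases hx.eq_or_lt with h | h
  · rw [← h, Real.zero_rpow (by linarith), Real.zero_rpow (by linarith)]
    simpa using Real.rpow_nonneg hy γ
  · have hb := one_add_mul_self_le_rpow_one_add (s := y / x - 1)
      (by linarith [div_nonneg hy hx]) hγ.le
    have e : (1 + (y / x - 1)) ^ γ = y ^ γ / x ^ γ := by
      rw [add_sub_cancel, Real.div_rpow hy hx]
    rw [e, le_div_iff₀ (Real.rpow_pos_of_pos h γ)] at hb
    refine le_trans (le_of_eq ?_) hb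
    rw [rpow_mul_self hγ hx]
    field_simp

lemma mul_rpow_sub_ge (hγ : 1 < γ) (hN : 0 < N) (hx : 0 ≤ x) :
    N ^ (γ - 1) * (x - N) ^ 2 ≤ (x - N) * (x ^ γ - N ^ γ) := by
  rw [rpow_mul_self hγ hx, rpow_mul_self hγ hN.le]
  have h : 0 ≤ (x - N) * (x ^ (γ - 1) - N ^ (γ - 1)) := by
    rcases le_total x N with h | h
    · exact mul_nonneg_of_nonpos_of_nonpos (sub_nonpos.2 h)
        (sub_nonpos.2 (Real.rpow_le_rpow hx h (by linarith)))
    · exact mul_nonneg (sub_nonneg.2 h)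
        (sub_nonneg.2 (Real.rpow_le_rpow hN.le h (by linarith)))
  nlinarith [mul_nonneg hx h]

lemma entropyPow_le (hγ : 1 < γ) (hN : 0 < N) (hNB : N ≤ B) (hx : x ∈ Icc 0 B) :
    entropyPow γ N x ≤ γ ^ 2 * B ^ (γ - 1) / (N * (γ - 1)) * (x - N) ^ 2 := by
  have hg : 0 < γ - 1 := sub_pos.2 hγ
  have t1 := rpow_tangent_le hγ hx.1 hN.le
  have t2 := rpow_tangent_le hγ hN.le hx.1
  have hxB : x ^ (γ - 1) ≤ B ^ (γ - 1) := Real.rpow_le_rpow hx.1 hx.2 hg.le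
  have hNB' : N ^ (γ - 1) ≤ B ^ (γ - 1) := Real.rpow_le_rpow hN.le hNB hg.le
  have hx0 := Real.rpow_nonneg hx.1 (γ - 1)
  rw [entropyPow]
  rw [rpow_mul_self hγ hN.le, rpow_mul_self hγ hx.1] at *
  generalize x ^ (γ - 1) = a at *
  generalize N ^ (γ - 1) = c at *
  generalize B ^ (γ - 1) = b at *
  -- The secant slope of `x ^ γ` is at most `γ max (x, N) ^ (γ - 1)`.
  have key : N * ((a - c) * (x - N)) ≤ γ * b * (x - N) ^ 2 := by
    have e : N * ((a - c) * (x - N)) = (a * x - c * N) * (x - N) - a * (x - N) ^ 2 := by ring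
    have h0 : 0 ≤ a * (x - N) ^ 2 := by positivity
    rw [e]
    rcases le_total N x with h | h
    · have h1 : a * x - c * N ≤ γ * b * (x - N) := by
        nlinarith [mul_le_mul_of_nonneg_left hxB (mul_nonneg (by linarith : 0 ≤ γ)
          (sub_nonneg.2 h))]
      nlinarith [mul_le_mul_of_nonneg_right h1 (sub_nonneg.2 h)]
    · have h1 : c * N - a * x ≤ γ * b * (N - x) := by
        nlinarith [mul_le_mul_of_nonneg_left hNB' (mul_nonneg (by linarith : 0 ≤ γ)
          (sub_nonneg.2 h))]
      nlinarith [mul_le_mul_of_nonneg_right h1 (sub_nonneg.2 h)]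
  rw [div_mul_eq_mul_div, div_le_div_iff₀ hg (by positivity)]
  have h2 : a * x - c * N - γ * c * (x - N) ≤ γ * ((a - c) * (x - N)) := by linarith
  have h3 : N * (a * x - c * N - γ * c * (x - N)) ≤ γ * (γ * b * (x - N) ^ 2) :=
    calc _ ≤ N * (γ * ((a - c) * (x - N))) := mul_le_mul_of_nonneg_left h2 hN.le
      _ = γ * (N * ((a - c) * (x - N))) := by ring
      _ ≤ _ := mul_le_mul_of_nonneg_left key (by linarith)
  nlinarith [mul_le_mul_of_nonneg_right h3 hg.le]

lemma le_rpow_sub_rpow {α a b : ℝ} (hα : 0 < α) (ha : 0 < a) (hab : a ≤ b) :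
    α * a ^ α / b * (b - a) ≤ b ^ α - a ^ α := by
  have hb := ha.trans_le hab
  have hp := Real.rpow_pos_of_pos ha α
  have h1 := Real.one_sub_inv_le_log_of_pos (div_pos hb ha)
  have h2 := Real.log_le_sub_one_of_pos (Real.rpow_pos_of_pos (div_pos hb ha) α)
  rw [Real.log_rpow (div_pos hb ha), Real.div_rpow hb.le ha.le] at h2
  have h3 := mul_le_mul_of_nonneg_left ((mul_le_mul_of_nonneg_left h1 hα.le).trans h2) hp.le
  have e1 : a ^ α * (α * (1 - (b / a)⁻¹)) = α * a ^ α / b * (b - a) := by field_simp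
  have e2 : a ^ α * (b ^ α / a ^ α - 1) = b ^ α - a ^ α := by field_simp
  rwa [e1, e2] at h3

lemma le_rpow_sub_rpow_mul_sub {α L a b : ℝ} (hα : 0 < α) (hL : 0 < L) (ha : a ∈ Icc L B)
    (hb : b ∈ Icc L B) :
    α * L ^ α / B * (a - b) ^ 2 ≤ (a ^ α - b ^ α) * (a - b) := by
  wlog hab : b ≤ a generalizing a b
  · have := this hb ha (le_of_not_ge hab)
    nlinarith
  have hb0 := hL.trans_le hb.1
  have ha0 := hL.trans_le ha.1
  have h1 := mul_le_mul_of_nonneg_right (le_rpow_sub_rpow hα hb0 hab) (sub_nonneg.2 hab)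
  refine le_trans ?_ h1
  rw [mul_assoc _ (a - b), ← sq]
  refine mul_le_mul_of_nonneg_right ?_ (sq_nonneg _)
  have h2 : L ^ α ≤ b ^ α := Real.rpow_le_rpow hL.le hb.1 hα.le
  have h3 : 0 ≤ L ^ α := Real.rpow_nonneg hL.le α
  have h4 := ha.2
  gcongr

lemma le_entropyPow (hγ : 1 < γ) (hN : 0 < N) (hNB : N ≤ B) (hx : x ∈ Icc 0 B) :
    γ * (N / 2) ^ (γ - 1) / (4 * B) * (x - N) ^ 2 ≤ entropyPow γ N x := by
  have hg : 0 < γ - 1 := sub_pos.2 hγ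
  have hx0 := hx.1
  have hxB := hx.2
  have hB : 0 < B := hN.trans_le hNB
  -- Convexity through the midpoint avoids the degenerate or singular behaviour at vacuum.
  set m := (x + N) / 2 with hm
  have hm0 : 0 ≤ m := by positivity
  have t1 := rpow_tangent_le hγ hm0 hx0
  have t2 := rpow_tangent_le hγ hN.le hm0
  have h1 := le_rpow_sub_rpow_mul_sub (B := B) (a := m) (b := N) hg (half_pos hN)
    ⟨by linarith, by linarith⟩ ⟨by linarith, hNB⟩
  rw [entropyPow, le_div_iff₀ hg]
  have e1 : x - m = m - N := by rw [hm]; ring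
  have e2 : x - N = 2 * (m - N) := by rw [hm]; ring
  rw [e1] at t1
  rw [e2]
  have h2 := mul_le_mul_of_nonneg_left h1 (by linarith : 0 ≤ γ)
  have e3 : γ * (N / 2) ^ (γ - 1) / (4 * B) * (2 * (m - N)) ^ 2 * (γ - 1)
      = γ * ((γ - 1) * (N / 2) ^ (γ - 1) / B * (m - N) ^ 2) := by
    field_simp; ring
  rw [e3]
  nlinarith

end Pow

/-! ### Solutions with bounded densities and velocities -/

section Phases

variable {γ μ lam : ℝ} {ρ : ℝ → Coord → ℝ} {u : ℝ → Coord → Vel} {n : ℝ → Coord → ℝ}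
  {v : ℝ → Coord → Vel}

lemma IsC1.rpow {f : ℝ → Coord → ℝ} (hf : IsC1 f) (hγ : 1 < γ) : IsC1 fun t x => f t x ^ γ :=
  hf.comp (s := univ) (b := fun x => x ^ γ)
    (Real.contDiff_rpow_const_of_le (by simpa using hγ.le)).contDiffOn fun _ _ _ => mem_univ _

/-- The drag force exerted on the isentropic phase. -/
def drag (ρ : ℝ → Coord → ℝ) (u v : ℝ → Coord → Vel) (i : Fin 3) (t : ℝ) (x : Coord) : ℝ :=
  ρ t x * (u t x i - v t x i)

lemma IsGlobalClassicalSolution.isC1_drag (h : IsGlobalClassicalSolution γ μ lam ρ u n v)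
    (i : Fin 3) : IsC1 (drag ρ u v i) := h.ρ_C1.mul ((h.u_C1.apply i).sub (h.v_C1.apply i))

lemma lame_zero (w : Coord → Vel) (i : Fin 3) (x : Coord) : lame 0 0 w i x = 0 := by simp [lame]

lemma IsGlobalClassicalSolution.isPhase_ρ (h : IsGlobalClassicalSolution γ μ lam ρ u n v) :
    IsPhase 0 0 ρ u v ρ fun i t x => -drag ρ u v i t x where
  r_C1 := h.ρ_C1
  z_C1 := h.u_C1
  v_C1 := h.v_C1
  p_C1 := h.ρ_C1
  g_C1 i := by simpa using (h.isC1_drag i).const_mul (-1)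
  v_C2 := h.v_C2
  mass := h.mass_ρ
  momentum t ht x i := by
    rw [lame_zero, add_zero]
    exact h.momentum_ρ t ht x i

lemma IsGlobalClassicalSolution.isPhase_n (h : IsGlobalClassicalSolution γ μ lam ρ u n v)
    (hγ : 1 < γ) : IsPhase μ lam n v v (fun t x => n t x ^ γ) (drag ρ u v) where
  r_C1 := h.n_C1
  z_C1 := h.v_C1
  v_C1 := h.v_C1
  p_C1 := h.n_C1.rpow hγ
  g_C1 := h.isC1_drag
  v_C2 := h.v_C2
  mass := h.mass_n
  momentum := h.momentum_n

end Phases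

/-- A global classical solution whose densities are bounded by `A` and `B` and have masses `R` and
`N`, whose velocities are at most `U` relative to a constant velocity `w`, and whose total momentum
vanishes in the frame moving with velocity `w`. -/
structure IsBoundedSolution (γ μ lam A B R N U : ℝ)
    (ρ : ℝ → Coord → ℝ) (u : ℝ → Coord → Vel) (n : ℝ → Coord → ℝ) (v : ℝ → Coord → Vel) (w : Vel) :
    Prop where
  sol : IsGlobalClassicalSolution γ μ lam ρ u n v
  ρ_mem : ∀ t, 0 ≤ t → ∀ x, ρ t x ∈ Icc 0 A
  n_mem : ∀ t, 0 ≤ t → ∀ x, n t x ∈ Icc 0 B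
  mass_ρ : ∀ t, 0 ≤ t → mass (ρ t) = R
  mass_n : ∀ t, 0 ≤ t → mass (n t) = N
  momentum : ∀ t, 0 ≤ t → ∀ i, torusInt (fun x => ρ t x * (u t x i - w i))
    + torusInt (fun x => n t x * (v t x i - w i)) = 0
  u_le : ∀ t, 0 ≤ t → ∀ x, ‖u t x - w‖ ≤ U
  v_le : ∀ t, 0 ≤ t → ∀ x, ‖v t x - w‖ ≤ U

lemma eq_initial_of_hasDerivAt_zero {f : ℝ → ℝ} (hc : ContinuousOn f (Ici 0))
    (hd : ∀ t, 0 < t → HasDerivAt f 0 t) {t : ℝ} (ht : 0 ≤ t) : f t = f 0 := by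
  rcases ht.eq_or_lt with rfl | ht
  · rfl
  obtain ⟨c, _, hc⟩ := exists_hasDerivAt_eq_slope f (fun _ => 0) ht
    (hc.mono Icc_subset_Ici_self) fun x hx => hd x hx.1
  rw [eq_div_iff (by linarith), zero_mul] at hc
  linarith

lemma norm_torusInt_smul_le {r : Coord → ℝ} {z : Coord → Vel} {M : ℝ} (hr : Continuous r)
    (hr0 : ∀ x, 0 ≤ r x) (hM : ∀ x, ‖z x‖ ≤ M) :
    ‖torusInt fun x => r x • z x‖ ≤ mass r * M := by
  have h : ‖torusInt fun x => r x • z x‖ ≤ ∫ x in Icc (0 : Coord) 1, r x * M :=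
    norm_integral_le_of_norm_le (integrableOn_cube (hr.mul continuous_const))
      (Filter.Eventually.of_forall fun x => by
        rw [norm_smul, Real.norm_of_nonneg (hr0 x)]
        exact mul_le_mul_of_nonneg_left (hM x) (hr0 x))
  rwa [integral_mul_const] at h

/-- The masses and the total momentum are conserved, so a solution is bounded in the frame moving
with the velocity of the centre of mass. -/
lemma IsGlobalClassicalSolution.exists_isBoundedSolution {γ μ lam A B R N M : ℝ}
    {ρ : ℝ → Coord → ℝ} {u : ℝ → Coord → Vel} {n : ℝ → Coord → ℝ} {v : ℝ → Coord → Vel}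
    (h : IsGlobalClassicalSolution γ μ lam ρ u n v) (hγ : 1 < γ) (hR : 0 < R) (hN : 0 < N)
    (hρ : ∀ t, 0 ≤ t → ∀ x, ρ t x ∈ Icc 0 A) (hn : ∀ t, 0 ≤ t → ∀ x, n t x ∈ Icc 0 B)
    (hρm : mass (ρ 0) = R) (hnm : mass (n 0) = N) (hu : ∀ t, 0 ≤ t → ∀ x, ‖u t x‖ ≤ M)
    (hv : ∀ t, 0 ≤ t → ∀ x, ‖v t x‖ ≤ M) :
    ∃ w, IsBoundedSolution γ μ lam A B R N (2 * M) ρ u n v w := by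
  have hP := h.isPhase_ρ
  have hQ := h.isPhase_n hγ
  have ρc := h.ρ_C1.continuous_slice le_rfl
  have nc := h.n_C1.continuous_slice le_rfl
  have uc := h.u_C1.continuous_slice le_rfl
  have vc := h.v_C1.continuous_slice le_rfl
  set w : Vel := (R + N)⁻¹ • (torusInt (fun x => ρ 0 x • u 0 x) + torusInt fun x => n 0 x • v 0 x)
    with hw
  have hRN : 0 < R + N := add_pos hR hN
  have hwM : ‖w‖ ≤ M := by
    rw [hw, norm_smul, norm_inv, Real.norm_of_nonneg hRN.le, inv_mul_le_iff₀ hRN]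
    refine (norm_add_le _ _).trans ?_
    have h1 := norm_torusInt_smul_le ρc (fun x => (hρ 0 le_rfl x).1) (hu 0 le_rfl)
    have h2 := norm_torusInt_smul_le nc (fun x => (hn 0 le_rfl x).1) (hv 0 le_rfl)
    rw [hρm] at h1
    rw [hnm] at h2
    linarith
  refine ⟨w, h, hρ, hn, fun t ht => ?_, fun t ht => ?_, fun t ht i => ?_, fun t ht x => ?_,
    fun t ht x => ?_⟩
  · rw [← hρm]
    exact eq_initial_of_hasDerivAt_zero (continuousOn_torusInt_of_continuousOn h.ρ_C1.cont)
      (fun t ht => hP.hasDerivAt_mass ht) ht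
  · rw [← hnm]
    exact eq_initial_of_hasDerivAt_zero (continuousOn_torusInt_of_continuousOn h.n_C1.cont)
      (fun t ht => hQ.hasDerivAt_mass ht) ht
  · have h0 : torusInt (fun x => ρ 0 x * (u 0 x i - w i))
        + torusInt (fun x => n 0 x * (v 0 x i - w i)) = 0 := by
      rw [torusInt_mul_sub_apply ρc uc, torusInt_mul_sub_apply nc vc, hρm, hnm]
      have e : (R + N) * w i = torusInt (fun x => ρ 0 x • u 0 x) i
          + torusInt (fun x => n 0 x • v 0 x) i := by
        rw [hw]
        simp only [PiLp.smul_apply, PiLp.add_apply, smul_eq_mul]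
        rw [mul_inv_cancel_left₀ hRN.ne']
      linarith
    rw [← h0]
    refine eq_initial_of_hasDerivAt_zero
      (f := fun t => torusInt (relMom ρ u w i t) + torusInt (relMom n v w i t))
      ((continuousOn_torusInt_of_continuousOn (hP.isC1_relMom w i).cont).add
        (continuousOn_torusInt_of_continuousOn (hQ.isC1_relMom w i).cont)) (fun t ht => ?_) ht
    refine ((hP.hasDerivAt_momentum w ht i).add (hQ.hasDerivAt_momentum w ht i)).congr_deriv ?_
    rw [torusInt_neg, neg_add_cancel]
  · exact (norm_sub_le _ _).trans (by linarith [hu t ht x])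
  · exact (norm_sub_le _ _).trans (by linarith [hv t ht x])

/-- The squared distance of the densities `r`, `m` to the constants `R`, `N`. -/
def fluct (R N : ℝ) (r m : Coord → ℝ) : ℝ :=
  torusInt (fun x => (r x - R) ^ 2) + torusInt fun x => (m x - N) ^ 2

/-- The relative energy of a state, in the frame moving with velocity `w`; the parameter `δ`
regularizes the isothermal entropy. -/
def relEnergy (γ δ R N : ℝ) (r : Coord → ℝ) (u : Coord → Vel) (m : Coord → ℝ) (v : Coord → Vel)
    (w : Vel) : ℝ :=
  kin r u w / 2 + kin m v w / 2 + torusInt (fun x => entropyIso δ R (r x))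
    + torusInt fun x => entropyPow γ N (m x)

lemma torusInt_div {z : Coord → Vel} (hz : ∀ j, ContDiff ℝ 1 fun x => z x j)
    (hp : ∀ j, IsTorusFun fun x => z x j) : torusInt (div z) = 0 := by
  have e : div z = fun x => ∑ j, pd j (fun y => z y j) x := rfl
  rw [e, torusInt_sum _ fun j _ => continuous_pd (hz j) j]
  exact Finset.sum_eq_zero fun j _ => torusInt_pd (hz j) (hp j) j

namespace IsBoundedSolution

variable {γ μ lam A B R N U δ : ℝ} {ρ : ℝ → Coord → ℝ} {u : ℝ → Coord → Vel}
  {n : ℝ → Coord → ℝ} {v : ℝ → Coord → Vel} {w : Vel}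

/-- The energy balance. The last term is the price of regularizing the entropy on vacuum. -/
lemma hasDerivAt_relEnergy (h : IsBoundedSolution γ μ lam A B R N U ρ u n v w) (hγ : 1 < γ)
    (hR : 0 < R) (hN : 0 < N) (hδ : 0 < δ) {t : ℝ} (ht : 0 < t) :
    HasDerivAt (fun s => relEnergy γ δ R N (ρ s) (u s) (n s) (v s) w)
      (-(torusInt (fun x => ρ t x * ‖u t x - v t x‖ ^ 2) + μ * (∑ i, gradSq fun x => v t x i)
          + (μ + lam) * torusInt fun x => div (v t) x ^ 2)
        + δ * torusInt fun x => Real.log ((ρ t x + δ) / (R + δ)) * div (u t) x) t := by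
  have hP := h.sol.isPhase_ρ
  have hQ := h.sol.isPhase_n hγ
  have ρ0 : ∀ s, 0 ≤ s → ∀ x, ρ s x ∈ Ici (0 : ℝ) := fun s hs x => (h.ρ_mem s hs x).1
  have hρδ : ∀ x, 0 < ρ t x + δ := fun x => add_pos_of_nonneg_of_pos (ρ0 t ht.le x) hδ
  have ρc := h.sol.ρ_C1.continuous_slice ht.le
  have nc := h.sol.n_C1.continuous_slice ht.le
  have uc := h.sol.u_C1.continuous_slice ht.le
  have vc := h.sol.v_C1.continuous_slice ht.le
  have uci := continuous_apply_vel uc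
  have vci := continuous_apply_vel vc
  have pc : Continuous fun x => n t x ^ γ := hQ.p_C1.continuous_slice ht.le
  have hu1 : ∀ j, ContDiff ℝ 1 fun x => u t x j := fun j => (h.sol.u_C1.apply j).contDiff_slice ht
  have hv1 : ∀ j, ContDiff ℝ 1 fun x => v t x j := fun j => (h.sol.v_C1.apply j).contDiff_slice ht
  have hdu := continuous_div hu1
  have hdv := continuous_div hv1
  have hdu0 := torusInt_div hu1 fun j => (h.sol.u_C1.apply j).periodic t ht.le
  have hdv0 := torusInt_div hv1 fun j => (h.sol.v_C1.apply j).periodic t ht.le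
  have hlog : Continuous fun x => Real.log ((ρ t x + δ) / (R + δ)) :=
    ((ρc.add continuous_const).div_const _).log fun x => (div_pos (hρδ x) (add_pos hR hδ)).ne'
  have k1 := hP.hasDerivAt_kin w ht
  have k2 := hQ.hasDerivAt_kin w ht
  have k3 := hP.hasDerivAt_torusInt_comp (b := entropyIso δ R)
    (b' := fun y => Real.log ((y + δ) / (R + δ))) ht
    (h.sol.ρ_C1.comp (contDiffOn_entropyIso hδ hR) ρ0)
    (fun x => hasDerivAt_entropyIso (hρδ x) (add_pos hR hδ)) hlog
  have hn1 : Continuous fun x => γ * (n t x ^ (γ - 1) - N ^ (γ - 1)) / (γ - 1) :=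
    (((nc.rpow_const fun _ => Or.inr (sub_pos.2 hγ).le).sub continuous_const).const_mul
      γ).div_const _
  have k4 := hQ.hasDerivAt_torusInt_comp (b := entropyPow γ N)
    (b' := fun y => γ * (y ^ (γ - 1) - N ^ (γ - 1)) / (γ - 1)) ht
    (h.sol.n_C1.comp (s := univ) (contDiff_entropyPow hγ).contDiffOn fun _ _ _ => mem_univ _)
    (fun x => hasDerivAt_entropyPow hγ) hn1
  refine (((k1.add k2).add k3).add k4).congr_deriv ?_
  have e1 : ∑ i, torusInt (fun x => (u t x i - w i) * lame 0 0 (v t) i x) = 0 := by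
    simp [lame_zero, torusInt_const]
  have e2 := sum_torusInt_mul_lame (μ := μ) (lam := lam) (hQ.contDiff_v ht) (hQ.isTorusFun_v ht) w
  have cd1 : ∀ i, Continuous fun x => (u t x i - w i) * -drag ρ u v i t x := fun i =>
    ((uci i).sub continuous_const).mul (hP.g_C1 i |>.continuous_slice ht.le)
  have cd2 : ∀ i, Continuous fun x => (v t x i - w i) * drag ρ u v i t x := fun i =>
    ((vci i).sub continuous_const).mul (hQ.g_C1 i |>.continuous_slice ht.le)
  have e3 : ∑ i, torusInt (fun x => (u t x i - w i) * -drag ρ u v i t x)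
      + ∑ i, torusInt (fun x => (v t x i - w i) * drag ρ u v i t x)
      = -torusInt fun x => ρ t x * ‖u t x - v t x‖ ^ 2 := by
    rw [← Finset.sum_add_distrib, ← torusInt_neg]
    simp only [← torusInt_add (cd1 _) (cd2 _)]
    have cd : ∀ i, Continuous fun x => (u t x i - w i) * -drag ρ u v i t x
        + (v t x i - w i) * drag ρ u v i t x := fun i => (cd1 i).add (cd2 i)
    rw [← torusInt_sum _ fun i _ => cd i]
    congr 1; funext x
    simp only [norm_sub_sq, drag, Fin.sum_univ_three]
    ring
  have e4 : torusInt (fun x => (Real.log ((ρ t x + δ) / (R + δ)) * ρ t x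
        - entropyIso δ R (ρ t x)) * div (u t) x)
      = torusInt (fun x => ρ t x * div (u t) x)
        - δ * torusInt fun x => Real.log ((ρ t x + δ) / (R + δ)) * div (u t) x := by
    have c1 : Continuous fun x => ρ t x * div (u t) x := ρc.mul hdu
    have c2 : Continuous fun x => Real.log ((ρ t x + δ) / (R + δ)) * div (u t) x := hlog.mul hdu
    have e : (fun x => (Real.log ((ρ t x + δ) / (R + δ)) * ρ t x
        - entropyIso δ R (ρ t x)) * div (u t) x)
        = fun x => (ρ t x * div (u t) x
          - δ * (Real.log ((ρ t x + δ) / (R + δ)) * div (u t) x)) - R * div (u t) x := by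
      funext x; simp only [entropyIso]; ring
    have c3 : Continuous fun x => ρ t x * div (u t) x
          - δ * (Real.log ((ρ t x + δ) / (R + δ)) * div (u t) x) := c1.sub (c2.const_mul δ)
    rw [e, torusInt_sub c3 (hdu.const_mul R), torusInt_sub c1 (c2.const_mul δ),
      torusInt_const_mul, torusInt_const_mul, hdu0, mul_zero, sub_zero]
  have e5 : torusInt (fun x => (γ * (n t x ^ (γ - 1) - N ^ (γ - 1)) / (γ - 1) * n t x
        - entropyPow γ N (n t x)) * div (v t) x)
      = torusInt (fun x => n t x ^ γ * div (v t) x) := by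
    have hg : γ - 1 ≠ 0 := (sub_pos.2 hγ).ne'
    have c1 : Continuous fun x => n t x ^ γ * div (v t) x := pc.mul hdv
    have e : (fun x => (γ * (n t x ^ (γ - 1) - N ^ (γ - 1)) / (γ - 1) * n t x
        - entropyPow γ N (n t x)) * div (v t) x)
        = fun x => n t x ^ γ * div (v t) x - N ^ γ * div (v t) x := by
      funext x
      rw [entropyPow, rpow_mul_self hγ (h.n_mem t ht.le x).1, rpow_mul_self hγ hN.le]
      field_simp
      ring
    rw [e, torusInt_sub c1 (hdv.const_mul _), torusInt_const_mul, hdv0, mul_zero, sub_zero]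
  rw [e4, e5, e1, e2]
  linarith

lemma kin_nonneg_ρ (h : IsBoundedSolution γ μ lam A B R N U ρ u n v w) {t : ℝ} (ht : 0 ≤ t)
    (a : Vel) : 0 ≤ kin (ρ t) (u t) a := kin_nonneg (fun x => (h.ρ_mem t ht x).1) _ _

lemma kin_nonneg_n (h : IsBoundedSolution γ μ lam A B R N U ρ u n v w) {t : ℝ} (ht : 0 ≤ t)
    (a : Vel) : 0 ≤ kin (n t) (v t) a := kin_nonneg (fun x => (h.n_mem t ht x).1) _ _

lemma torusInt_drag_sq_le (h : IsBoundedSolution γ μ lam A B R N U ρ u n v w) {t : ℝ}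
    (ht : 0 ≤ t) :
    ∑ i, torusInt (fun x => drag ρ u v i t x ^ 2)
      ≤ A * torusInt fun x => ρ t x * ‖u t x - v t x‖ ^ 2 := by
  have ρc := h.sol.ρ_C1.continuous_slice ht
  have hd : Continuous fun x => u t x - v t x :=
    (h.sol.u_C1.continuous_slice ht).sub (h.sol.v_C1.continuous_slice ht)
  have hc : ∀ i, Continuous fun x => drag ρ u v i t x ^ 2 := fun i =>
    ((h.sol.isC1_drag i).continuous_slice ht).pow 2
  rw [← torusInt_sum _ fun i _ => hc i, ← torusInt_const_mul]
  refine torusInt_mono (continuous_finsetSum _ fun i _ => hc i)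
    ((ρc.mul (hd.norm.pow 2)).const_mul A) fun x => ?_
  have e : ∑ i, drag ρ u v i t x ^ 2 = ρ t x * (ρ t x * ‖u t x - v t x‖ ^ 2) := by
    simp only [drag, norm_sub_sq, Fin.sum_univ_three]
    ring
  rw [e]
  have hρ := h.ρ_mem t ht x
  exact mul_le_mul_of_nonneg_right hρ.2 (mul_nonneg hρ.1 (sq_nonneg _))

/-- The compensating functionals of both phases together dissipate the density fluctuations. The
pressure of the isentropic phase is strictly increasing, with secant slopes from `N` at least
`N ^ (γ - 1)`. -/
lemma exists_hasDerivAt_cross (h : IsBoundedSolution γ μ lam A B R N U ρ u n v w) (hγ : 1 < γ)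
    (hN : 0 < N) {κ : ℝ} (hκ : 0 < κ) (hκ1 : κ ≤ 1) (hκN : κ ≤ N ^ (γ - 1)) {t : ℝ} (ht : 0 < t)
    {k : ℕ} (hk : 0 < k) :
    ∃ X', HasDerivAt (fun s => cross k (fun x => ρ s x - R) (fun i => relMom ρ u w i s)
        + cross k (fun x => n s x - N) (fun i => relMom n v w i s)) X' t ∧
      X' ≤ -(κ / 2 * fluct R N (ρ t) (n t))
        + (A + B) * (kin (ρ t) (u t) w + kin (n t) (v t) w)
        + (κ / 2)⁻¹ * ((A + B) * U ^ 2 * (kin (ρ t) (u t) w + kin (n t) (v t) w)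
          + (2 * μ + lam) ^ 2 * torusInt (fun x => div (v t) x ^ 2)
          + 2 * A * torusInt (fun x => ρ t x * ‖u t x - v t x‖ ^ 2))
        + gradSq (fun x => ρ t x + ρ t x) / (4 * k ^ 2)
        + gradSq (fun x => n t x + n t x ^ γ) / (4 * k ^ 2) := by
  have hP := h.sol.isPhase_ρ
  have hQ := h.sol.isPhase_n hγ
  have nc := h.sol.n_C1.continuous_slice ht.le
  have pc : Continuous fun x => n t x ^ γ := hQ.p_C1.continuous_slice ht.le
  obtain ⟨X, hX, hXle⟩ := hP.exists_hasDerivAt_cross w (p₀ := R) ht (h.mass_ρ t ht.le)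
    (h.ρ_mem t ht.le) (h.u_le t ht.le) (half_pos hκ) hk
  obtain ⟨Y, hY, hYle⟩ := hQ.exists_hasDerivAt_cross w (p₀ := N ^ γ) ht (h.mass_n t ht.le)
    (h.n_mem t ht.le) (h.v_le t ht.le) (half_pos hκ) hk
  refine ⟨X + Y, hX.add hY, ?_⟩
  have hd := h.torusInt_drag_sq_le ht.le
  have a1 : κ * torusInt (fun x => (ρ t x - R) ^ 2)
      ≤ torusInt fun x => (ρ t x - R) * (ρ t x - R) := by
    simp only [← sq]
    exact mul_le_of_le_one_left (torusInt_nonneg fun x => sq_nonneg _) hκ1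
  have a2 : κ * torusInt (fun x => (n t x - N) ^ 2)
      ≤ torusInt fun x => (n t x - N) * (n t x ^ γ - N ^ γ) := by
    rw [← torusInt_const_mul]
    refine torusInt_mono (by fun_prop) (by fun_prop) fun x => ?_
    exact (mul_le_mul_of_nonneg_right hκN (sq_nonneg _)).trans
      (mul_rpow_sub_ge hγ hN (h.n_mem t ht.le x).1)
  have hA : 0 ≤ A := (h.ρ_mem t ht.le 0).1.trans (h.ρ_mem t ht.le 0).2
  have hB : 0 ≤ B := (h.n_mem t ht.le 0).1.trans (h.n_mem t ht.le 0).2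
  have k1 := h.kin_nonneg_ρ ht.le w
  have k2 := h.kin_nonneg_n ht.le w
  have hθ : 0 < (κ / 2)⁻¹ := inv_pos.2 (half_pos hκ)
  simp only [neg_sq, mul_zero, add_zero, zero_mul, ne_eq, OfNat.ofNat_ne_zero, not_false_eq_true,
    zero_pow] at hXle
  have m1 : 0 ≤ B * kin (ρ t) (u t) w := mul_nonneg hB k1
  have m2 : 0 ≤ A * kin (n t) (v t) w := mul_nonneg hA k2
  have m3 : 0 ≤ (κ / 2)⁻¹ * (B * U ^ 2 * kin (ρ t) (u t) w) := by positivity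
  have m4 : 0 ≤ (κ / 2)⁻¹ * (A * U ^ 2 * kin (n t) (v t) w) := by positivity
  have m5 := mul_le_mul_of_nonneg_left hd hθ.le
  simp only [fluct]
  linarith

/-- The relative energy is equivalent to the sum of the relative kinetic energies and the density
fluctuations, uniformly in the regularization. -/
lemma relEnergy_bounds (h : IsBoundedSolution γ μ lam A B R N U ρ u n v w) (hγ : 1 < γ)
    (hR : 0 < R) (hN : 0 < N) (hRA : R ≤ A) (hNB : N ≤ B) (hδ : 0 < δ) (hδ1 : δ ≤ 1) {t : ℝ}
    (ht : 0 ≤ t) :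
    (1 / 2) * (kin (ρ t) (u t) w + kin (n t) (v t) w)
        + 1 / (4 * (A + 1)) * torusInt (fun x => (ρ t x - R) ^ 2)
        + γ * (N / 2) ^ (γ - 1) / (4 * B) * torusInt (fun x => (n t x - N) ^ 2)
      ≤ relEnergy γ δ R N (ρ t) (u t) (n t) (v t) w ∧
    relEnergy γ δ R N (ρ t) (u t) (n t) (v t) w
      ≤ (1 / 2) * (kin (ρ t) (u t) w + kin (n t) (v t) w)
        + 1 / R * torusInt (fun x => (ρ t x - R) ^ 2)
        + γ ^ 2 * B ^ (γ - 1) / (N * (γ - 1)) * torusInt (fun x => (n t x - N) ^ 2) := by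
  have ρc := h.sol.ρ_C1.continuous_slice ht
  have nc := h.sol.n_C1.continuous_slice ht
  have hρδ : ∀ x, 0 < ρ t x + δ := fun x => add_pos_of_nonneg_of_pos (h.ρ_mem t ht x).1 hδ
  have hRδ : 0 < R + δ := add_pos hR hδ
  have hA : 0 < A + 1 := by linarith
  have cρ : Continuous fun x => (ρ t x - R) ^ 2 := by fun_prop
  have cn : Continuous fun x => (n t x - N) ^ 2 := by fun_prop
  have cI : Continuous fun x => entropyIso δ R (ρ t x) := by
    have := (contDiffOn_entropyIso hδ hR).continuousOn.comp_continuous ρc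
      fun x => (h.ρ_mem t ht x).1
    exact this
  have cP : Continuous fun x => entropyPow γ N (n t x) :=
    (contDiff_entropyPow hγ).continuous.comp nc
  have l1 : 1 / (4 * (A + 1)) * torusInt (fun x => (ρ t x - R) ^ 2)
      ≤ torusInt fun x => entropyIso δ R (ρ t x) := by
    rw [← torusInt_const_mul]
    refine torusInt_mono (cρ.const_mul _) cI fun x => ?_
    have := le_mul_log_div (K := A + 1) (hρδ x) hRδ
      (by linarith [(h.ρ_mem t ht x).2]) (by linarith)
    rwa [add_sub_add_right_eq_sub, div_eq_inv_mul, ← one_div] at this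
  have l2 : torusInt (fun x => entropyIso δ R (ρ t x))
      ≤ 1 / R * torusInt (fun x => (ρ t x - R) ^ 2) := by
    rw [← torusInt_const_mul]
    refine torusInt_mono cI (cρ.const_mul _) fun x => ?_
    have := mul_log_div_le (hρδ x) hRδ
    rw [add_sub_add_right_eq_sub] at this
    refine this.trans ?_
    rw [one_div_mul_eq_div]
    exact div_le_div_of_nonneg_left (sq_nonneg _) hR (by linarith)
  have l3 : γ * (N / 2) ^ (γ - 1) / (4 * B) * torusInt (fun x => (n t x - N) ^ 2)
      ≤ torusInt fun x => entropyPow γ N (n t x) := by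
    rw [← torusInt_const_mul]
    exact torusInt_mono (cn.const_mul _) cP fun x => le_entropyPow hγ hN hNB (h.n_mem t ht x)
  have l4 : torusInt (fun x => entropyPow γ N (n t x))
      ≤ γ ^ 2 * B ^ (γ - 1) / (N * (γ - 1)) * torusInt (fun x => (n t x - N) ^ 2) := by
    rw [← torusInt_const_mul]
    exact torusInt_mono cP (cn.const_mul _) fun x => entropyPow_le hγ hN hNB (h.n_mem t ht x)
  simp only [relEnergy]
  constructor <;> linarith

lemma abs_cross_add_cross_le (h : IsBoundedSolution γ μ lam A B R N U ρ u n v w) (k : ℕ) {t : ℝ}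
    (ht : 0 ≤ t) :
    |cross k (fun x => ρ t x - R) (fun i => relMom ρ u w i t)
        + cross k (fun x => n t x - N) (fun i => relMom n v w i t)|
      ≤ fluct R N (ρ t) (n t) + (A + B) * (kin (ρ t) (u t) w + kin (n t) (v t) w) := by
  have ρc := h.sol.ρ_C1.continuous_slice ht
  have nc := h.sol.n_C1.continuous_slice ht
  have uc := h.sol.u_C1.continuous_slice ht
  have vc := h.sol.v_C1.continuous_slice ht
  have uci := continuous_apply_vel uc
  have vci := continuous_apply_vel vc
  have x1 := abs_cross_le (f := fun x => ρ t x - R) (q := fun i => relMom ρ u w i t) (by fun_prop)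
    (fun i => ρc.mul ((uci i).sub continuous_const)) k
  have x2 := abs_cross_le (f := fun x => n t x - N) (q := fun i => relMom n v w i t) (by fun_prop)
    (fun i => nc.mul ((vci i).sub continuous_const)) k
  have y1 := sum_torusInt_relMom_sq_le w ρc uc (h.ρ_mem t ht)
  have y2 := sum_torusInt_relMom_sq_le w nc vc (h.n_mem t ht)
  have hA : 0 ≤ A := (h.ρ_mem t ht 0).1.trans (h.ρ_mem t ht 0).2
  have hB : 0 ≤ B := (h.n_mem t ht 0).1.trans (h.n_mem t ht 0).2
  have m1 := mul_nonneg hB (h.kin_nonneg_ρ ht w)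
  have m2 := mul_nonneg hA (h.kin_nonneg_n ht w)
  refine (abs_add_le _ _).trans ?_
  simp only [fluct]
  linarith

end IsBoundedSolution

/-! ### Exponential decay -/

lemma torusInt_le_of_le_cube {f : Coord → ℝ} (hf : Continuous f) {c : ℝ}
    (h : ∀ x ∈ Icc (0 : Coord) 1, f x ≤ c) : torusInt f ≤ c := by
  rw [← torusInt_const c]
  exact setIntegral_mono_on (integrableOn_cube hf) (integrableOn_cube continuous_const)
    measurableSet_Icc h

lemma exists_gradSq_le {f : ℝ → Coord → ℝ} (hf : IsC1 f) {a b : ℝ} (ha : 0 < a) :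
    ∃ K, ∀ t ∈ Icc a b, gradSq (f t) ≤ K := by
  choose K _ hK using fun i => exists_bound_cube (b := b)
    (h := fun t => pd i (f t)) (hf.continuousOn_pd i) ha
  refine ⟨∑ i, K i ^ 2, fun t ht => Finset.sum_le_sum fun i _ => ?_⟩
  refine torusInt_le_of_le_cube
    ((continuous_pd (hf.contDiff_slice (ha.trans_le ht.1)) i).pow 2) fun x hx => ?_
  exact sq_le_sq' (abs_le.1 (hK i t ht x hx)).1 (abs_le.1 (hK i t ht x hx)).2

lemma exists_nat_div_sq_le (K : ℝ) {e : ℝ} (he : 0 < e) :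
    ∃ k₀ : ℕ, ∀ k : ℕ, k₀ ≤ k → 0 < k → K / (4 * (k : ℝ) ^ 2) ≤ e := by
  obtain ⟨k₀, hk⟩ := exists_nat_ge (K / e)
  refine ⟨k₀, fun k hk0 hpos => ?_⟩
  have h1 : (1 : ℝ) ≤ k := by exact_mod_cast hpos
  have h2 : K / e ≤ k := hk.trans (by exact_mod_cast hk0)
  rw [div_le_iff₀ he] at h2
  rw [div_le_iff₀ (by positivity)]
  nlinarith [mul_nonneg he.le (sub_nonneg.2 h1), mul_nonneg (mul_nonneg he.le (sub_nonneg.2 h1))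
    (zero_le_one.trans h1)]

/-- With `K` a bound of the divergence and `A` one of the density, this makes the error of the
regularized entropy small: `δ log δ` tends to zero with `δ`. -/
lemma exists_delta (A K : ℝ) {e : ℝ} (he : 0 < e) :
    ∃ δ : ℝ, 0 < δ ∧ δ ≤ 1 ∧ δ * (A - Real.log δ) * K ≤ e := by
  have hc : Continuous fun δ : ℝ => (δ * A - δ * Real.log δ) * K :=
    ((continuous_mul_const A).sub Real.continuous_mul_log).mul continuous_const
  have h0 : Filter.Tendsto (fun δ : ℝ => (δ * A - δ * Real.log δ) * K) (nhdsWithin 0 (Ioi 0))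
      (nhds 0) := by
    have := (hc.tendsto 0).mono_left (nhdsWithin_le_nhds (s := Ioi 0))
    simpa using this
  obtain ⟨δ, h1, h2⟩ := ((h0.eventually_lt_const he).and
    (Ioc_mem_nhdsGT (zero_lt_one (α := ℝ)))).exists
  exact ⟨δ, h2.1, h2.2, by rw [mul_sub]; exact h1.le⟩

/-- Grönwall's inequality with a constant error. -/
lemma le_of_hasDerivAt_le {F : ℝ → ℝ} {a b c e : ℝ} (hab : a ≤ b) (hc : 0 < c) (he : 0 ≤ e)
    (hF : ∀ t ∈ Icc a b, ∃ F', HasDerivAt F F' t ∧ F' ≤ -(c * F t) + e) :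
    F b ≤ Real.exp (-c * (b - a)) * F a + e / c := by
  choose! F' hF' hle using hF
  have hE : ∀ t, HasDerivAt (fun s => Real.exp (c * s)) (Real.exp (c * t) * c) t := fun t => by
    simpa using ((hasDerivAt_id t).const_mul c).exp
  have hd : ∀ t ∈ Icc a b, HasDerivAt (fun s => Real.exp (c * s) * (F s - e / c))
      (Real.exp (c * t) * c * (F t - e / c) + Real.exp (c * t) * F' t) t := fun t ht =>
    (hE t).fun_mul ((hF' t ht).sub_const _)
  have hanti : AntitoneOn (fun s => Real.exp (c * s) * (F s - e / c)) (Icc a b) := by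
    refine antitoneOn_of_deriv_nonpos (convex_Icc a b)
      (fun t ht => (hd t ht).continuousAt.continuousWithinAt)
      (fun t ht => (hd t (interior_subset ht)).differentiableAt.differentiableWithinAt)
      fun t ht => ?_
    rw [(hd t (interior_subset ht)).deriv]
    have h1 := hle t (interior_subset ht)
    have h2 : Real.exp (c * t) * c * (F t - e / c) + Real.exp (c * t) * F' t
        = Real.exp (c * t) * (c * F t - e + F' t) := by field_simp
    rw [h2]
    exact mul_nonpos_of_nonneg_of_nonpos (Real.exp_pos _).le (by linarith)
  have h := hanti (left_mem_Icc.2 hab) (right_mem_Icc.2 hab) hab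
  simp only at h
  have h3 : Real.exp (c * a) = Real.exp (c * b) * Real.exp (-c * (b - a)) := by
    rw [← Real.exp_add]; congr 1; ring
  rw [h3, mul_assoc] at h
  have h4 := le_of_mul_le_mul_left h (Real.exp_pos _)
  have h5 : 0 ≤ Real.exp (-c * (b - a)) * (e / c) := by positivity
  linarith

namespace IsBoundedSolution

variable {γ μ lam A B R N U : ℝ} {ρ : ℝ → Coord → ℝ} {u : ℝ → Coord → Vel}
  {n : ℝ → Coord → ℝ} {v : ℝ → Coord → Vel} {w : Vel}

/-- The error term in the energy balance can be made small uniformly on a compact time interval. -/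
lemma exists_entropy_error (h : IsBoundedSolution γ μ lam A B R N U ρ u n v w) (hR : 0 < R)
    (hRA : R ≤ A) {a b e : ℝ} (ha : 0 < a) (he : 0 < e) :
    ∃ δ : ℝ, 0 < δ ∧ δ ≤ 1 ∧ ∀ t ∈ Icc a b,
      δ * torusInt (fun x => Real.log ((ρ t x + δ) / (R + δ)) * div (u t) x) ≤ e := by
  have hdiv : ContinuousOn (fun p : ℝ × Coord => div (u p.1) p.2) (Ioi 0 ×ˢ univ) :=
    continuousOn_finsetSum _ fun j _ => (h.sol.u_C1.apply j).continuousOn_pd j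
  obtain ⟨K, hK0, hK⟩ := exists_bound_cube (b := b) (h := fun t => div (u t)) hdiv ha
  obtain ⟨δ, hδ, hδ1, hδe⟩ := exists_delta A K he
  refine ⟨δ, hδ, hδ1, fun t ht => ?_⟩
  have ht0 : 0 < t := ha.trans_le ht.1
  have ρc := h.sol.ρ_C1.continuous_slice ht0.le
  have hρδ : ∀ x, 0 < ρ t x + δ := fun x => add_pos_of_nonneg_of_pos (h.ρ_mem t ht0.le x).1 hδ
  have hRδ := add_pos hR hδ
  have hlog : Continuous fun x => Real.log ((ρ t x + δ) / (R + δ)) :=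
    ((ρc.add continuous_const).div_const _).log fun x => (div_pos (hρδ x) hRδ).ne'
  have hdu : Continuous (div (u t)) :=
    continuous_div fun j => (h.sol.u_C1.apply j).contDiff_slice ht0
  have hl : ∀ y, 0 ≤ y → y ≤ A → Real.log δ ≤ Real.log (y + δ) ∧ Real.log (y + δ) ≤ A := by
    intro y hy0 hyA
    refine ⟨Real.log_le_log hδ (by linarith), ?_⟩
    have := Real.log_le_sub_one_of_pos (by linarith : 0 < y + δ)
    linarith
  have hprod : Continuous fun x => Real.log ((ρ t x + δ) / (R + δ)) * div (u t) x := hlog.mul hdu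
  refine le_trans ?_ hδe
  rw [mul_assoc]
  refine mul_le_mul_of_nonneg_left (torusInt_le_of_le_cube hprod fun x hx => ?_) hδ.le
  obtain ⟨l1, l2⟩ := hl _ (h.ρ_mem t ht0.le x).1 (h.ρ_mem t ht0.le x).2
  obtain ⟨l3, l4⟩ := hl R hR.le hRA
  rw [Real.log_div (hρδ x).ne' hRδ.ne']
  have habs : |Real.log (ρ t x + δ) - Real.log (R + δ)| ≤ A - Real.log δ :=
    abs_le.2 ⟨by linarith, by linarith⟩
  exact (le_abs_self _).trans ((abs_mul _ _).trans_le
    (mul_le_mul habs (hK t ht x hx) (abs_nonneg _) ((abs_nonneg _).trans habs)))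

/-- The truncation error in the compensating functional can be made small uniformly on a compact
time interval. -/
lemma exists_cross_error (h : IsBoundedSolution γ μ lam A B R N U ρ u n v w) (hγ : 1 < γ)
    {a b e : ℝ} (ha : 0 < a) (he : 0 < e) :
    ∃ k : ℕ, 0 < k ∧ ∀ t ∈ Icc a b,
      gradSq (fun x => ρ t x + ρ t x) / (4 * (k : ℝ) ^ 2) ≤ e ∧
      gradSq (fun x => n t x + n t x ^ γ) / (4 * (k : ℝ) ^ 2) ≤ e := by
  obtain ⟨K₁, h1⟩ := exists_gradSq_le (b := b) (h.sol.ρ_C1.add h.sol.ρ_C1) ha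
  obtain ⟨K₂, h2⟩ := exists_gradSq_le (b := b) (h.sol.n_C1.add (h.sol.n_C1.rpow hγ)) ha
  obtain ⟨k₁, hk1⟩ := exists_nat_div_sq_le K₁ he
  obtain ⟨k₂, hk2⟩ := exists_nat_div_sq_le K₂ he
  refine ⟨k₁ + k₂ + 1, by omega, fun t ht => ⟨?_, ?_⟩⟩
  · exact (div_le_div_of_nonneg_right (h1 t ht) (by positivity)).trans
      (hk1 _ (by omega) (by omega))
  · exact (div_le_div_of_nonneg_right (h2 t ht) (by positivity)).trans
      (hk2 _ (by omega) (by omega))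

end IsBoundedSolution

/-- Exponential decay of the relative energy, with constants depending only on the parameters and
the bounds. -/
theorem exists_decay {γ μ lam A B R N U : ℝ} (hγ : 1 < γ) (hμ : 0 < μ) (hlam : 0 < lam + 2 * μ)
    (hR : 0 < R) (hN : 0 < N) (hRA : R ≤ A) (hNB : N ≤ B) :
    ∃ K c : ℝ, 0 < K ∧ 0 < c ∧ ∀ (ρ : ℝ → Coord → ℝ) (u : ℝ → Coord → Vel) (n : ℝ → Coord → ℝ)
      (v : ℝ → Coord → Vel) (w : Vel), IsBoundedSolution γ μ lam A B R N U ρ u n v w →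
      ∀ a b, 0 < a → a ≤ b →
        kin (ρ b) (u b) w + kin (n b) (v b) w + fluct R N (ρ b) (n b)
          ≤ K * Real.exp (-c * (b - a))
            * (kin (ρ a) (u a) w + kin (n a) (v a) w + fluct R N (ρ a) (n a)) := by
  have hg : 0 < γ - 1 := sub_pos.2 hγ
  have hA : 0 < A := hR.trans_le hRA
  have hB : 0 < B := hN.trans_le hNB
  have hNp : 0 < N ^ (γ - 1) := Real.rpow_pos_of_pos hN _
  -- `ν` is the rate of dissipation, `C₂` bounds the kinetic energy by the dissipation, and `C₃`
  -- collects the terms of the compensating functional that the dissipation has to absorb.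
  obtain ⟨κ, hκ, hκ1, hκN⟩ : ∃ κ : ℝ, 0 < κ ∧ κ ≤ 1 ∧ κ ≤ N ^ (γ - 1) :=
    ⟨min 1 (N ^ (γ - 1)), lt_min one_pos hNp, min_le_left _ _, min_le_right _ _⟩
  obtain ⟨ν, hν, hν1, hνμ, hνlam⟩ : ∃ ν : ℝ, 0 < ν ∧ ν ≤ 1 ∧ ν ≤ μ ∧ ν ≤ lam + 2 * μ :=
    ⟨min 1 (min μ (lam + 2 * μ)), lt_min one_pos (lt_min hμ hlam), min_le_left _ _,
      (min_le_right _ _).trans (min_le_left _ _), (min_le_right _ _).trans (min_le_right _ _)⟩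
  obtain ⟨h₁, hh1, hh1a, hh1b, hh1c⟩ : ∃ h₁ : ℝ, 0 < h₁ ∧ h₁ ≤ 1 / 2 ∧ h₁ ≤ 1 / (4 * (A + 1)) ∧
      h₁ ≤ γ * (N / 2) ^ (γ - 1) / (4 * B) := by
    refine ⟨min (1 / 2) (min (1 / (4 * (A + 1))) (γ * (N / 2) ^ (γ - 1) / (4 * B))), ?_,
      min_le_left _ _, (min_le_right _ _).trans (min_le_left _ _),
      (min_le_right _ _).trans (min_le_right _ _)⟩
    have := Real.rpow_pos_of_pos (half_pos hN) (γ - 1)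
    exact lt_min (by norm_num) (lt_min (by positivity) (by positivity))
  obtain ⟨h₂, hh2, hh2a, hh2b, hh2c⟩ : ∃ h₂ : ℝ, 0 < h₂ ∧ 1 / 2 ≤ h₂ ∧ 1 / R ≤ h₂ ∧
      γ ^ 2 * B ^ (γ - 1) / (N * (γ - 1)) ≤ h₂ := by
    refine ⟨max (1 / 2) (max (1 / R) (γ ^ 2 * B ^ (γ - 1) / (N * (γ - 1)))), ?_,
      le_max_left _ _, (le_max_left _ _).trans (le_max_right _ _),
      (le_max_right _ _).trans (le_max_right _ _)⟩
    exact lt_max_of_lt_left (by norm_num)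
  obtain ⟨C₂, hC2, hC2a, hC2b⟩ : ∃ C₂ : ℝ, 0 < C₂ ∧ 2 ≤ C₂ ∧ 2 * A + B ≤ C₂ :=
    ⟨2 + (2 * A + B), by positivity, by linarith, by linarith⟩
  set C₃ : ℝ := (A + B) * C₂ + (κ / 2)⁻¹ * ((A + B) * U ^ 2 * C₂ + (2 * μ + lam) ^ 2 + 2 * A)
    with hC3
  have hC3p : 0 < C₃ := by positivity
  obtain ⟨η, hη, hη1, hη2⟩ : ∃ η : ℝ, 0 < η ∧ η * C₃ ≤ ν / 2 ∧ η * (1 + A + B) ≤ h₁ / 2 := by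
    refine ⟨min (ν / 2 / C₃) (h₁ / 2 / (1 + A + B)), lt_min (by positivity) (by positivity), ?_, ?_⟩
    · rw [← le_div_iff₀ hC3p]; exact min_le_left _ _
    · rw [← le_div_iff₀ (by positivity)]; exact min_le_right _ _
  obtain ⟨c₄, hc4, hc4a, hc4b⟩ : ∃ c₄ : ℝ, 0 < c₄ ∧ c₄ * C₂ ≤ ν / 2 ∧ c₄ ≤ η * (κ / 2) := by
    refine ⟨min (ν / 2 / C₂) (η * (κ / 2)), lt_min (by positivity) (by positivity), ?_,
      min_le_right _ _⟩
    rw [← le_div_iff₀ hC2]; exact min_le_left _ _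
  set c₆ : ℝ := h₂ + h₁ / 2 with hc6
  have hc6p : 0 < c₆ := by positivity
  have hcp : 0 < c₄ / c₆ := by positivity
  refine ⟨c₆ / (h₁ / 2), c₄ / c₆, by positivity, hcp, ?_⟩
  intro ρ u n v w h a b ha hab
  set E : ℝ → ℝ := fun t => kin (ρ t) (u t) w + kin (n t) (v t) w + fluct R N (ρ t) (n t) with hE
  have key : ∀ e : ℝ, 0 < e → h₁ / 2 * E b
      ≤ Real.exp (-(c₄ / c₆) * (b - a)) * (c₆ * E a) + (e + η * (e + e)) / (c₄ / c₆) := by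
    intro e he
    obtain ⟨δ, hδ, hδ1, hδe⟩ := h.exists_entropy_error (b := b) hR hRA ha he
    obtain ⟨k, hk, hke⟩ := h.exists_cross_error (b := b) hγ ha he
    set X : ℝ → ℝ := fun t => cross k (fun x => ρ t x - R) (fun i => relMom ρ u w i t)
        + cross k (fun x => n t x - N) (fun i => relMom n v w i t) with hX
    set F : ℝ → ℝ := fun t => relEnergy γ δ R N (ρ t) (u t) (n t) (v t) w + η * X t with hF
    have hbd : ∀ t, 0 < t → h₁ / 2 * E t ≤ F t ∧ F t ≤ c₆ * E t := by
      intro t ht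
      obtain ⟨b1, b2⟩ := h.relEnergy_bounds hγ hR hN hRA hNB hδ hδ1 ht.le
      have b3 := abs_le.1 (h.abs_cross_add_cross_le k ht.le)
      have k1 := h.kin_nonneg_ρ ht.le w
      have k2 := h.kin_nonneg_n ht.le w
      have q1 : 0 ≤ torusInt fun x => (ρ t x - R) ^ 2 := torusInt_nonneg fun x => sq_nonneg _
      have q2 : 0 ≤ torusInt fun x => (n t x - N) ^ 2 := torusInt_nonneg fun x => sq_nonneg _
      have k3 := add_nonneg k1 k2
      simp only [hE, hF, hX, fluct] at b3 ⊢
      generalize cross k (fun x => ρ t x - R) (fun i => relMom ρ u w i t)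
        + cross k (fun x => n t x - N) (fun i => relMom n v w i t) = x at *
      generalize kin (ρ t) (u t) w + kin (n t) (v t) w = y at *
      generalize torusInt (fun x => (ρ t x - R) ^ 2) = y₁ at *
      generalize torusInt (fun x => (n t x - N) ^ 2) = y₂ at *
      have g1 : (y₁ + y₂ + (A + B) * y) ≤ (1 + A + B) * (y + (y₁ + y₂)) := by
        linarith [mul_nonneg (add_pos hA hB).le (add_nonneg q1 q2)]
      have g2 := (mul_le_mul_of_nonneg_left g1 hη.le).trans
        ((mul_assoc _ _ _).symm.trans_le (mul_le_mul_of_nonneg_right hη2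
          (add_nonneg k3 (add_nonneg q1 q2))))
      have g3 := mul_le_mul_of_nonneg_left b3.1 hη.le
      have g4 := mul_le_mul_of_nonneg_left b3.2 hη.le
      have e1 := mul_le_mul_of_nonneg_right hh1a k3
      have e2 := mul_le_mul_of_nonneg_right hh1b q1
      have e3 := mul_le_mul_of_nonneg_right hh1c q2
      have e4 := mul_le_mul_of_nonneg_right hh2a k3
      have e5 := mul_le_mul_of_nonneg_right hh2b q1
      have e6 := mul_le_mul_of_nonneg_right hh2c q2
      rw [hc6]
      constructor <;> linarith
    have hder : ∀ t ∈ Icc a b, ∃ F', HasDerivAt F F' t ∧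
        F' ≤ -(c₄ / c₆ * F t) + (e + η * (e + e)) := by
      intro t ht
      have ht0 : 0 < t := ha.trans_le ht.1
      obtain ⟨X', hX', hX'le⟩ := h.exists_hasDerivAt_cross hγ hN hκ hκ1 hκN ht0 hk
      refine ⟨_, (h.hasDerivAt_relEnergy hγ hR hN hδ ht0).add (hX'.const_mul η), ?_⟩
      obtain ⟨k1, k2⟩ := hke t ht
      have hFE := (hbd t ht0).2
      have hδt := hδe t ht
      have hv1 : ∀ j, ContDiff ℝ 1 fun x => v t x j := fun j =>
        (h.sol.v_C1.apply j).contDiff_slice ht0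
      have hvp : ∀ j, IsTorusFun fun x => v t x j := fun j =>
        (h.sol.v_C1.apply j).periodic t ht0.le
      have d1 := torusInt_div_sq_le hv1 hvp
      have d2 := kin_add_kin_le_dissipation (h.sol.ρ_C1.continuous_slice ht0.le)
        (h.sol.n_C1.continuous_slice ht0.le) (h.sol.u_C1.continuous_slice ht0.le) hv1
        (h.sol.v_C1.continuous_slice ht0.le) hvp (h.ρ_mem t ht0.le) (h.n_mem t ht0.le)
        (h.momentum t ht0.le)
      have d3 : 0 ≤ torusInt fun x => ρ t x * ‖u t x - v t x‖ ^ 2 :=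
        torusInt_nonneg fun x => mul_nonneg (h.ρ_mem t ht0.le x).1 (sq_nonneg _)
      have d4 : 0 ≤ torusInt fun x => div (v t) x ^ 2 := torusInt_nonneg fun x => sq_nonneg _
      have hΦ : 0 ≤ fluct R N (ρ t) (n t) := add_nonneg (torusInt_nonneg fun x => sq_nonneg _)
        (torusInt_nonneg fun x => sq_nonneg _)
      have hEt : E t = kin (ρ t) (u t) w + kin (n t) (v t) w + fluct R N (ρ t) (n t) := rfl
      generalize kin (ρ t) (u t) w + kin (n t) (v t) w = y at *
      generalize fluct R N (ρ t) (n t) = Φ at *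
      generalize torusInt (fun x => ρ t x * ‖u t x - v t x‖ ^ 2) = S at *
      generalize torusInt (fun x => div (v t) x ^ 2) = Z at *
      generalize ∑ i, gradSq (fun x => v t x i) = G at *
      have hG0 : 0 ≤ G := d4.trans d1
      have hvisc : ν * G ≤ μ * G + (μ + lam) * Z := by
        rcases le_total 0 (μ + lam) with hs | hs
        · linarith [mul_le_mul_of_nonneg_right hνμ hG0, mul_nonneg hs d4]
        · linarith [mul_le_mul_of_nonneg_right hνlam hG0, mul_le_mul_of_nonpos_left d1 hs]
      have hS : ν * S ≤ S := mul_le_of_le_one_left d3 hν1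
      have hy : y ≤ C₂ * (S + G) := by
        linarith [mul_le_mul_of_nonneg_right hC2a d3, mul_le_mul_of_nonneg_right hC2b hG0]
      have hAB : 0 ≤ A + B := (add_pos hA hB).le
      have t1 := mul_le_mul_of_nonneg_left hy hAB
      have t2 := mul_le_mul_of_nonneg_left hy (mul_nonneg hAB (sq_nonneg U))
      have t3 : (2 * μ + lam) ^ 2 * Z ≤ (2 * μ + lam) ^ 2 * (S + G) :=
        mul_le_mul_of_nonneg_left (by linarith) (sq_nonneg _)
      have t4 : 2 * A * S ≤ 2 * A * (S + G) :=
        mul_le_mul_of_nonneg_left (by linarith) (by positivity)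
      have t5 := mul_le_mul_of_nonneg_left (add_le_add (add_le_add t2 t3) t4)
        (inv_pos.2 (half_pos hκ)).le
      have hXC : X' ≤ -(κ / 2 * Φ) + C₃ * (S + G) + (e + e) := by
        rw [hC3]; linarith
      have hη3 := mul_le_mul_of_nonneg_left hXC hη.le
      have hη4 := mul_le_mul_of_nonneg_right hη1 (add_nonneg d3 hG0)
      have hc := mul_le_mul_of_nonneg_left hy hc4.le
      have hc' := mul_le_mul_of_nonneg_right hc4a (add_nonneg d3 hG0)
      have hc'' := mul_le_mul_of_nonneg_right hc4b hΦ
      have hFc : c₄ / c₆ * F t ≤ c₄ * (y + Φ) := by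
        rw [div_mul_eq_mul_div, div_le_iff₀ hc6p, mul_assoc, ← hEt]
        exact mul_le_mul_of_nonneg_left (by linarith) hc4.le
      linarith
    have hG := le_of_hasDerivAt_le hab hcp (by positivity) hder
    have f1 := (hbd b (ha.trans_le hab)).1
    have f2 := mul_le_mul_of_nonneg_left (hbd a ha).2 (Real.exp_pos (-(c₄ / c₆) * (b - a))).le
    linarith
  have hlim : h₁ / 2 * E b ≤ Real.exp (-(c₄ / c₆) * (b - a)) * (c₆ * E a) := by
    refine le_of_forall_pos_le_add fun e he => ?_
    have hp : 0 < e * (c₄ / c₆) / (1 + 2 * η) := by positivity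
    refine (key _ hp).trans_eq ?_
    congr 1
    field_simp
    ring
  have hh : 0 < h₁ / 2 := half_pos hh1
  have : E b ≤ c₆ / (h₁ / 2) * Real.exp (-(c₄ / c₆) * (b - a)) * E a := by
    rw [div_mul_eq_mul_div, div_mul_eq_mul_div, le_div_iff₀ hh]
    linarith
  exact this

/-! ### Decay up to the initial time -/

lemma lyapunov_eq {r m : Coord → ℝ} {R N : ℝ} (hR : mass r = R) (hN : mass m = N)
    (u v : Coord → Vel) : lyapunov r u m v = lyapunovKin r u m v + fluct R N r m := by
  rw [lyapunov, lyapunovKin, fluct, kin, kin, hR, hN]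
  ring

lemma fluct_nonneg (R N : ℝ) (r m : Coord → ℝ) : 0 ≤ fluct R N r m :=
  add_nonneg (torusInt_nonneg fun _ => sq_nonneg _) (torusInt_nonneg fun _ => sq_nonneg _)

lemma continuousOn_kin {r : ℝ → Coord → ℝ} {z : ℝ → Coord → Vel} (hr : IsC1 r) (hz : IsC1 z)
    (w : Vel) : ContinuousOn (fun t => kin (r t) (z t) w) (Ici 0) :=
  continuousOn_torusInt_of_continuousOn (f := fun t x => r t x * ‖z t x - w‖ ^ 2)
    (hr.cont.mul ((hz.cont.sub continuousOn_const).norm.pow 2))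

lemma continuousOn_fluct {r m : ℝ → Coord → ℝ} (hr : IsC1 r) (hm : IsC1 m) (R N : ℝ) :
    ContinuousOn (fun t => fluct R N (r t) (m t)) (Ici 0) :=
  (continuousOn_torusInt_of_continuousOn (f := fun t x => (r t x - R) ^ 2)
    ((hr.cont.sub continuousOn_const).pow 2)).add
  (continuousOn_torusInt_of_continuousOn (f := fun t x => (m t x - N) ^ 2)
    ((hm.cont.sub continuousOn_const).pow 2))

/-- An exponential decay estimate between positive times extends to the initial time. -/
lemma le_exp_mul_of_continuousOn {E : ℝ → ℝ} {K c : ℝ} (hE : ContinuousOn E (Ici 0))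
    (h : ∀ a b, 0 < a → a ≤ b → E b ≤ K * Real.exp (-c * (b - a)) * E a) {t : ℝ} (ht : 0 < t) :
    E t ≤ K * Real.exp (-c * t) * E 0 := by
  have hlim : Filter.Tendsto (fun a => K * Real.exp (-c * (t - a)) * E a) (nhdsWithin 0 (Ioi 0))
      (nhds (K * Real.exp (-c * (t - 0)) * E 0)) := by
    have h1 : Continuous fun a => K * Real.exp (-c * (t - a)) := by fun_prop
    exact (h1.continuousWithinAt (x := 0)).mul
      ((hE 0 self_mem_Ici).mono Ioi_subset_Ici_self)
  rw [sub_zero] at hlim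
  refine ge_of_tendsto hlim ?_
  filter_upwards [Ioo_mem_nhdsGT ht] with a ha using h a t ha.1 ha.2.le

/-- Exponential decay of the Lyapunov functional, without any smallness of the initial energy. -/
theorem exists_lyapunov_decay {γ μ lam A B R N : ℝ} (hγ : 1 < γ) (hμ : 0 < μ)
    (hlam : 0 < lam + 2 * μ) (hR : 0 < R) (hN : 0 < N) (M : ℝ) :
    ∃ K c : ℝ, 0 < K ∧ 0 < c ∧ ∀ (ρ : ℝ → Coord → ℝ) (u : ℝ → Coord → Vel) (n : ℝ → Coord → ℝ)
      (v : ℝ → Coord → Vel), IsGlobalClassicalSolution γ μ lam ρ u n v →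
      (∀ t, 0 ≤ t → ∀ x, ρ t x ∈ Icc 0 A) → (∀ t, 0 ≤ t → ∀ x, n t x ∈ Icc 0 B) →
      mass (ρ 0) = R → mass (n 0) = N →
      (∀ t, 0 ≤ t → ∀ x, ‖u t x‖ ≤ M) → (∀ t, 0 ≤ t → ∀ x, ‖v t x‖ ≤ M) →
      ∀ t, 0 ≤ t → lyapunov (ρ t) (u t) (n t) (v t)
        ≤ K * lyapunov (ρ 0) (u 0) (n 0) (v 0) * Real.exp (-c * t) := by
  -- Enlarging the bounds makes them admissible for `exists_decay`, whatever the masses are.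
  obtain ⟨K, c, hK, hc, H⟩ := exists_decay (U := 2 * M) hγ hμ hlam hR hN (le_max_right A R)
    (le_max_right B N)
  have hD : 1 ≤ 1 + 2 / R + 2 / N := by
    have : 0 < 2 / R + 2 / N := by positivity
    linarith
  set D := 1 + 2 / R + 2 / N with hDdef
  refine ⟨D * K * (1 + N) + 1, c, by positivity, hc, ?_⟩
  intro ρ u n v h hρ hn hρm hnm hu hv t ht
  obtain ⟨w, hw⟩ := h.exists_isBoundedSolution (A := max A R) (B := max B N) hγ hR hN
    (fun t ht x => ⟨(hρ t ht x).1, (hρ t ht x).2.trans (le_max_left _ _)⟩)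
    (fun t ht x => ⟨(hn t ht x).1, (hn t ht x).2.trans (le_max_left _ _)⟩) hρm hnm hu hv
  set E : ℝ → ℝ := fun t => kin (ρ t) (u t) w + kin (n t) (v t) w + fluct R N (ρ t) (n t) with hE
  have hEc : ContinuousOn E (Ici 0) :=
    ((continuousOn_kin h.ρ_C1 h.u_C1 w).add (continuousOn_kin h.n_C1 h.v_C1 w)).add
      (continuousOn_fluct h.ρ_C1 h.n_C1 R N)
  have hL0 : 0 ≤ lyapunov (ρ 0) (u 0) (n 0) (v 0) := by
    rw [lyapunov_eq hρm hnm, lyapunovKin]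
    have k1 := kin_nonneg (fun x => (hρ 0 le_rfl x).1) (u 0) (meanVel (ρ 0) (u 0))
    have k2 := kin_nonneg (fun x => (hn 0 le_rfl x).1) (v 0) (meanVel (n 0) (v 0))
    have k3 := fluct_nonneg R N (ρ 0) (n 0)
    positivity
  rcases ht.eq_or_lt with rfl | ht0
  · rw [mul_zero, Real.exp_zero, mul_one]
    have : 0 ≤ D * K * (1 + N) := by positivity
    exact le_mul_of_one_le_left hL0 (by linarith)
  have hup : lyapunov (ρ t) (u t) (n t) (v t) ≤ D * E t := by
    rw [lyapunov_eq (hw.mass_ρ t ht) (hw.mass_n t ht)]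
    have := lyapunovKin_le (h.ρ_C1.continuous_slice ht) (h.n_C1.continuous_slice ht)
      (h.u_C1.continuous_slice ht) (h.v_C1.continuous_slice ht) (fun x => (hρ t ht x).1)
      (fun x => (hn t ht x).1) (hw.mass_ρ t ht) (hw.mass_n t ht) hR hN w
    have hf := le_mul_of_one_le_left (fluct_nonneg R N (ρ t) (n t)) hD
    simp only [hE]
    linarith
  have hlow : E 0 ≤ (1 + N) * lyapunov (ρ 0) (u 0) (n 0) (v 0) := by
    rw [lyapunov_eq hρm hnm]
    have := kin_add_kin_le_lyapunovKin (h.ρ_C1.continuous_slice le_rfl)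
      (h.n_C1.continuous_slice le_rfl) (h.u_C1.continuous_slice le_rfl)
      (h.v_C1.continuous_slice le_rfl) (fun x => (hρ 0 le_rfl x).1)
      (fun x => (hn 0 le_rfl x).1) hnm hN (hw.momentum 0 le_rfl)
    have hf := mul_nonneg hN.le (fluct_nonneg R N (ρ 0) (n 0))
    simp only [hE]
    linarith
  have hdec : E t ≤ K * Real.exp (-c * t) * E 0 :=
    le_exp_mul_of_continuousOn hEc (fun a b => H ρ u n v w hw a b) ht0
  calc lyapunov (ρ t) (u t) (n t) (v t) ≤ D * E t := hup
    _ ≤ D * (K * Real.exp (-c * t) * ((1 + N) * lyapunov (ρ 0) (u 0) (n 0) (v 0))) := by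
      refine mul_le_mul_of_nonneg_left (hdec.trans ?_) (by linarith)
      exact mul_le_mul_of_nonneg_left hlow (by positivity)
    _ = D * K * (1 + N) * lyapunov (ρ 0) (u 0) (n 0) (v 0) * Real.exp (-c * t) := by ring
    _ ≤ (D * K * (1 + N) + 1) * lyapunov (ρ 0) (u 0) (n 0) (v 0) * Real.exp (-c * t) := by
      gcongr
      linarith

end

end TwoPhase

theorem theorem1p2 (γ μ lam : ℝ) (hγ : 1 < γ) (hμ : 0 < μ) (hlam : 0 < lam + 2 * μ)
    (ρbar nbar : ℝ) (hρbar : 0 < ρbar) (hnbar : 0 < nbar)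
    (ρc nc : ℝ) (hρc : 0 < ρc) (hnc : 0 < nc) :
    ∃ ε : ℝ, 0 < ε ∧ ∀ M : ℝ, ∃ K C : ℝ, 0 < K ∧ 0 < C ∧
      ∀ (ρ : ℝ → TwoPhase.Coord → ℝ) (u : ℝ → TwoPhase.Coord → TwoPhase.Vel)
        (n : ℝ → TwoPhase.Coord → ℝ) (v : ℝ → TwoPhase.Coord → TwoPhase.Vel),
        TwoPhase.IsGlobalClassicalSolution γ μ lam ρ u n v →
        (∀ t, 0 ≤ t → ∀ x, ρ t x ∈ Set.Icc 0 ρbar) →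
        (∀ t, 0 ≤ t → ∀ x, n t x ∈ Set.Icc 0 nbar) →
        TwoPhase.mass (ρ 0) = ρc →
        TwoPhase.mass (n 0) = nc →
        (∀ t, 0 ≤ t → ∀ x, ‖u t x‖ ≤ M) →
        (∀ t, 0 ≤ t → ∀ x, ‖v t x‖ ≤ M) →
        TwoPhase.energy (ρ 0) (u 0) (n 0) (v 0) ≤ ε →
        ∀ t, 0 ≤ t →
          TwoPhase.lyapunov (ρ t) (u t) (n t) (v t)
            ≤ K * TwoPhase.lyapunov (ρ 0) (u 0) (n 0) (v 0) * Real.exp (-C * t) := by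
  refine ⟨1, one_pos, fun M => ?_⟩
  obtain ⟨K, C, hK, hC, H⟩ :=
    TwoPhase.exists_lyapunov_decay (A := ρbar) (B := nbar) hγ hμ hlam hρc hnc M
  exact ⟨K, C, hK, hC, fun ρ u n v h hρ hn hρm hnm hu hv _ => H ρ u n v h hρ hn hρm hnm hu hv⟩
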